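/- Let $I,J,L\subseteq\mathbb R$ be nonempty open intervals and $U=I\times J\times L\subseteq\mathbb R^3$ with coordinates $(x,y,z)$. Write $p=\partial_x$, $q=\partial_y$, $r=\partial_z$, and let $T=v+\eta$ ($v$ a vector field, $\eta$ a function) act on $f\in C^\infty(U)$ by $T(f)=v(f)+\eta f$. For a linear space $\mathfrak g$ of first order differential operators, a \emph{fixed module} is a finite-dimensional real subspace $\mathcal N\subseteq C^\infty(U)$ with $T(\mathcal N)\subseteq\mathcal N$ for all $T\in\mathfrak g$. It is \emph{locally nontrivial} if the functions in $\mathcal N$ do not all vanish on any nonempty open subset of $U$. Put $\mathfrak s=\{xq,\;xp-yq,\;yp\}$ and, for $c\in\mathbb R$, $\mathfrak p_c=\{p,q,xp,yq,xq,yp,\;x^2p+xyq+cx,\;xyp+y^2q+cy\}$. Below, $c,d,a\in\mathbb R$; $l$ is a nonnegative integer; $n,m$ denote nonnegative integers; $Z^1,\dots,Z^s$ and $K$ are smooth functions of $z\in L$; "$z^ke^{\lambda z}$" with $\lambda\in\mathbb C$ stands for the two real functions $\mathrm{Re}(z^ke^{\lambda z})$, $\mathrm{Im}(z^ke^{\lambda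 z})$; an \emph{exponential space} is the real span on $L$ of all $z^ke^{\lambda z}$ with $\lambda\in\Lambda$, $k\le m_\lambda$, for a finite set $\Lambda\subset\mathbb C$ and nonnegative integers $m_\lambda$. For finite-dimensional spaces $G^{(0)},\dots,G^{(n)}\subseteq C^\infty(L)$ put $\mathcal N_n(G)=\mathrm{Span}\{x^iy^jg(z): i+j\le n,\ g\in G^{(i+j)}\}$. 1. $\mathfrak g=\mathrm{Span}\{p,q,xp+K,yq+K,xq,yp,x^2p+xyq+3xK,xyp+y^2q+3yK,1\}$. If $\mathfrak g$ has a locally nontrivial fixed module, then $3K\equiv-n$ on $L$ for some $n$ (so that, modulo constants, the cocycle is given by $x^2p+xyq-nx$, $xyp+y^2q-ny$). If $3K\equiv -n$, the fixed modules are exactly the spaces $\mathcal N_n(G)$ with $G^{(l)}\subseteq G^{(l-1)}$ for $1\le l\le n$ and, in fact, $G^{(0)}=\dots=G^{(n)}$; and a space $\mathcal N_n(G)$ with $G^{(l)}\subseteq G^{(l-1)}$ for $1\le l\le n$ is a fixed module if and only if all $G^{(l)}$, $l\le n$, are equal. 2. $\mathfrak g=\mathrm{Span}(\mathfrak s\cup\{Z^ip,Z^iq\}_i\cup\{1\})$.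 The fixed modules are exactly the $\mathcal N_n(G)$ with $Z^iG^{(l)}\subseteq G^{(l-1)}$ for all $i$ and $1\le l\le n$ ($n$ arbitrary). 3. $\mathfrak g=\mathrm{Span}(\mathfrak s\cup\{Z^ip,Z^iq\}_i\cup\{xp+yq+K,1\})$. If there is a locally nontrivial fixed module then $K$ is constant on $L$ (the cocycle is $0$ modulo constants); if $K$ is constant on $L$, the fixed modules are exactly those described in 2. 4. $\mathfrak g=\mathrm{Span}(\mathfrak p_c\cup\{r,1\})$. A nonzero $\mathcal N$ is a fixed module iff $c=-n$ and $\mathcal N=\mathrm{Span}\{x^iy^jg(z): i+j\le n,\ g\in G\}$ for some $n$ and some exponential space $G$. 5. $\mathfrak g=\mathrm{Span}(\mathfrak s\cup\{\zeta p,\zeta q\}_{\zeta}\cup\{r,1\})$, $\zeta$ running over $z^ke^{\lambda z}$ with $\lambda\in\Lambda_0$, $k\le\nu_\lambda$ ($\Lambda_0\subset\mathbb C$ finite, $\nu_\lambda$ nonnegative integers). The fixed modules are exactly the $\mathcal N_n(G)$ in which every $G^{(l)}$, $l\le n$, is an exponential space and $\zeta G^{(l)}\subseteq G^{(l-1)}$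 for all $\zeta$ and $1\le l\le n$. 6. $\mathfrak g$ as in 5 with $xp+yq+cz$ added. A nonzero $\mathcal N$ is a fixed module iff $c=0$ and $\mathcal N$ is as in 5. 7. $\mathfrak g=\mathrm{Span}(\mathfrak p_c\cup\{r,zr,1\})$. A nonzero $\mathcal N$ is a fixed module iff, for some $n,m$, $c=-n$ and $\mathcal N=\mathrm{Span}\{x^iy^jz^k: i+j\le n,\ k\le m\}$. 8. $\mathfrak g=\mathrm{Span}(\mathfrak s\cup\{z^kp,z^kq\}_{k\le l}\cup\{r,\;zr+a(xp+yq),1\})$. For all $n,m$ the space $\mathrm{Span}\{x^iy^jz^k: i+j\le n,\ l(i+j)+k\le m\}$ is a fixed module. A nonzero $\mathcal N$ is a fixed module iff $\mathcal N=\mathrm{Span}\{x^iy^jz^k: i+j\le n,\ k\le\mu_{i+j}\}$ for some $n$ and some nonnegative integers $\mu_0,\mu_1,\dots$ with $l+\mu_{d+1}\le\mu_d$ for $0\le d<n$. 9. $\mathfrak g=\mathrm{Span}(\mathfrak s\cup\{z^kp,z^kq\}_{k\le l}\cup\{xp+yq,r,zr,1\})$. The same two assertions as in 8 hold. 10. $\mathfrak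 g=\mathrm{Span}(\mathfrak p_c\cup\{r,zr,z^2r+dz,1\})$. A nonzero $\mathcal N$ is a fixed module iff, for some $n,m$, $c=-n$, $d=-m$ and $\mathcal N=\mathrm{Span}\{x^iy^jz^k: i+j\le n,\ k\le m\}$. 11. $\mathfrak g=\mathrm{Span}(\mathfrak s\cup\{z^kp,z^kq\}_{k\le l}\cup\{r,\;zr+\tfrac l2(xp+yq),\;z^2r+lz(xp+yq)+cz,\;1\})$. A nonzero $\mathcal N$ is a fixed module iff, for some $n,m$, $c=-m$ and $\mathcal N=\mathrm{Span}\{x^iy^jz^k: i+j\le n,\ l(i+j)+k\le m\}$. 12. $\mathfrak g=\mathrm{Span}(\mathfrak s\cup\{z^kp,z^kq\}_{k\le l}\cup\{xp+yq,\;r,\;zr,\;z^2r+lz(xp+yq)+cz,\;1\})$. A nonzero $\mathcal N$ is a fixed module iff, for some $n,m$, $c=-m$ and $\mathcal N=\mathrm{Span}\{x^iy^jz^k: i+j\le n,\ l(i+j)+k\le m\}$. -/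

import Mathlib

open scoped ContDiff

noncomputable section

namespace QES

/-- Coordinate space with coordinates `(x, y, z)`. -/
abbrev Space : Type := ℝ × ℝ × ℝ

/-- The smooth real-valued functions on an open set `U`.  A function on `U` is represented by its
extension by zero to the whole space, so that equality is equality of functions on `U`. -/
def smoothFun {E : Type*} [NormedAddCommGroup E] [NormedSpace ℝ E] (U : Set E) :
    Submodule ℝ (E → ℝ) where
  carrier := {f | ContDiffOn ℝ ∞ f U ∧ ∀ a, a ∉ U → f a = 0}
  add_mem' := by
    rintro f g ⟨hf, hf0⟩ ⟨hg, hg0⟩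
    exact ⟨hf.add hg, fun a ha => by simp [hf0 a ha, hg0 a ha]⟩
  zero_mem' := ⟨contDiffOn_const, fun _ _ => rfl⟩
  smul_mem' := by
    rintro c f ⟨hf, hf0⟩
    exact ⟨hf.const_smul c, fun a ha => by simp [hf0 a ha]⟩

/-- A first-order differential operator `v + η`: a vector field `v` and a multiplier `η`. -/
abbrev DiffOp : Type := (Space → Space) × (Space → ℝ)

/-- The action of `T = v + η` on a function `f` on the open set `U`: `T f = v(f) + η f`. -/
def act (U : Set Space) (T : DiffOp) (f : Space → ℝ) : Space → ℝ :=
  U.indicator (fun a => fderiv ℝ f a (T.1 a) + T.2 a * f a)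

/-- `N` is a finite-dimensional `g`-module of smooth functions on `U`. -/
structure IsFixedModule (U : Set Space) (g : Submodule ℝ DiffOp)
    (N : Submodule ℝ (Space → ℝ)) : Prop where
  smooth : N ≤ smoothFun U
  finite : FiniteDimensional ℝ N
  stable : ∀ T ∈ g, ∀ f ∈ N, act U T f ∈ N

/-- `N` does not vanish identically on any nonempty open subset of `U`. -/
def LocallyNontrivial (U : Set Space) (N : Submodule ℝ (Space → ℝ)) : Prop :=
  ∀ V : Set Space, V ⊆ U → IsOpen V → V.Nonempty → ∃ f ∈ N, ∃ a ∈ V, f a ≠ 0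

/-! ### Coordinates, vector fields and generators -/

/-- The coordinate function `x`. -/
def cx : Space → ℝ := fun a => a.1
/-- The coordinate function `y`. -/
def cy : Space → ℝ := fun a => a.2.1
/-- The coordinate function `z`. -/
def cz : Space → ℝ := fun a => a.2.2
/-- A function of one variable, viewed as the function `K(z)` on space. -/
def ofZ (K : ℝ → ℝ) : Space → ℝ := fun a => K a.2.2

/-- `p = ∂/∂x`. -/
def vp : Space → Space := fun _ => (1, 0, 0)
/-- `q = ∂/∂y`. -/
def vq : Space → Space := fun _ => (0, 1, 0)
/-- `r = ∂/∂z`. -/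
def vr : Space → Space := fun _ => (0, 0, 1)

/-- `xp + yq`. -/
def euler : Space → Space := cx • vp + cy • vq

/-- The multiplication operator `1`. -/
def one : DiffOp := (0, 1)

/-- `xq, xp - yq, yp`. -/
def sl2 : Set DiffOp := {(cx • vq, 0), (cx • vp - cy • vq, 0), (cy • vp, 0)}

/-- `p, q, xp, yq, xq, yp, x²p + xyq + cx, xyp + y²q + cy`. -/
def sl3 (c : ℝ) : Set DiffOp :=
  {(vp, 0), (vq, 0), (cx • vp, 0), (cy • vq, 0), (cx • vq, 0), (cy • vp, 0),
    (cx ^ 2 • vp + (cx * cy) • vq, c • cx), ((cx * cy) • vp + cy ^ 2 • vq, c • cy)}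

/-- `ζ(z)p` and `ζ(z)q` for `ζ` in a set of functions of `z`. -/
def translations (S : Set (ℝ → ℝ)) : Set DiffOp :=
  {T | ∃ ζ ∈ S, T = (ofZ ζ • vp, 0) ∨ T = (ofZ ζ • vq, 0)}

/-- The functions `z^k e^{λz}`, `λ ∈ Λ`, `k ≤ m λ`, in real form: for a complex exponent the real
and the imaginary part are taken (for real `λ` these are `z^k e^{λz}` and `0`). -/
def expMonomials (Λ : Finset ℂ) (m : ℂ → ℕ) : Set (ℝ → ℝ) :=
  {ζ | ∃ lam ∈ Λ, ∃ k ≤ m lam,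
    ζ = (fun z : ℝ => ((z : ℂ) ^ k * Complex.exp (lam * z)).re) ∨
    ζ = (fun z : ℝ => ((z : ℂ) ^ k * Complex.exp (lam * z)).im)}

/-- The functions `1, z, …, z^l`. -/
def powers (l : ℕ) : Set (ℝ → ℝ) := {ζ | ∃ k ≤ l, ζ = fun z => z ^ k}

/-! ### The twelve Lie algebras of first-order differential operators -/

def alg1 (K : ℝ → ℝ) : Submodule ℝ DiffOp := Submodule.span ℝ
  {(vp, 0), (vq, 0), (cx • vp, ofZ K), (cy • vq, ofZ K), (cx • vq, 0), (cy • vp, 0),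
    (cx ^ 2 • vp + (cx * cy) • vq, 3 • (cx * ofZ K)),
    ((cx * cy) • vp + cy ^ 2 • vq, 3 • (cy * ofZ K)), one}

def alg2 {s : ℕ} (Z : Fin s → ℝ → ℝ) : Submodule ℝ DiffOp := Submodule.span ℝ
  (sl2 ∪ translations (Set.range Z) ∪ {one})

def alg3 {s : ℕ} (Z : Fin s → ℝ → ℝ) (K : ℝ → ℝ) : Submodule ℝ DiffOp := Submodule.span ℝ
  (sl2 ∪ translations (Set.range Z) ∪ {(euler, ofZ K), one})

def alg4 (c : ℝ) : Submodule ℝ DiffOp := Submodule.span ℝ (sl3 c ∪ {(vr, 0), one})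

def alg5 (Λ : Finset ℂ) (ν : ℂ → ℕ) : Submodule ℝ DiffOp := Submodule.span ℝ
  (sl2 ∪ translations (expMonomials Λ ν) ∪ {(vr, 0), one})

def alg6 (Λ : Finset ℂ) (ν : ℂ → ℕ) (c : ℝ) : Submodule ℝ DiffOp := Submodule.span ℝ
  (sl2 ∪ translations (expMonomials Λ ν) ∪ {(euler, c • cz), (vr, 0), one})

def alg7 (c : ℝ) : Submodule ℝ DiffOp := Submodule.span ℝ
  (sl3 c ∪ {(vr, 0), (cz • vr, 0), one})

def alg8 (l : ℕ) (a : ℝ) : Submodule ℝ DiffOp := Submodule.span ℝ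
  (sl2 ∪ translations (powers l) ∪ {(vr, 0), (cz • vr + a • euler, 0), one})

def alg9 (l : ℕ) : Submodule ℝ DiffOp := Submodule.span ℝ
  (sl2 ∪ translations (powers l) ∪ {(euler, 0), (vr, 0), (cz • vr, 0), one})

def alg10 (c d : ℝ) : Submodule ℝ DiffOp := Submodule.span ℝ
  (sl3 c ∪ {(vr, 0), (cz • vr, 0), (cz ^ 2 • vr, d • cz), one})

/-- Closure under brackets forces the coefficient `a` of `z²r + az(xp + yq)` to be `l`, because
`[z²r + az(xp + yq), z^l p] = (l - a) z^{l+1} p`. -/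
def alg11 (l : ℕ) (c : ℝ) : Submodule ℝ DiffOp := Submodule.span ℝ
  (sl2 ∪ translations (powers l) ∪
    {(vr, 0), (cz • vr + ((l : ℝ) / 2) • euler, 0),
      (cz ^ 2 • vr + (l : ℝ) • cz • euler, c • cz), one})

/-- As for `alg11`, the coefficient of `z(xp + yq)` has to be `l`. -/
def alg12 (l : ℕ) (c : ℝ) : Submodule ℝ DiffOp := Submodule.span ℝ
  (sl2 ∪ translations (powers l) ∪
    {(euler, 0), (vr, 0), (cz • vr, 0), (cz ^ 2 • vr + (l : ℝ) • cz • euler, c • cz), one})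

/-! ### The modules -/

/-- The box `I × J × L`. -/
def box (I J L : Set ℝ) : Set Space := I ×ˢ (J ×ˢ L)

/-- `Span {x^i y^j g(z) | i + j ≤ n, g ∈ G^{(i+j)}}` on the open set `U`. -/
def polyModule (U : Set Space) (n : ℕ) (G : ℕ → Submodule ℝ (ℝ → ℝ)) :
    Submodule ℝ (Space → ℝ) := Submodule.span ℝ
  {f | ∃ i j : ℕ, i + j ≤ n ∧ ∃ g ∈ G (i + j), f = U.indicator (cx ^ i * cy ^ j * ofZ g)}

/-- `Span {x^i y^j z^k | (i, j, k) ∈ S}` on the open set `U`. -/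
def monoModule (U : Set Space) (S : Set (ℕ × ℕ × ℕ)) : Submodule ℝ (Space → ℝ) :=
  Submodule.span ℝ
    {f | ∃ i j k : ℕ, (i, j, k) ∈ S ∧ f = U.indicator (cx ^ i * cy ^ j * cz ^ k)}

/-- `Span {z^k e^{λz} | λ ∈ Λ, k ≤ m λ}` (real form) on the interval `L`. -/
def expModule (L : Set ℝ) (Λ : Finset ℂ) (m : ℂ → ℕ) : Submodule ℝ (ℝ → ℝ) :=
  Submodule.span ℝ {g | ∃ ζ ∈ expMonomials Λ m, g = L.indicator ζ}

/-- Each `G^{(l)}`, `l ≤ n`, is a finite-dimensional space of smooth functions on `L`. -/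
def FiniteFamily (L : Set ℝ) (n : ℕ) (G : ℕ → Submodule ℝ (ℝ → ℝ)) : Prop :=
  ∀ l ≤ n, G l ≤ smoothFun L ∧ FiniteDimensional ℝ (G l)

/-- `ζ G^{(l)} ⊆ G^{(l-1)}` for every `ζ ∈ S` and `1 ≤ l ≤ n`. -/
def Lowers (S : Set (ℝ → ℝ)) (n : ℕ) (G : ℕ → Submodule ℝ (ℝ → ℝ)) : Prop :=
  ∀ ζ ∈ S, ∀ l < n, ∀ g ∈ G (l + 1), ζ * g ∈ G l

end QES

end

/-!
A finite-dimensional space `N` of functions stable under `xq` and `yp` is a module over `sl₂`,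
so these operators are nilpotent on `N`. Since `(xq)^k = x^k q^k` and `(yp)^k = y^k p^k`, the
functions in `N` are polynomials in `x` and `y` with coefficients depending on `z`. A
Casimir-type operator has distinct eigenvalues on distinct monomials `x^i y^j`, and therefore
splits `N` into the pieces `x^i y^j G^(i+j)`.

Each remaining generator becomes a condition on the components `G^(l)`. The operators `ζ p` and
`ζ q` send `G^(l)` to `G^(l-1)` by multiplication by `ζ`. Stability under `∂/∂z` makes every
component a finite-dimensional space of solutions of a linear equation with constant
coefficients, that is, an exponential space; if `z ∂/∂z` acts as well, the relation
`[∂/∂z, z ∂/∂z] = ∂/∂z` makes `∂/∂z` nilpotent and only polynomials remain. A raising operator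
`x (xp + yq) + C x` must annihilate the components of top degree, which fixes the multiplier
`C`, and it makes neighbouring components equal. The same argument in the variable `z` treats
the operators quadratic in `z`. Finally, a finite-dimensional space of functions on an open set
can be stable under multiplication by a function only if that function is constant where the
space does not vanish.
-/

noncomputable section

namespace QES

/-! ### Linear algebra -/

theorem finiteDimensional_comap_subtype {K V : Type*} [Field K] [AddCommGroup V] [Module K V]
    (S W : Submodule K V) [FiniteDimensional K W] : FiniteDimensional K (W.comap S.subtype) := by
  have : FiniteDimensional K (LinearMap.ker S.subtype) := by
    rw [Submodule.ker_subtype]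
    infer_instance
  infer_instance

section Commutator

open Polynomial

theorem commutator_pow {R A : Type*} [CommRing R] [Ring A] [Algebra R A] {H E : A} {c : R}
    (h : H * E - E * H = c • E) (k : ℕ) : H * E ^ k - E ^ k * H = (k * c) • E ^ k := by
  induction k with
  | zero => simp
  | succ k ih =>
    calc H * E ^ (k + 1) - E ^ (k + 1) * H
        = (H * E ^ k - E ^ k * H) * E + E ^ k * (H * E - E * H) := by
          simp only [pow_succ, sub_mul, mul_sub, mul_assoc]; abel
      _ = ((k + 1 : ℕ) * c) • E ^ (k + 1) := by
          rw [ih, h, smul_mul_assoc, mul_smul_comm, ← pow_succ, ← add_smul]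
          push_cast
          ring_nf

variable {K V : Type*} [Field K] [AddCommGroup V] [Module K V]

theorem isNilpotent_of_commutator_eq_smul [CharZero K] [FiniteDimensional K V]
    {H E : Module.End K V} {c : K} (hc : c ≠ 0) (h : H * E - E * H = c • E) : IsNilpotent E := by
  by_contra hE
  -- Otherwise the powers of `E` are eigenvectors of `ad H` for infinitely many eigenvalues.
  let adH : Module.End K (Module.End K V) := LinearMap.mulLeft K H - LinearMap.mulRight K H
  have hasEigenvalue (k : ℕ) : adH.HasEigenvalue (k * c) := by
    refine Module.End.hasEigenvalue_of_hasEigenvector (x := E ^ k) ⟨?_, fun h0 => hE ⟨k, h0⟩⟩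
    rw [Module.End.mem_eigenspace_iff]
    exact commutator_pow h k
  refine Set.infinite_of_injective_forall_mem (f := fun k : ℕ => (k : K) * c) ?_ hasEigenvalue
    adH.finite_hasEigenvalue
  exact fun a b hab => Nat.cast_injective (mul_right_cancel₀ hc hab)

theorem exists_le_ker_pow_of_commutator [CharZero K] (W : Submodule K V) [FiniteDimensional K W]
    {H E : Module.End K V} (hH : ∀ w ∈ W, H w ∈ W) (hE : ∀ w ∈ W, E w ∈ W) {c : K} (hc : c ≠ 0)
    (h : H * E - E * H = c • E) : ∃ k : ℕ, W ≤ LinearMap.ker (E ^ k) := by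
  have hres : H.restrict hH * E.restrict hE - E.restrict hE * H.restrict hH
      = c • E.restrict hE := by
    ext w
    exact LinearMap.congr_fun h w
  obtain ⟨k, hk⟩ := isNilpotent_of_commutator_eq_smul hc hres
  refine ⟨k, fun w hw => ?_⟩
  rw [Module.End.pow_restrict] at hk
  exact congrArg Subtype.val (LinearMap.congr_fun hk ⟨w, hw⟩)

theorem mem_of_sum_eigenvectors_mem {ι : Type*} {T : Module.End K V} {S : Submodule K V}
    (hS : ∀ v ∈ S, T v ∈ S) {s : Finset ι} {μ : ι → K} (hμ : Set.InjOn μ s) {v : ι → V}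
    (hv : ∀ i ∈ s, T (v i) = μ i • v i) (hsum : ∑ i ∈ s, v i ∈ S) : ∀ i ∈ s, v i ∈ S := by
  classical
  intro i hi
  have heval (P : K[X]) : aeval T P (∑ j ∈ s, v j) = ∑ j ∈ s, P.eval (μ j) • v j := by
    rw [map_sum]
    refine Finset.sum_congr rfl fun j hj => ?_
    rcases eq_or_ne (v j) 0 with h0 | h0
    · simp [h0]
    · exact Module.End.aeval_apply_of_hasEigenvector
        ⟨Module.End.mem_eigenspace_iff.2 (hv j hj), h0⟩
  have hvi : aeval T (Lagrange.basis s μ i) (∑ j ∈ s, v j) = v i := by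
    rw [heval, Finset.sum_eq_single_of_mem i hi, Lagrange.eval_basis_self hμ hi, one_smul]
    intro j hj hji
    rw [Lagrange.eval_basis_of_ne hji.symm hj, zero_smul]
  rw [← hvi]
  exact aeval_apply_smul_mem_of_le_comap' hsum _ T hS

theorem coe_aeval_restrict {T : Module.End K V} {N : Submodule K V} (h : ∀ v ∈ N, T v ∈ N)
    (P : K[X]) (v : N) : (aeval (T.restrict h) P v : V) = aeval T P v := by
  rw [aeval_endomorphism, aeval_endomorphism, sum_def, sum_def, AddSubmonoidClass.coe_finsetSum]
  refine Finset.sum_congr rfl fun n _ => ?_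
  rw [Module.End.pow_restrict]
  rfl

theorem exists_aeval_mul_eq_zero {A : Type*} [Ring A] [Algebra K A] {N : Submodule K A}
    [FiniteDimensional K N] {φ : A} (h : ∀ f ∈ N, φ * f ∈ N) :
    ∃ P : K[X], P ≠ 0 ∧ ∀ f ∈ N, aeval φ P * f = 0 := by
  have hN : ∀ f ∈ N, Algebra.lmul K A φ f ∈ N := h
  let m : Module.End K N := (Algebra.lmul K A φ).restrict hN
  refine ⟨minpoly K m, minpoly.ne_zero (Algebra.IsIntegral.isIntegral m), fun f hf => ?_⟩
  have hm : aeval (Algebra.lmul K A φ) (minpoly K m) f = 0 := by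
    rw [← coe_aeval_restrict hN (minpoly K m) ⟨f, hf⟩, minpoly.aeval K m]
    rfl
  rwa [aeval_algHom_apply] at hm

end Commutator

section Weyl

variable {K V : Type*} [Field K] [AddCommGroup V] [Module K V] {D M : Module.End K V}

theorem weyl_apply (h : D * M - M * D = 1) (v : V) : D (M v) = M (D v) + v :=
  sub_eq_iff_eq_add'.1 (LinearMap.congr_fun h v)

theorem weyl_apply_pow (h : D * M - M * D = 1) {v : V} (hv : D v = 0) (k : ℕ) :
    D ((M ^ (k + 1)) v) = ((k : K) + 1) • (M ^ k) v := by
  induction k with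
  | zero => simp [weyl_apply h, hv]
  | succ k ih =>
    rw [pow_succ' M (k + 1), Module.End.mul_apply, weyl_apply h, ih, map_smul, pow_succ' M k,
      Module.End.mul_apply]
    push_cast
    module

theorem weyl_pow_apply_pow (h : D * M - M * D = 1) {v : V} (hv : D v = 0) (k : ℕ) :
    (D ^ k) ((M ^ k) v) = (k.factorial : K) • v := by
  induction k with
  | zero => simp
  | succ k ih =>
    rw [pow_succ D, Module.End.mul_apply, weyl_apply_pow h hv, map_smul, ih, smul_smul,
      Nat.factorial_succ]
    push_cast
    rfl

theorem weyl_pow_apply_pow_of_lt (h : D * M - M * D = 1) {v : V} (hv : D v = 0) {j k : ℕ}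
    (hjk : j < k) : (D ^ k) ((M ^ j) v) = 0 := by
  obtain ⟨m, rfl⟩ := Nat.exists_eq_add_of_lt hjk
  rw [show j + m + 1 = m + 1 + j by ring, pow_add, Module.End.mul_apply, weyl_pow_apply_pow h hv,
    map_smul, pow_succ, Module.End.mul_apply, hv, map_zero, smul_zero]

theorem weyl_mul_commutator (h : D * M - M * D = 1) :
    M * D * D - D * (M * D) = (-1 : K) • D := by
  have hcomm : M * D * D - D * (M * D) = -((D * M - M * D) * D) := by noncomm_ring
  rw [hcomm, h, one_mul, neg_one_smul]

theorem weyl_expansion [CharZero K] (h : D * M - M * D = 1) {S : Submodule K V}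
    (hSD : ∀ v ∈ S, D v ∈ S) (hSM : ∀ v ∈ S, M v ∈ S) (k : ℕ) :
    ∀ v ∈ S, (D ^ k) v = 0 →
      ∃ g : ℕ → V, (∀ j, g j ∈ S ∧ D (g j) = 0) ∧ v = ∑ j ∈ Finset.range k, (M ^ j) (g j) := by
  induction k with
  | zero => intro v _ hv; exact ⟨0, by simp, by simpa using hv⟩
  | succ k ih =>
    intro v hvS hv
    have hk : (k.factorial : K) ≠ 0 := Nat.cast_ne_zero.2 k.factorial_ne_zero
    obtain ⟨w, hw⟩ : ∃ w, w = (k.factorial : K)⁻¹ • (D ^ k) v := ⟨_, rfl⟩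
    have hwS : w ∈ S := hw ▸ S.smul_mem _ (Module.End.pow_apply_mem_of_forall_mem k hSD v hvS)
    have hDw : D w = 0 := by
      rw [hw, map_smul, ← Module.End.mul_apply, ← pow_succ', hv, smul_zero]
    have hrem : (D ^ k) (v - (M ^ k) w) = 0 := by
      rw [map_sub, weyl_pow_apply_pow h hDw, hw, smul_inv_smul₀ hk, sub_self]
    obtain ⟨g, hg, hsum⟩ := ih _
      (S.sub_mem hvS (Module.End.pow_apply_mem_of_forall_mem k hSM w hwS)) hrem
    refine ⟨Function.update g k w, fun j => ?_, ?_⟩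
    · rcases eq_or_ne j k with rfl | hj
      · simpa using ⟨hwS, hDw⟩
      · simpa [hj] using hg j
    · rw [Finset.sum_range_succ, Function.update_self, Finset.sum_congr rfl fun j hj => by
        rw [Function.update_of_ne (Finset.mem_range.1 hj).ne], ← hsum, sub_add_cancel]

theorem weyl_ker_pow_eq_span [CharZero K] (h : D * M - M * D = 1) {e : V} (he : D e = 0)
    (hker : ∀ v, D v = 0 → ∃ c : K, v = c • e) (k : ℕ) :
    LinearMap.ker (D ^ k) = Submodule.span K {v | ∃ j < k, v = (M ^ j) e} := by
  refine le_antisymm (fun v hv => ?_) (Submodule.span_le.2 ?_)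
  · obtain ⟨g, hg, rfl⟩ := weyl_expansion h (S := ⊤) (by simp) (by simp) k v trivial hv
    refine Submodule.sum_mem _ fun j hj => ?_
    obtain ⟨c, hc⟩ := hker (g j) (hg j).2
    rw [hc, map_smul]
    exact Submodule.smul_mem _ _ (Submodule.subset_span ⟨j, Finset.mem_range.1 hj, rfl⟩)
  · rintro _ ⟨j, hj, rfl⟩
    exact weyl_pow_apply_pow_of_lt h he hj

end Weyl

section Eigenspaces

variable {K V : Type*} [Field K] [AddCommGroup V] [Module K V] {D : Module.End K V}
  {W : Submodule K V}

theorem ker_pow_le_of_mem {e : V} (hker : ∀ v, D v = 0 → ∃ c : K, v = c • e)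
    (hW : ∀ w ∈ W, D w ∈ W) (k : ℕ) :
    ∀ w ∈ W, (D ^ k) w ≠ 0 → (D ^ (k + 1)) w = 0 → LinearMap.ker (D ^ (k + 1)) ≤ W := by
  induction k with
  | zero =>
    intro w hw hw0 hw1 v hv
    rw [zero_add, pow_one] at hw1 hv
    obtain ⟨a, rfl⟩ := hker w hw1
    obtain ⟨b, rfl⟩ := hker v hv
    have ha : a ≠ 0 := fun ha => hw0 (by simp [ha])
    exact W.smul_mem b ((W.smul_mem_iff ha).1 hw)
  | succ k ih =>
    intro w hw hw0 hw1 v hv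
    have hle := ih (D w) (hW w hw) (by rwa [← Module.End.mul_apply, ← pow_succ])
      (by rwa [← Module.End.mul_apply, ← pow_succ])
    have hD {u : V} (hu : (D ^ (k + 1 + 1)) u = 0) : D ((D ^ (k + 1)) u) = 0 := by
      rwa [← Module.End.mul_apply, ← pow_succ']
    obtain ⟨a, ha⟩ := hker _ (hD hw1)
    obtain ⟨b, hb⟩ := hker _ (hD hv)
    have ha0 : a ≠ 0 := fun h0 => hw0 (by rw [ha, h0, zero_smul])
    have hdiff : v - (b / a) • w ∈ LinearMap.ker (D ^ (k + 1)) := by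
      rw [LinearMap.mem_ker, map_sub, map_smul, ha, hb, smul_smul, div_mul_cancel₀ b ha0, sub_self]
    exact (W.sub_mem_iff_left (W.smul_mem _ hw)).1 (hle hdiff)

theorem exists_eq_ker_pow {e : V} (hker : ∀ v, D v = 0 → ∃ c : K, v = c • e)
    (hW : ∀ w ∈ W, D w ∈ W) {k : ℕ} (hk : W ≤ LinearMap.ker (D ^ k)) :
    ∃ m, W = LinearMap.ker (D ^ m) := by
  induction k with
  | zero => exact ⟨0, le_antisymm hk (by simp [Module.End.one_eq_id])⟩
  | succ k ih =>
    by_cases h : W ≤ LinearMap.ker (D ^ k)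
    · exact ih h
    · obtain ⟨w, hw, hw0⟩ := SetLike.not_le_iff_exists.1 h
      exact ⟨k + 1, le_antisymm hk (ker_pow_le_of_mem hker hW k w hw hw0 (hk hw))⟩

theorem map_subtype_genEigenspace_restrict (hW : ∀ w ∈ W, D w ∈ W) (lam : K) (k : ℕ∞) :
    (Module.End.genEigenspace (D.restrict hW) lam k).map W.subtype
      = W ⊓ D.genEigenspace lam k := by
  rw [Module.End.genEigenspace_restrict, Submodule.map_comap_subtype]

variable [FiniteDimensional K W]

theorem iSup_inf_maxGenEigenspace [IsAlgClosed K] (hW : ∀ w ∈ W, D w ∈ W) :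
    ⨆ lam, W ⊓ D.maxGenEigenspace lam = W := by
  simp only [Module.End.maxGenEigenspace, ← map_subtype_genEigenspace_restrict hW]
  rw [← Submodule.map_iSup]
  exact (congrArg _ (Module.End.iSup_maxGenEigenspace_eq_top (D.restrict hW))).trans (by simp)

theorem finite_inf_maxGenEigenspace_ne_bot (hW : ∀ w ∈ W, D w ∈ W) :
    {lam | W ⊓ D.maxGenEigenspace lam ≠ ⊥}.Finite := by
  refine (Module.End.finite_hasEigenvalue (D.restrict hW)).subset fun lam hlam => ?_
  rw [Set.mem_ofPred_eq, Module.End.maxGenEigenspace,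
    ← map_subtype_genEigenspace_restrict hW] at hlam
  have hlam' : Module.End.HasUnifEigenvalue (D.restrict hW) lam ⊤ := fun h0 =>
    hlam (by rw [h0, Submodule.map_bot])
  exact hlam'.lt zero_lt_one

theorem exists_inf_maxGenEigenspace_le_ker_pow (hW : ∀ w ∈ W, D w ∈ W) (lam : K) :
    ∃ k : ℕ, W ⊓ D.maxGenEigenspace lam ≤ LinearMap.ker ((D - lam • 1) ^ k) := by
  refine ⟨Module.finrank K W, ?_⟩
  rw [← Module.End.genEigenspace_nat, Module.End.maxGenEigenspace,
    ← map_subtype_genEigenspace_restrict hW]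
  have := Module.End.maxGenEigenspace_eq_genEigenspace_finrank (D.restrict hW) lam
  rw [Module.End.maxGenEigenspace] at this
  rw [this, map_subtype_genEigenspace_restrict hW]
  exact inf_le_right

end Eigenspaces

/-! ### Differential operators on smooth functions -/

section Operators

variable {E : Type*} [NormedAddCommGroup E] [NormedSpace ℝ E] {U : Set E}

theorem smoothFun_ext {f g : E → ℝ} (hf : f ∈ smoothFun U) (hg : g ∈ smoothFun U)
    (h : ∀ a ∈ U, f a = g a) : f = g := by
  ext a
  by_cases ha : a ∈ U
  · exact h a ha
  · rw [hf.2 a ha, hg.2 a ha]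

theorem indicator_mem_smoothFun {φ : E → ℝ} (hφ : ContDiffOn ℝ ∞ φ U) :
    U.indicator φ ∈ smoothFun U :=
  ⟨hφ.congr fun _ ha => Set.indicator_of_mem ha _, fun _ ha => Set.indicator_of_notMem ha _⟩

theorem mul_mem_smoothFun {φ f : E → ℝ} (hφ : ContDiffOn ℝ ∞ φ U) (hf : f ∈ smoothFun U) :
    φ * f ∈ smoothFun U :=
  ⟨hφ.mul hf.1, fun a ha => by simp [hf.2 a ha]⟩

theorem contDiffAt_of_mem_smoothFun (hU : IsOpen U) {f : E → ℝ} (hf : f ∈ smoothFun U) {a : E}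
    (ha : a ∈ U) : ContDiffAt ℝ ∞ f a :=
  hf.1.contDiffAt (hU.mem_nhds ha)

theorem differentiableAt_of_mem_smoothFun (hU : IsOpen U) {f : E → ℝ} (hf : f ∈ smoothFun U)
    {a : E} (ha : a ∈ U) : DifferentiableAt ℝ f a :=
  (contDiffAt_of_mem_smoothFun hU hf ha).differentiableAt (by simp)

theorem der_mem_smoothFun (hU : IsOpen U) (v : E) {f : E → ℝ} (hf : f ∈ smoothFun U) :
    U.indicator (fun a => fderiv ℝ f a v) ∈ smoothFun U :=
  indicator_mem_smoothFun ((hf.1.fderiv_of_isOpen hU (by simp)).clm_apply contDiffOn_const)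

/-- The derivative along a constant vector, as an operator on smooth functions on `U`. -/
def der (hU : IsOpen U) (v : E) : Module.End ℝ (smoothFun U) where
  toFun f := ⟨U.indicator (fun a => fderiv ℝ f a v), der_mem_smoothFun hU v f.2⟩
  map_add' f g := by
    ext a
    by_cases ha : a ∈ U
    · simp [ha, fderiv_add (differentiableAt_of_mem_smoothFun hU f.2 ha)
        (differentiableAt_of_mem_smoothFun hU g.2 ha)]
    · simp [ha]
  map_smul' c f := by
    ext a
    by_cases ha : a ∈ U
    · simp [ha, fderiv_const_smul (differentiableAt_of_mem_smoothFun hU f.2 ha)]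
    · simp [ha]

theorem der_apply (hU : IsOpen U) (v : E) (f : smoothFun U) {a : E} (ha : a ∈ U) :
    (der hU v f : E → ℝ) a = fderiv ℝ f a v := by
  change U.indicator (fun a => fderiv ℝ (f : E → ℝ) a v) a = _
  rw [Set.indicator_of_mem ha]

/-- Multiplication by a smooth function, as an operator on smooth functions on `U`. -/
def mulBy {φ : E → ℝ} (hφ : ContDiffOn ℝ ∞ φ U) : Module.End ℝ (smoothFun U) where
  toFun f := ⟨φ * f, mul_mem_smoothFun hφ f.2⟩
  map_add' f g := by ext a; simp [mul_add]
  map_smul' c f := by ext a; simp [mul_left_comm]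

@[simp]
theorem mulBy_apply {φ : E → ℝ} (hφ : ContDiffOn ℝ ∞ φ U) (f : smoothFun U) (a : E) :
    (mulBy hφ f : E → ℝ) a = φ a * (f : E → ℝ) a := rfl

theorem mulBy_pow_apply {φ : E → ℝ} (hφ : ContDiffOn ℝ ∞ φ U) (f : smoothFun U) (a : E) (k : ℕ) :
    ((mulBy hφ ^ k) f : E → ℝ) a = φ a ^ k * (f : E → ℝ) a := by
  induction k with
  | zero => simp
  | succ k ih => rw [pow_succ', Module.End.mul_apply, mulBy_apply, ih]; ring

theorem mulBy_injective (hU : IsOpen U) {φ : E → ℝ} (hφ : ContDiffOn ℝ ∞ φ U)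
    (hopen : IsOpenMap φ) : Function.Injective (mulBy hφ) := by
  refine (injective_iff_map_eq_zero _).2 fun f hf => Subtype.ext ?_
  refine smoothFun_ext f.2 (Submodule.zero_mem _) fun a ha => ?_
  by_contra hne
  have hfa : ∀ᶠ b in nhds a, (f : E → ℝ) b ≠ 0 :=
    (contDiffAt_of_mem_smoothFun hU f.2 ha).continuousAt.eventually_ne hne
  obtain ⟨b, hb, hφb⟩ := mem_closure_iff_nhds.1
    ((dense_compl_singleton (0 : ℝ)).preimage hopen a) _ hfa
  exact (mul_ne_zero hφb hb) (congrFun (congrArg Subtype.val hf) b)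

theorem mulBy_comm {φ ψ : E → ℝ} (hφ : ContDiffOn ℝ ∞ φ U) (hψ : ContDiffOn ℝ ∞ ψ U) :
    Commute (mulBy hφ) (mulBy hψ) := by
  ext f a
  simp only [Module.End.mul_apply, mulBy_apply]
  ring

theorem der_comm (hU : IsOpen U) (v w : E) : Commute (der hU v) (der hU w) := by
  refine LinearMap.ext fun f => Subtype.ext (smoothFun_ext (der hU v (der hU w f)).2
    (der hU w (der hU v f)).2 fun a ha => ?_)
  have der_der (v w : E) : (der hU v (der hU w f) : E → ℝ) a
      = fderiv ℝ (fderiv ℝ (f : E → ℝ)) a v w := by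
    have hw : (der hU w f : E → ℝ) =ᶠ[nhds a] fun b => fderiv ℝ f b w := by
      filter_upwards [hU.mem_nhds ha] with b hb using der_apply hU w f hb
    have hf : DifferentiableAt ℝ (fderiv ℝ (f : E → ℝ)) a :=
      ((f.2.1.fderiv_of_isOpen hU (m := ∞) (by simp)).contDiffAt
        (hU.mem_nhds ha)).differentiableAt (by simp)
    rw [der_apply hU _ _ ha, hw.fderiv_eq, fderiv_clm_apply hf (differentiableAt_const w)]
    simp
  exact (der_der v w).trans ((((contDiffAt_of_mem_smoothFun hU f.2 ha).isSymmSndFDerivAt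
    (by simpa using ENat.LEInfty.out)) v w).trans (der_der w v).symm)

theorem der_mul_mulBy (hU : IsOpen U) (v : E) {φ : E → ℝ} (hφ : ContDiffOn ℝ ∞ φ U)
    (φ' : E →L[ℝ] ℝ) (h : ∀ a ∈ U, HasFDerivAt φ φ' a) :
    der hU v * mulBy hφ - mulBy hφ * der hU v = φ' v • 1 := by
  refine LinearMap.ext fun f => Subtype.ext (smoothFun_ext (Subtype.property _)
    (Subtype.property _) fun a ha => ?_)
  have hφf : HasFDerivAt (mulBy hφ f : E → ℝ) _ a :=
    (h a ha).mul (differentiableAt_of_mem_smoothFun hU f.2 ha).hasFDerivAt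
  have hleft : (der hU v (mulBy hφ f) : E → ℝ) a
      = φ a * fderiv ℝ f a v + (f : E → ℝ) a * φ' v := by
    rw [der_apply hU _ _ ha, hφf.fderiv]
    rfl
  have hright : (mulBy hφ (der hU v f) : E → ℝ) a = φ a * fderiv ℝ f a v := by
    rw [mulBy_apply, der_apply hU _ _ ha]
  change (der hU v (mulBy hφ f) : E → ℝ) a - (mulBy hφ (der hU v f) : E → ℝ) a
    = φ' v * (f : E → ℝ) a
  rw [hleft, hright]
  ring

end Operators

/-- The derivative `dg/dz` of a function on `L`, extended by zero like `g` itself. -/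
def dz (L : Set ℝ) (g : ℝ → ℝ) : ℝ → ℝ := L.indicator (deriv g)

theorem der_one_eq_dz {L : Set ℝ} (hL : IsOpen L) (g : smoothFun L) :
    (der hL 1 g : ℝ → ℝ) = dz L g := rfl

theorem dz_mem_smoothFun {L : Set ℝ} (hL : IsOpen L) {g : ℝ → ℝ} (hg : g ∈ smoothFun L) :
    dz L g ∈ smoothFun L :=
  (der hL 1 ⟨g, hg⟩).2

section Coordinates

theorem contDiff_cx : ContDiff ℝ ∞ cx := contDiff_fst

theorem contDiff_cy : ContDiff ℝ ∞ cy := contDiff_fst.comp contDiff_snd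

theorem contDiff_cz : ContDiff ℝ ∞ cz := contDiff_snd.comp contDiff_snd

theorem hasFDerivAt_cx (a : Space) :
    HasFDerivAt cx (ContinuousLinearMap.fst ℝ ℝ (ℝ × ℝ)) a := hasFDerivAt_fst

theorem hasFDerivAt_cy (a : Space) :
    HasFDerivAt cy ((ContinuousLinearMap.fst ℝ ℝ ℝ).comp (ContinuousLinearMap.snd ℝ ℝ (ℝ × ℝ))) a :=
  hasFDerivAt_fst.comp a hasFDerivAt_snd

theorem hasFDerivAt_cz (a : Space) :
    HasFDerivAt cz ((ContinuousLinearMap.snd ℝ ℝ ℝ).comp (ContinuousLinearMap.snd ℝ ℝ (ℝ × ℝ))) a :=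
  hasFDerivAt_snd.comp a hasFDerivAt_snd

variable {U : Set Space} (hU : IsOpen U)

/-- `∂/∂x` as an operator on smooth functions on `U`. -/
def derX : Module.End ℝ (smoothFun U) := der hU (1, 0, 0)

/-- `∂/∂y` as an operator on smooth functions on `U`. -/
def derY : Module.End ℝ (smoothFun U) := der hU (0, 1, 0)

variable (U) in
/-- Multiplication by `x` as an operator on smooth functions on `U`. -/
def mulX : Module.End ℝ (smoothFun U) := mulBy (U := U) contDiff_cx.contDiffOn

variable (U) in
/-- Multiplication by `y` as an operator on smooth functions on `U`. -/
def mulY : Module.End ℝ (smoothFun U) := mulBy (U := U) contDiff_cy.contDiffOn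

theorem mulX_pow_apply (f : smoothFun U) (a : Space) (k : ℕ) :
    ((mulX U ^ k) f : Space → ℝ) a = a.1 ^ k * (f : Space → ℝ) a :=
  mulBy_pow_apply _ f a k

theorem mulY_pow_apply (f : smoothFun U) (a : Space) (k : ℕ) :
    ((mulY U ^ k) f : Space → ℝ) a = a.2.1 ^ k * (f : Space → ℝ) a :=
  mulBy_pow_apply _ f a k

theorem commute_mulX_mulY : Commute (mulX U) (mulY U) := mulBy_comm _ _

include hU in
theorem mulX_injective : Function.Injective (mulX U) :=
  mulBy_injective hU _ isOpenMap_fst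

include hU in
theorem mulY_injective : Function.Injective (mulY U) :=
  mulBy_injective hU _ (isOpenMap_fst.comp isOpenMap_snd)

theorem derX_mul_mulX : derX hU * mulX U - mulX U * derX hU = 1 :=
  (der_mul_mulBy hU _ _ _ fun a _ => hasFDerivAt_cx a).trans (one_smul ℝ _)

theorem derY_mul_mulY : derY hU * mulY U - mulY U * derY hU = 1 :=
  (der_mul_mulBy hU _ _ _ fun a _ => hasFDerivAt_cy a).trans (one_smul ℝ _)

theorem commute_derX_mulY : Commute (derX hU) (mulY U) :=
  sub_eq_zero.1 ((der_mul_mulBy hU _ _ _ fun a _ => hasFDerivAt_cy a).trans (zero_smul ℝ _))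

theorem commute_derY_mulX : Commute (derY hU) (mulX U) :=
  sub_eq_zero.1 ((der_mul_mulBy hU _ _ _ fun a _ => hasFDerivAt_cx a).trans (zero_smul ℝ _))

theorem commute_derX_derY : Commute (derX hU) (derY hU) := der_comm hU _ _

/-- The operator `xq` of the `sl₂`-triple `(xq, xp - yq, yp)` on smooth functions on `U`. -/
def sl2E : Module.End ℝ (smoothFun U) := mulX U * derY hU

/-- The operator `yp` of the `sl₂`-triple `(xq, xp - yq, yp)` on smooth functions on `U`. -/
def sl2F : Module.End ℝ (smoothFun U) := mulY U * derX hU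

/-- The operator `xp - yq` of the `sl₂`-triple `(xq, xp - yq, yp)` on smooth functions on `U`. -/
def sl2H : Module.End ℝ (smoothFun U) := mulX U * derX hU - mulY U * derY hU

theorem sl2H_commutator_sl2E : sl2H hU * sl2E hU - sl2E hU * sl2H hU = (2 : ℝ) • sl2E hU := by
  have hX (v) := weyl_apply (derX_mul_mulX hU) v
  have hY (v) := weyl_apply (derY_mul_mulY hU) v
  have hDD (v) := LinearMap.congr_fun (commute_derX_derY hU).eq v
  have hYX (v) := LinearMap.congr_fun (commute_derY_mulX hU).eq v
  have hMM (v) := LinearMap.congr_fun (commute_mulX_mulY (U := U)).eq v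
  ext1 v
  simp only [Module.End.mul_apply] at hDD hYX hMM
  simp only [sl2H, sl2E, Module.End.mul_apply, LinearMap.sub_apply, LinearMap.smul_apply, hX, hY,
    hYX, hDD, hMM, map_add, map_sub]
  module

theorem sl2H_commutator_sl2F : sl2H hU * sl2F hU - sl2F hU * sl2H hU = (-2 : ℝ) • sl2F hU := by
  have hX (v) := weyl_apply (derX_mul_mulX hU) v
  have hY (v) := weyl_apply (derY_mul_mulY hU) v
  have hDD (v) := LinearMap.congr_fun (commute_derX_derY hU).eq v
  have hXY (v) := LinearMap.congr_fun (commute_derX_mulY hU).eq v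
  have hMM (v) := LinearMap.congr_fun (commute_mulX_mulY (U := U)).eq v
  ext1 v
  simp only [Module.End.mul_apply] at hDD hXY hMM
  simp only [sl2H, sl2F, Module.End.mul_apply, LinearMap.sub_apply, LinearMap.smul_apply, hX, hY,
    hXY, hDD, hMM, map_add, map_sub]
  module

end Coordinates

/-! ### First-order operators and the functions `x^i y^j g(z)` -/

section Act

variable {U : Set Space}

theorem act_of_notMem {T : DiffOp} {f : Space → ℝ} {a : Space} (ha : a ∉ U) :
    act U T f a = 0 := Set.indicator_of_notMem ha _

theorem act_of_mem {T : DiffOp} {f : Space → ℝ} {a : Space} (ha : a ∈ U) :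
    act U T f a = fderiv ℝ f a (T.1 a) + T.2 a * f a := Set.indicator_of_mem ha _

theorem act_eq_of_forall_mem {T : DiffOp} {f h : Space → ℝ} (h0 : ∀ a ∉ U, h a = 0)
    (hT : ∀ a ∈ U, act U T f a = h a) : act U T f = h := by
  ext a
  by_cases ha : a ∈ U
  · exact hT a ha
  · rw [act_of_notMem ha, h0 a ha]

theorem act_one {f : Space → ℝ} (hf : f ∈ smoothFun U) : act U one f = f :=
  act_eq_of_forall_mem hf.2 fun a ha => by simp [act_of_mem ha, one]

theorem act_add_left (S T : DiffOp) (f : Space → ℝ) :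
    act U (S + T) f = act U S f + act U T f :=
  act_eq_of_forall_mem (fun a ha => by simp [act_of_notMem ha]) fun a ha => by
    simp only [act_of_mem ha, Prod.fst_add, Prod.snd_add, Pi.add_apply, map_add]
    ring

theorem act_smul_left (c : ℝ) (T : DiffOp) (f : Space → ℝ) :
    act U (c • T) f = c • act U T f :=
  act_eq_of_forall_mem (fun a ha => by simp [act_of_notMem ha]) fun a ha => by
    simp only [act_of_mem ha, Prod.smul_fst, Prod.smul_snd, Pi.smul_apply, map_smul, smul_eq_mul]
    ring

theorem act_zero_left (f : Space → ℝ) : act U 0 f = 0 := by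
  simpa using act_smul_left (U := U) 0 0 f

theorem act_zero_right (T : DiffOp) : act U T 0 = 0 :=
  act_eq_of_forall_mem (fun _ _ => rfl) fun a ha => by simp [act_of_mem ha]

theorem act_add_right (hU : IsOpen U) (T : DiffOp) {f g : Space → ℝ}
    (hf : f ∈ smoothFun U) (hg : g ∈ smoothFun U) :
    act U T (f + g) = act U T f + act U T g :=
  act_eq_of_forall_mem (fun a ha => by simp [act_of_notMem ha]) fun a ha => by
    simp only [act_of_mem ha, fderiv_add (differentiableAt_of_mem_smoothFun hU hf ha)
      (differentiableAt_of_mem_smoothFun hU hg ha), Pi.add_apply, add_apply]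
    ring

theorem act_smul_right (hU : IsOpen U) (T : DiffOp) (c : ℝ) {f : Space → ℝ}
    (hf : f ∈ smoothFun U) : act U T (c • f) = c • act U T f :=
  act_eq_of_forall_mem (fun a ha => by simp [act_of_notMem ha]) fun a ha => by
    simp only [act_of_mem ha, fderiv_const_smul (differentiableAt_of_mem_smoothFun hU hf ha),
      Pi.smul_apply, smul_apply, smul_eq_mul]
    ring

theorem act_mem_of_generators (hU : IsOpen U) {𝒯 : Set DiffOp} {S : Set (Space → ℝ)}
    {N : Submodule ℝ (Space → ℝ)} (hS : S ⊆ smoothFun U) (h : ∀ T ∈ 𝒯, ∀ f ∈ S, act U T f ∈ N) :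
    ∀ T ∈ Submodule.span ℝ 𝒯, ∀ f ∈ Submodule.span ℝ S, act U T f ∈ N := by
  intro T hT f hf
  have hle : Submodule.span ℝ S ≤ smoothFun U := Submodule.span_le.2 hS
  induction hT using Submodule.span_induction with
  | mem T hT =>
    induction hf using Submodule.span_induction with
    | mem f hf => exact h T hT f hf
    | zero => rw [act_zero_right]; exact N.zero_mem
    | add f g hf hg ihf ihg =>
      rw [act_add_right hU T (hle hf) (hle hg)]; exact N.add_mem ihf ihg
    | smul c f hf ih => rw [act_smul_right hU T c (hle hf)]; exact N.smul_mem c ih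
  | zero => rw [act_zero_left]; exact N.zero_mem
  | add S T _ _ ihS ihT => rw [act_add_left]; exact N.add_mem ihS ihT
  | smul c T _ ih => rw [act_smul_left]; exact N.smul_mem c ih

variable (hU : IsOpen U)

theorem coe_mulBy_der {φ : Space → ℝ} (hφ : ContDiffOn ℝ ∞ φ U) (v : Space) (f : smoothFun U) :
    (mulBy hφ (der hU v f) : Space → ℝ) = act U (φ • fun _ => v, 0) f :=
  (act_eq_of_forall_mem (Subtype.property (mulBy hφ (der hU v f))).2 fun a ha => by
    simp [act_of_mem ha, der_apply hU _ _ ha]).symm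

theorem coe_sl2E (f : smoothFun U) : (sl2E hU f : Space → ℝ) = act U (cx • vq, 0) f :=
  coe_mulBy_der hU contDiff_cx.contDiffOn _ f

theorem coe_sl2F (f : smoothFun U) : (sl2F hU f : Space → ℝ) = act U (cy • vp, 0) f :=
  coe_mulBy_der hU contDiff_cy.contDiffOn _ f

theorem coe_sl2H (f : smoothFun U) :
    (sl2H hU f : Space → ℝ) = act U (cx • vp - cy • vq, 0) f := by
  refine (congrArg₂ (· - ·) (coe_mulBy_der hU contDiff_cx.contDiffOn (1, 0, 0) f)
    (coe_mulBy_der hU contDiff_cy.contDiffOn (0, 1, 0) f)).trans ?_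
  refine (act_eq_of_forall_mem (fun a ha => by simp [act_of_notMem ha]) fun a ha => ?_).symm
  simp only [act_of_mem ha, Pi.sub_apply, map_sub, Pi.zero_apply, zero_mul, add_zero]
  rfl

end Act

/-- The operator `A(z) r + B(z) (xp + yq) + C(z)`. -/
def vert (A B C : ℝ → ℝ) : DiffOp := (ofZ A • vr + ofZ B • euler, ofZ C)

/-- The operator `x (xp + yq) + C(z) x`, which raises the degree in `x`, `y` by one. -/
def raiseX (C : ℝ → ℝ) : DiffOp := (cx ^ 2 • vp + (cx * cy) • vq, cx * ofZ C)

/-- The operator `y (xp + yq) + C(z) y`, which raises the degree in `x`, `y` by one. -/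
def raiseY (C : ℝ → ℝ) : DiffOp := ((cx * cy) • vp + cy ^ 2 • vq, cy * ofZ C)

theorem vr_eq_vert : ((vr, 0) : DiffOp) = vert 1 0 0 := by
  ext a <;> simp [vert, ofZ]

theorem euler_eq_vert (C : ℝ → ℝ) : ((euler, ofZ C) : DiffOp) = vert 0 1 C := by
  ext a <;> simp [vert, ofZ]

theorem euler_zero_eq_vert : ((euler, 0) : DiffOp) = vert 0 1 0 := by
  ext a <;> simp [vert, ofZ]

theorem euler_smul_cz_eq_vert (c : ℝ) : ((euler, c • cz) : DiffOp) = vert 0 1 (c • id) := by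
  ext a <;> simp [vert, ofZ, cz]

theorem cz_vr_add_eq_vert (b : ℝ) :
    ((cz • vr + b • euler, 0) : DiffOp) = vert id (fun _ => b) 0 := by
  ext a <;> simp [vert, ofZ, cz]

theorem cz_sq_vr_add_eq_vert (b c : ℝ) :
    ((cz ^ 2 • vr + b • cz • euler, c • cz) : DiffOp) = vert (id ^ 2) (b • id) (c • id) := by
  ext a <;> simp [vert, ofZ, cz, mul_assoc]

theorem vp_eq_ofZ_smul : ((vp, 0) : DiffOp) = (ofZ 1 • vp, 0) := by
  ext a <;> simp [ofZ]

theorem vq_eq_ofZ_smul : ((vq, 0) : DiffOp) = (ofZ 1 • vq, 0) := by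
  ext a <;> simp [ofZ]

theorem raiseX_const (c : ℝ) :
    ((cx ^ 2 • vp + (cx * cy) • vq, c • cx) : DiffOp) = raiseX fun _ => c := by
  ext a <;> simp [raiseX, ofZ, mul_comm]

theorem raiseY_const (c : ℝ) :
    (((cx * cy) • vp + cy ^ 2 • vq, c • cy) : DiffOp) = raiseY fun _ => c := by
  ext a <;> simp [raiseY, ofZ, mul_comm]

theorem raiseX_three (K : ℝ → ℝ) :
    ((cx ^ 2 • vp + (cx * cy) • vq, 3 • (cx * ofZ K)) : DiffOp) = raiseX fun z => 3 * K z := by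
  ext a <;> simp [raiseX, ofZ, mul_left_comm]

theorem raiseY_three (K : ℝ → ℝ) :
    (((cx * cy) • vp + cy ^ 2 • vq, 3 • (cy * ofZ K)) : DiffOp) = raiseY fun z => 3 * K z := by
  ext a <;> simp [raiseY, ofZ, mul_left_comm]

/-- The function `x^i y^j g(z)` on `U`, linear in `g`. -/
def mono (U : Set Space) (i j : ℕ) : (ℝ → ℝ) →ₗ[ℝ] (Space → ℝ) where
  toFun g := U.indicator (cx ^ i * cy ^ j * ofZ g)
  map_add' g h := by
    rw [← Set.indicator_add']
    exact congrArg _ (mul_add _ _ _)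
  map_smul' c g := by
    ext a
    by_cases ha : a ∈ U <;> simp [ha, ofZ, mul_left_comm]

section Mono

variable {U : Set Space} {i j : ℕ} {g : ℝ → ℝ} {a : Space}

theorem mono_apply (ha : a ∈ U) : mono U i j g a = a.1 ^ i * a.2.1 ^ j * g a.2.2 :=
  Set.indicator_of_mem ha _

theorem mono_of_notMem (ha : a ∉ U) : mono U i j g a = 0 := Set.indicator_of_notMem ha _

end Mono

section Box

variable {I J L : Set ℝ}

theorem isOpen_box (hI : IsOpen I) (hJ : IsOpen J) (hL : IsOpen L) : IsOpen (box I J L) :=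
  hI.prod (hJ.prod hL)

theorem mono_mem_smoothFun (i j : ℕ) {g : ℝ → ℝ} (hg : g ∈ smoothFun L) :
    mono (box I J L) i j g ∈ smoothFun (box I J L) := by
  have hofZ : ContDiffOn ℝ ∞ (ofZ g) (box I J L) :=
    hg.1.comp contDiff_cz.contDiffOn fun _ ha => ha.2.2
  exact indicator_mem_smoothFun
    (((contDiff_cx.pow i).mul (contDiff_cy.pow j)).contDiffOn.mul hofZ)

variable (hU : IsOpen (box I J L)) (hL : IsOpen L) {g : ℝ → ℝ} (hg : g ∈ smoothFun L) (i j : ℕ)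
include hU hL hg

theorem act_mono_apply (T : DiffOp) {a : Space} (ha : a ∈ box I J L) :
    act (box I J L) T (mono (box I J L) i j g) a =
      (T.1 a).1 * (i * a.1 ^ (i - 1) * a.2.1 ^ j * g a.2.2)
      + (T.1 a).2.1 * (a.1 ^ i * (j * a.2.1 ^ (j - 1)) * g a.2.2)
      + (T.1 a).2.2 * (a.1 ^ i * a.2.1 ^ j * dz L g a.2.2)
      + T.2 a * (a.1 ^ i * a.2.1 ^ j * g a.2.2) := by
  have heq : mono (box I J L) i j g =ᶠ[nhds a] cx ^ i * cy ^ j * ofZ g := by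
    filter_upwards [hU.mem_nhds ha] with b hb using mono_apply hb
  have hz : HasDerivAt g (deriv g (cz a)) (cz a) :=
    (differentiableAt_of_mem_smoothFun hL hg ha.2.2).hasDerivAt
  have hofZ : HasFDerivAt (ofZ g) _ a := hz.comp_hasFDerivAt a (hasFDerivAt_cz a)
  have hmono : HasFDerivAt (cx ^ i * cy ^ j * ofZ g) _ a :=
    (((hasFDerivAt_cx a).pow i).mul ((hasFDerivAt_cy a).pow j)).mul hofZ
  have hdz : dz L g a.2.2 = deriv g (cz a) := Set.indicator_of_mem ha.2.2 _
  rw [act_of_mem ha, mono_apply ha, heq.fderiv_eq, hmono.fderiv, hdz]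
  simp [cx, cy, cz, ofZ]
  ring

theorem act_mono_eq {T : DiffOp} {h : Space → ℝ} (h0 : ∀ a ∉ box I J L, h a = 0)
    (hT : ∀ a ∈ box I J L, (T.1 a).1 * (i * a.1 ^ (i - 1) * a.2.1 ^ j * g a.2.2)
      + (T.1 a).2.1 * (a.1 ^ i * (j * a.2.1 ^ (j - 1)) * g a.2.2)
      + (T.1 a).2.2 * (a.1 ^ i * a.2.1 ^ j * dz L g a.2.2)
      + T.2 a * (a.1 ^ i * a.2.1 ^ j * g a.2.2) = h a) :
    act (box I J L) T (mono (box I J L) i j g) = h :=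
  act_eq_of_forall_mem h0 fun a ha => (act_mono_apply hU hL hg i j T ha).trans (hT a ha)

theorem act_xq_mono : act (box I J L) (cx • vq, 0) (mono (box I J L) i j g)
    = (j : ℝ) • mono (box I J L) (i + 1) (j - 1) g :=
  act_mono_eq hU hL hg i j (fun a ha => by simp [mono_of_notMem ha]) fun a ha => by
    simp [mono_apply ha, cx, vq]; ring

theorem act_yp_mono : act (box I J L) (cy • vp, 0) (mono (box I J L) i j g)
    = (i : ℝ) • mono (box I J L) (i - 1) (j + 1) g :=
  act_mono_eq hU hL hg i j (fun a ha => by simp [mono_of_notMem ha]) fun a ha => by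
    simp [mono_apply ha, cy, vp]; ring

theorem act_xp_add_mono (C : ℝ → ℝ) : act (box I J L) (cx • vp, ofZ C) (mono (box I J L) i j g)
    = mono (box I J L) i j ((i : ℝ) • g + C * g) :=
  act_mono_eq hU hL hg i j (fun a ha => mono_of_notMem ha) fun a ha => by
    rcases i with _ | i <;> simp [mono_apply ha, cx, vp, ofZ] <;> ring

theorem act_yq_add_mono (C : ℝ → ℝ) : act (box I J L) (cy • vq, ofZ C) (mono (box I J L) i j g)
    = mono (box I J L) i j ((j : ℝ) • g + C * g) :=
  act_mono_eq hU hL hg i j (fun a ha => mono_of_notMem ha) fun a ha => by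
    rcases j with _ | j <;> simp [mono_apply ha, cy, vq, ofZ] <;> ring

theorem act_xp_sub_yq_mono : act (box I J L) (cx • vp - cy • vq, 0) (mono (box I J L) i j g)
    = ((i : ℝ) - j) • mono (box I J L) i j g :=
  act_mono_eq hU hL hg i j (fun a ha => by simp [mono_of_notMem ha]) fun a ha => by
    rcases i with _ | i <;> rcases j with _ | j <;>
      simp [mono_apply ha, cx, cy, vp, vq] <;> ring

theorem act_ofZ_smul_vp_mono (ζ : ℝ → ℝ) :
    act (box I J L) (ofZ ζ • vp, 0) (mono (box I J L) i j g)
      = (i : ℝ) • mono (box I J L) (i - 1) j (ζ * g) :=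
  act_mono_eq hU hL hg i j (fun a ha => by simp [mono_of_notMem ha]) fun a ha => by
    simp [mono_apply ha, vp, ofZ]; ring

theorem act_ofZ_smul_vq_mono (ζ : ℝ → ℝ) :
    act (box I J L) (ofZ ζ • vq, 0) (mono (box I J L) i j g)
      = (j : ℝ) • mono (box I J L) i (j - 1) (ζ * g) :=
  act_mono_eq hU hL hg i j (fun a ha => by simp [mono_of_notMem ha]) fun a ha => by
    simp [mono_apply ha, vq, ofZ]; ring

theorem act_vert_mono (A B C : ℝ → ℝ) :
    act (box I J L) (vert A B C) (mono (box I J L) i j g)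
      = mono (box I J L) i j (A * dz L g + ((i + j : ℕ) : ℝ) • (B * g) + C * g) :=
  act_mono_eq hU hL hg i j (fun a ha => mono_of_notMem ha) fun a ha => by
    rcases i with _ | i <;> rcases j with _ | j <;>
      simp [mono_apply ha, cx, cy, vp, vq, vr, vert, euler, ofZ] <;> ring

theorem act_raiseX_mono (C : ℝ → ℝ) :
    act (box I J L) (raiseX C) (mono (box I J L) i j g)
      = mono (box I J L) (i + 1) j (((i + j : ℕ) : ℝ) • g + C * g) :=
  act_mono_eq hU hL hg i j (fun a ha => mono_of_notMem ha) fun a ha => by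
    rcases i with _ | i <;> rcases j with _ | j <;>
      simp [mono_apply ha, cx, cy, vp, vq, raiseX, ofZ] <;> ring

theorem act_raiseY_mono (C : ℝ → ℝ) :
    act (box I J L) (raiseY C) (mono (box I J L) i j g)
      = mono (box I J L) i (j + 1) (((i + j : ℕ) : ℝ) • g + C * g) :=
  act_mono_eq hU hL hg i j (fun a ha => mono_of_notMem ha) fun a ha => by
    rcases i with _ | i <;> rcases j with _ | j <;>
      simp [mono_apply ha, cx, cy, vp, vq, raiseY, ofZ] <;> ring

end Box

/-! ### Modules over `sl₂` -/

/-- The box `I × J × L` has nonempty open intervals as sides. -/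
structure IsOpenBox (I J L : Set ℝ) : Prop where
  oI : IsOpen I
  cI : I.OrdConnected
  nI : I.Nonempty
  oJ : IsOpen J
  cJ : J.OrdConnected
  nJ : J.Nonempty
  oL : IsOpen L
  cL : L.OrdConnected
  nL : L.Nonempty

/-- The component of degree `l` of a space `N` of functions on the box: the smooth functions `g` on
`L` with `x^i y^j g(z)` in `N` for all `i + j = l`. -/
def comp (I J L : Set ℝ) (N : Submodule ℝ (Space → ℝ)) (l : ℕ) : Submodule ℝ (ℝ → ℝ) :=
  smoothFun L ⊓ ⨅ p : {p : ℕ × ℕ // p.1 + p.2 = l}, N.comap (mono (box I J L) p.1.1 p.1.2)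

theorem mem_comp {I J L : Set ℝ} {N : Submodule ℝ (Space → ℝ)} {l : ℕ} {g : ℝ → ℝ} :
    g ∈ comp I J L N l ↔
      g ∈ smoothFun L ∧ ∀ i j, i + j = l → mono (box I J L) i j g ∈ N := by
  simp [comp]

theorem comp_le_smoothFun {I J L : Set ℝ} {N : Submodule ℝ (Space → ℝ)} {l : ℕ} :
    comp I J L N l ≤ smoothFun L := inf_le_left

theorem IsFixedModule.mono {U : Set Space} {g g' : Submodule ℝ DiffOp}
    {N : Submodule ℝ (Space → ℝ)} (h : IsFixedModule U g N) (hg : g' ≤ g) :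
    IsFixedModule U g' N :=
  ⟨h.smooth, h.finite, fun T hT => h.stable T (hg hT)⟩

theorem isFixedModule_bot {U : Set Space} {g : Submodule ℝ DiffOp} : IsFixedModule U g ⊥ where
  smooth := bot_le
  finite := inferInstance
  stable T _ f hf := by rw [(Submodule.mem_bot ℝ).1 hf, act_zero_right]; exact zero_mem _

theorem IsFixedModule.stable_of_mem {U : Set Space} {𝒯 : Set DiffOp} {N : Submodule ℝ (Space → ℝ)}
    (hN : IsFixedModule U (Submodule.span ℝ 𝒯) N) {T : DiffOp} (hT : T ∈ 𝒯) :
    ∀ f ∈ N, act U T f ∈ N := hN.stable T (Submodule.subset_span hT)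

theorem exists_ne_zero_mem {I : Set ℝ} (hI : IsOpen I) (hn : I.Nonempty) : ∃ x ∈ I, x ≠ 0 :=
  (dense_compl_singleton (0 : ℝ)).inter_open_nonempty I hI hn

theorem apply_mem_ker_of_commute {K V : Type*} [Field K] [AddCommGroup V] [Module K V]
    {A B : Module.End K V} (h : Commute A B) : ∀ v ∈ LinearMap.ker A, B v ∈ LinearMap.ker A := by
  intro v hv
  rw [LinearMap.mem_ker] at hv ⊢
  rw [← Module.End.mul_apply, h.eq, Module.End.mul_apply, hv, map_zero]

section Structure

variable {I J L : Set ℝ} (hB : IsOpenBox I J L)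
include hB

theorem IsOpenBox.isOpen : IsOpen (box I J L) := isOpen_box hB.oI hB.oJ hB.oL

theorem IsOpenBox.convex : Convex ℝ (box I J L) :=
  hB.cI.convex.prod (hB.cJ.convex.prod hB.cL.convex)

theorem mono_injective {i j : ℕ} {g : ℝ → ℝ} (hg : g ∈ smoothFun L)
    (h : mono (box I J L) i j g = 0) : g = 0 := by
  obtain ⟨x, hx, hx0⟩ := exists_ne_zero_mem hB.oI hB.nI
  obtain ⟨y, hy, hy0⟩ := exists_ne_zero_mem hB.oJ hB.nJ
  refine smoothFun_ext hg (Submodule.zero_mem _) fun z hz => ?_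
  have hxyz := congrFun h (x, y, z)
  rw [mono_apply (show (x, y, z) ∈ box I J L from ⟨hx, hy, hz⟩)] at hxyz
  simpa [hx0, hy0] using hxyz

theorem apply_eq_of_derX_eq_zero {f : smoothFun (box I J L)} (hx : derX hB.isOpen f = 0)
    (hy : derY hB.isOpen f = 0) {a b : Space} (ha : a ∈ box I J L) (hb : b ∈ box I J L)
    (hz : a.2.2 = b.2.2) : (f : Space → ℝ) a = (f : Space → ℝ) b := by
  obtain ⟨c, hc, hfc⟩ := domain_mvt (fun c hc => (differentiableAt_of_mem_smoothFun hB.isOpen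
    f.2 hc).hasFDerivAt.hasFDerivWithinAt) hB.convex ha hb
  have hcB : c ∈ box I J L := hB.convex.segment_subset ha hb hc
  have hxc : fderiv ℝ (f : Space → ℝ) c (1, 0, 0) = 0 := by
    rw [← der_apply hB.isOpen _ _ hcB]
    exact congrFun (congrArg Subtype.val hx) c
  have hyc : fderiv ℝ (f : Space → ℝ) c (0, 1, 0) = 0 := by
    rw [← der_apply hB.isOpen _ _ hcB]
    exact congrFun (congrArg Subtype.val hy) c
  have hba : b - a = (b - a).1 • ((1, 0, 0) : Space) + (b - a).2.1 • ((0, 1, 0) : Space) := by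
    ext <;> simp [hz]
  rw [hba, map_add, map_smul, map_smul, hxc, hyc, smul_zero, smul_zero, add_zero] at hfc
  exact (sub_eq_zero.1 hfc).symm

theorem exists_eq_mono_zero {f : smoothFun (box I J L)} (hx : derX hB.isOpen f = 0)
    (hy : derY hB.isOpen f = 0) : ∃ g ∈ smoothFun L, (f : Space → ℝ) = mono (box I J L) 0 0 g := by
  obtain ⟨x₀, hx₀⟩ := hB.nI
  obtain ⟨y₀, hy₀⟩ := hB.nJ
  have hg : L.indicator (fun z => (f : Space → ℝ) (x₀, y₀, z)) ∈ smoothFun L :=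
    indicator_mem_smoothFun (f.2.1.comp (f := fun z : ℝ => ((x₀, y₀, z) : Space))
      (by fun_prop) fun z hz => ⟨hx₀, hy₀, hz⟩)
  refine ⟨_, hg, smoothFun_ext f.2 (mono_mem_smoothFun 0 0 hg) fun a ha => ?_⟩
  rw [mono_apply ha, Set.indicator_of_mem ha.2.2, pow_zero, pow_zero, one_mul, one_mul]
  exact apply_eq_of_derX_eq_zero hB hx hy ha ⟨hx₀, hy₀, ha.2.2⟩ rfl

theorem exists_eq_sum_mono {k : ℕ} {f : smoothFun (box I J L)}
    (hx : (derX hB.isOpen ^ k) f = 0) (hy : (derY hB.isOpen ^ k) f = 0) :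
    ∃ g : ℕ × ℕ → smoothFun L, (f : Space → ℝ) =
      ∑ p ∈ Finset.range k ×ˢ Finset.range k, mono (box I J L) p.1 p.2 (g p) := by
  have hD := commute_derX_derY hB.isOpen
  obtain ⟨u, hu, hfu⟩ := weyl_expansion (derY_mul_mulY hB.isOpen)
    (apply_mem_ker_of_commute (hD.pow_left k))
    (apply_mem_ker_of_commute ((commute_derX_mulY hB.isOpen).pow_left k)) k f hx hy
  choose w hw huw using fun j => weyl_expansion (derX_mul_mulX hB.isOpen)
    (apply_mem_ker_of_commute hD.symm) (apply_mem_ker_of_commute (commute_derY_mulX hB.isOpen))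
    k (u j) (hu j).2 (hu j).1
  choose g hg hgw using fun i j => exists_eq_mono_zero hB (hw j i).2 (hw j i).1
  refine ⟨fun p => ⟨g p.1 p.2, hg _ _⟩, ?_⟩
  rw [Finset.sum_product_right, hfu, AddSubmonoidClass.coe_finsetSum]
  refine Finset.sum_congr rfl fun j _ => ?_
  rw [huw j, map_sum, AddSubmonoidClass.coe_finsetSum]
  refine Finset.sum_congr rfl fun i _ => ?_
  ext a
  rw [mulY_pow_apply, mulX_pow_apply, hgw]
  by_cases ha : a ∈ box I J L
  · rw [mono_apply ha, mono_apply ha]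
    ring
  · simp only [mono_of_notMem ha, mul_zero]

/-- `x^i y^j g(z)` as an element of the space of smooth functions on the box, on which the operators
`derX`, `mulX`, … are defined. -/
def smoothMono (I J : Set ℝ) (p : ℕ × ℕ) (g : smoothFun L) : smoothFun (box I J L) :=
  ⟨mono (box I J L) p.1 p.2 g, mono_mem_smoothFun p.1 p.2 g.2⟩

theorem sl2H_smoothMono (p : ℕ × ℕ) (g : smoothFun L) :
    sl2H hB.isOpen (smoothMono I J p g) = ((p.1 : ℝ) - p.2) • smoothMono I J p g :=
  Subtype.ext ((coe_sl2H hB.isOpen _).trans (act_xp_sub_yq_mono hB.isOpen hB.oL g.2 p.1 p.2))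

theorem sl2E_sl2F_smoothMono (p : ℕ × ℕ) (g : smoothFun L) :
    sl2E hB.isOpen (sl2F hB.isOpen (smoothMono I J p g))
      = ((p.1 : ℝ) * (p.2 + 1)) • smoothMono I J p g := by
  obtain ⟨i, j⟩ := p
  have hF : sl2F hB.isOpen (smoothMono I J (i, j) g) = (i : ℝ) • smoothMono I J (i - 1, j + 1) g :=
    Subtype.ext ((coe_sl2F hB.isOpen _).trans (act_yp_mono hB.isOpen hB.oL g.2 i j))
  have hE : sl2E hB.isOpen (smoothMono I J (i - 1, j + 1) g)
      = ((j + 1 : ℕ) : ℝ) • smoothMono I J (i - 1 + 1, j) g :=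
    Subtype.ext ((coe_sl2E hB.isOpen _).trans (act_xq_mono hB.isOpen hB.oL g.2 (i - 1) (j + 1)))
  rw [hF, map_smul, hE, smul_smul]
  rcases i with _ | i <;> simp

/-- Up to a function of `H` this is the Casimir operator `H² + 2H + 4FE`; it is chosen so that
distinct monomials `x^i y^j` have distinct eigenvalues. -/
def separator {U : Set Space} (hU : IsOpen U) : Module.End ℝ (smoothFun U) :=
  sl2H hU * sl2H hU - sl2H hU + (4 : ℝ) • (sl2E hU * sl2F hU)

theorem separator_smoothMono (p : ℕ × ℕ) (g : smoothFun L) :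
    separator hB.isOpen (smoothMono I J p g)
      = (((p.1 + p.2) ^ 2 + 3 * p.1 + p.2 : ℕ) : ℝ) • smoothMono I J p g := by
  simp only [separator, LinearMap.add_apply, LinearMap.sub_apply, LinearMap.smul_apply,
    Module.End.mul_apply, sl2H_smoothMono hB, sl2E_sl2F_smoothMono hB, map_smul]
  push_cast
  module

omit hB in
theorem add_sq_add_injective :
    Function.Injective fun p : ℕ × ℕ => (p.1 + p.2) ^ 2 + 3 * p.1 + p.2 := by
  have hlt {i j i' j' : ℕ} (h : i + j < i' + j') :
      (i + j) ^ 2 + 3 * i + j < (i' + j') ^ 2 + 3 * i' + j' := by nlinarith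
  rintro ⟨i, j⟩ ⟨i', j'⟩ hp
  dsimp only at hp
  obtain h | h | h := lt_trichotomy (i + j) (i' + j')
  · exact absurd hp (hlt h).ne
  · rw [h] at hp
    ext <;> dsimp only <;> omega
  · exact absurd hp (hlt h).ne'

section Sl2

variable {N : Submodule ℝ (Space → ℝ)}
  (hN : IsFixedModule (box I J L) (Submodule.span ℝ sl2) N)
include hN

omit hB in
theorem act_xq_mem : ∀ f ∈ N, act (box I J L) (cx • vq, 0) f ∈ N :=
  hN.stable_of_mem (Or.inl rfl)

omit hB in
theorem act_yp_mem : ∀ f ∈ N, act (box I J L) (cy • vp, 0) f ∈ N :=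
  hN.stable_of_mem (Or.inr (Or.inr rfl))

theorem sl2E_mem : ∀ f ∈ N.comap (smoothFun (box I J L)).subtype,
    sl2E hB.isOpen f ∈ N.comap (smoothFun (box I J L)).subtype := fun f hf => by
  rw [Submodule.mem_comap, Submodule.subtype_apply, coe_sl2E]
  exact act_xq_mem hN _ hf

theorem sl2F_mem : ∀ f ∈ N.comap (smoothFun (box I J L)).subtype,
    sl2F hB.isOpen f ∈ N.comap (smoothFun (box I J L)).subtype := fun f hf => by
  rw [Submodule.mem_comap, Submodule.subtype_apply, coe_sl2F]
  exact act_yp_mem hN _ hf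

theorem sl2H_mem : ∀ f ∈ N.comap (smoothFun (box I J L)).subtype,
    sl2H hB.isOpen f ∈ N.comap (smoothFun (box I J L)).subtype := fun f hf => by
  rw [Submodule.mem_comap, Submodule.subtype_apply, coe_sl2H]
  exact hN.stable_of_mem (Or.inr (Or.inl rfl)) _ hf

theorem separator_mem : ∀ f ∈ N.comap (smoothFun (box I J L)).subtype,
    separator hB.isOpen f ∈ N.comap (smoothFun (box I J L)).subtype := fun f hf =>
  add_mem (sub_mem (sl2H_mem hB hN _ (sl2H_mem hB hN f hf)) (sl2H_mem hB hN f hf))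
    (Submodule.smul_mem _ _ (sl2E_mem hB hN _ (sl2F_mem hB hN f hf)))

theorem exists_derX_pow_eq_zero : ∃ k : ℕ, ∀ f : smoothFun (box I J L), (f : Space → ℝ) ∈ N →
    (derX hB.isOpen ^ k) f = 0 ∧ (derY hB.isOpen ^ k) f = 0 := by
  have : FiniteDimensional ℝ N := hN.finite
  have := finiteDimensional_comap_subtype (smoothFun (box I J L)) N
  obtain ⟨kE, hkE⟩ := exists_le_ker_pow_of_commutator _ (sl2H_mem hB hN) (sl2E_mem hB hN)
    two_ne_zero (sl2H_commutator_sl2E hB.isOpen)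
  obtain ⟨kF, hkF⟩ := exists_le_ker_pow_of_commutator _ (sl2H_mem hB hN) (sl2F_mem hB hN)
    (neg_ne_zero.2 two_ne_zero) (sl2H_commutator_sl2F hB.isOpen)
  -- `(xq)^k = x^k q^k` and `(yp)^k = y^k p^k`, and multiplication by `x` or `y` is injective.
  have hY : ∀ f : smoothFun (box I J L), (f : Space → ℝ) ∈ N → (derY hB.isOpen ^ kE) f = 0 := by
    intro f hf
    have hxq : (mulX (box I J L) ^ kE) ((derY hB.isOpen ^ kE) f) = 0 := by
      rw [← Module.End.mul_apply, ← (commute_derY_mulX hB.isOpen).symm.mul_pow]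
      exact hkE hf
    rw [Module.End.pow_apply] at hxq
    exact (mulX_injective hB.isOpen).iterate kE (hxq.trans (iterate_map_zero _ _).symm)
  have hX : ∀ f : smoothFun (box I J L), (f : Space → ℝ) ∈ N → (derX hB.isOpen ^ kF) f = 0 := by
    intro f hf
    have hyp : (mulY (box I J L) ^ kF) ((derX hB.isOpen ^ kF) f) = 0 := by
      rw [← Module.End.mul_apply, ← (commute_derX_mulY hB.isOpen).symm.mul_pow]
      exact hkF hf
    rw [Module.End.pow_apply] at hyp
    exact (mulY_injective hB.isOpen).iterate kF (hyp.trans (iterate_map_zero _ _).symm)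
  exact ⟨max kE kF, fun f hf =>
    ⟨Module.End.pow_map_zero_of_le (le_max_right _ _) (hX f hf),
      Module.End.pow_map_zero_of_le (le_max_left _ _) (hY f hf)⟩⟩

theorem mono_add_zero_mem {g : ℝ → ℝ} (hg : g ∈ smoothFun L) {i j : ℕ}
    (h : mono (box I J L) i j g ∈ N) : mono (box I J L) (i + j) 0 g ∈ N := by
  induction j generalizing i with
  | zero => exact h
  | succ j ih =>
    have hxq := act_xq_mem hN _ h
    rw [act_xq_mono hB.isOpen hB.oL hg] at hxq
    have hij : i + (j + 1) = i + 1 + j := by ring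
    exact hij ▸ ih ((N.smul_mem_iff (by positivity)).1 hxq)

theorem mono_mem_of_mono_add_zero_mem {g : ℝ → ℝ} (hg : g ∈ smoothFun L) {i j : ℕ}
    (h : mono (box I J L) (i + j) 0 g ∈ N) : mono (box I J L) i j g ∈ N := by
  induction j generalizing i with
  | zero => exact h
  | succ j ih =>
    have hij : i + (j + 1) = i + 1 + j := by ring
    have hyp := act_yp_mem hN _ (ih (hij ▸ h))
    rw [act_yp_mono hB.isOpen hB.oL hg] at hyp
    exact (N.smul_mem_iff (by positivity)).1 hyp

theorem mem_comp_of_mono_mem {i j l : ℕ} (hl : i + j = l) {g : ℝ → ℝ} (hg : g ∈ smoothFun L)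
    (h : mono (box I J L) i j g ∈ N) : g ∈ comp I J L N l :=
  mem_comp.2 ⟨hg, fun _ _ hij => mono_mem_of_mono_add_zero_mem hB hN hg
    (hij ▸ hl ▸ mono_add_zero_mem hB hN hg h)⟩

theorem mono_mem_of_sum_mem {s : Finset (ℕ × ℕ)} {g : ℕ × ℕ → smoothFun L}
    (h : ∑ p ∈ s, mono (box I J L) p.1 p.2 (g p) ∈ N) :
    ∀ p ∈ s, mono (box I J L) p.1 p.2 (g p) ∈ N :=
  mem_of_sum_eigenvectors_mem (v := fun p => smoothMono I J p (g p)) (separator_mem hB hN)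
    (Nat.cast_injective.comp add_sq_add_injective).injOn
    (fun p _ => separator_smoothMono hB p (g p))
    (Submodule.mem_comap.2 (by rwa [map_sum]))

theorem comp_eq_bot_of_le : ∃ k : ℕ, ∀ l, k ≤ l → comp I J L N l = ⊥ := by
  obtain ⟨k, hk⟩ := exists_derX_pow_eq_zero hB hN
  refine ⟨k, fun l hl => (Submodule.eq_bot_iff _).2 fun g hg => ?_⟩
  obtain ⟨hgs, hg⟩ := mem_comp.1 hg
  set e := smoothMono I J (0, 0) ⟨g, hgs⟩
  have hY : ((mulY (box I J L) ^ l) e : Space → ℝ) = mono (box I J L) 0 l g := by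
    ext a
    rw [mulY_pow_apply]
    change _ * mono (box I J L) 0 0 g a = _
    by_cases ha : a ∈ box I J L
    · rw [mono_apply ha, mono_apply ha]
      ring
    · simp only [mono_of_notMem ha, mul_zero]
  have he : derY hB.isOpen e = 0 := by
    refine Subtype.ext (smoothFun_ext (Subtype.property _) (Submodule.zero_mem _) fun a ha => ?_)
    have hq := congrFun (act_ofZ_smul_vq_mono hB.isOpen hB.oL hgs 0 0 1) a
    rw [act_of_mem ha] at hq
    rw [derY, der_apply _ _ _ ha]
    change fderiv ℝ (mono (box I J L) 0 0 g) a (0, 1, 0) = 0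
    simpa [ofZ, vq] using hq
  have hfact := weyl_pow_apply_pow (derY_mul_mulY hB.isOpen) he l
  rw [Module.End.pow_map_zero_of_le hl (hk _ (hY ▸ hg 0 l (zero_add l))).2, eq_comm,
    smul_eq_zero, or_iff_right (Nat.cast_ne_zero.2 l.factorial_ne_zero)] at hfact
  exact mono_injective hB hgs (congrArg Subtype.val hfact)

theorem eq_polyModule_comp {n : ℕ} (hn : ∀ l, n < l → comp I J L N l = ⊥) :
    N = polyModule (box I J L) n (comp I J L N) := by
  apply le_antisymm
  · intro f hf
    obtain ⟨k, hk⟩ := exists_derX_pow_eq_zero hB hN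
    obtain ⟨hx, hy⟩ := hk ⟨f, hN.smooth hf⟩ hf
    obtain ⟨g, hfg⟩ := exists_eq_sum_mono hB hx hy
    change f = _ at hfg
    have hmem := mono_mem_of_sum_mem hB hN (hfg ▸ hf)
    rw [hfg]
    refine Submodule.sum_mem _ fun p hp => ?_
    have hgp := mem_comp_of_mono_mem hB hN rfl (g p).2 (hmem p hp)
    by_cases hpn : p.1 + p.2 ≤ n
    · exact Submodule.subset_span ⟨p.1, p.2, hpn, g p, hgp, rfl⟩
    · rw [hn _ (not_le.1 hpn), Submodule.mem_bot] at hgp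
      rw [hgp, map_zero]
      exact Submodule.zero_mem _
  · rw [polyModule, Submodule.span_le]
    rintro _ ⟨i, j, -, g, hg, rfl⟩
    exact (mem_comp.1 hg).2 i j rfl

theorem finiteFamily_comp (n : ℕ) : FiniteFamily L n (comp I J L N) := by
  refine fun l _ => ⟨comp_le_smoothFun, ?_⟩
  have : FiniteDimensional ℝ N := hN.finite
  refine Module.Finite.of_injective ((mono (box I J L) l 0).restrict (q := N)
    fun g hg => (mem_comp.1 hg).2 l 0 (add_zero l)) ?_
  rw [injective_iff_map_eq_zero]
  exact fun g hg => Subtype.ext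
    (mono_injective hB (mem_comp.1 g.2).1 (congrArg Subtype.val hg))

theorem exists_comp_ne_bot (h0 : N ≠ ⊥) : ∃ l, comp I J L N l ≠ ⊥ := by
  by_contra! hbot
  apply h0
  rw [eq_polyModule_comp hB hN (n := 0) fun l _ => hbot l, polyModule, Submodule.span_eq_bot]
  rintro _ ⟨i, j, -, g, hg, rfl⟩
  rw [hbot, Submodule.mem_bot] at hg
  exact hg ▸ map_zero (mono (box I J L) i j)

theorem exists_top (h0 : N ≠ ⊥) :
    ∃ n, comp I J L N n ≠ ⊥ ∧ ∀ l, n < l → comp I J L N l = ⊥ := by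
  obtain ⟨k, hk⟩ := comp_eq_bot_of_le hB hN
  have hbdd : BddAbove {l | comp I J L N l ≠ ⊥} :=
    ⟨k, fun l hl => le_of_not_ge fun hkl => hl (hk l hkl)⟩
  exact ⟨_, Nat.sSup_mem (exists_comp_ne_bot hB hN h0) hbdd,
    fun l hl => not_not.1 (notMem_of_csSup_lt hl hbdd)⟩

end Sl2

end Structure

/-! ### Spaces of polynomials in z -/

section Polynomials

variable {L : Set ℝ}

theorem hasDerivAt_dz (hL : IsOpen L) {g : ℝ → ℝ} (hg : g ∈ smoothFun L) {z : ℝ} (hz : z ∈ L) :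
    HasDerivAt g (dz L g z) z := by
  rw [dz, Set.indicator_of_mem hz]
  exact (differentiableAt_of_mem_smoothFun hL hg hz).hasDerivAt

theorem hasDerivAt_indicator {F : Type*} [NormedAddCommGroup F] [NormedSpace ℝ F] (hL : IsOpen L)
    {φ : ℝ → F} {φ' : F} {z : ℝ} (hz : z ∈ L) (h : HasDerivAt φ φ' z) :
    HasDerivAt (L.indicator φ) φ' z :=
  h.congr_of_eventuallyEq (Set.eqOn_indicator.eventuallyEq_of_mem (hL.mem_nhds hz))

theorem dz_indicator (hL : IsOpen L) {φ φ' : ℝ → ℝ} (h : ∀ z ∈ L, HasDerivAt φ (φ' z) z) :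
    dz L (L.indicator φ) = L.indicator φ' :=
  Set.indicator_congr fun z hz => (hasDerivAt_indicator hL hz (h z hz)).deriv

theorem dz_zero (L : Set ℝ) : dz L 0 = 0 := by
  ext z
  by_cases hz : z ∈ L <;> simp [dz, hz]

theorem dz_add (hL : IsOpen L) {f g : ℝ → ℝ} (hf : f ∈ smoothFun L) (hg : g ∈ smoothFun L) :
    dz L (f + g) = dz L f + dz L g :=
  congrArg Subtype.val (map_add (der hL 1) (⟨f, hf⟩ : smoothFun L) ⟨g, hg⟩)

theorem dz_smul (hL : IsOpen L) (c : ℝ) {f : ℝ → ℝ} (hf : f ∈ smoothFun L) :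
    dz L (c • f) = c • dz L f :=
  congrArg Subtype.val (map_smul (der hL 1) c (⟨f, hf⟩ : smoothFun L))

variable (L) in
/-- The function `z^k` on `L`. -/
def smoothPow (k : ℕ) : smoothFun L :=
  ⟨L.indicator fun z => z ^ k, indicator_mem_smoothFun (contDiff_id.pow k).contDiffOn⟩

variable (L) in
/-- The span of the powers `z^k` with `P k`, on `L`. -/
def powSpan (P : ℕ → Prop) : Submodule ℝ (ℝ → ℝ) :=
  Submodule.span ℝ {g | ∃ k, P k ∧ g = L.indicator fun z => z ^ k}

theorem pow_mem_powSpan {P : ℕ → Prop} {k : ℕ} (hk : P k) :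
    L.indicator (fun z : ℝ => z ^ k) ∈ powSpan L P :=
  Submodule.subset_span ⟨k, hk, rfl⟩

theorem powSpan_le_smoothFun (L : Set ℝ) (P : ℕ → Prop) : powSpan L P ≤ smoothFun L := by
  rw [powSpan, Submodule.span_le]
  rintro _ ⟨k, -, rfl⟩
  exact (smoothPow L k).2

theorem finiteDimensional_powSpan (L : Set ℝ) {P : ℕ → Prop} {b : ℕ} (hP : ∀ k, P k → k ≤ b) :
    FiniteDimensional ℝ (powSpan L P) := by
  refine FiniteDimensional.span_of_finite ℝ
    (((Set.finite_Iic b).image fun k => L.indicator fun z : ℝ => z ^ k).subset ?_)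
  rintro _ ⟨k, hk, rfl⟩
  exact ⟨k, hP k hk, rfl⟩

variable (L) in
/-- Restriction of polynomial functions to `L`. -/
def polyOn : Polynomial ℝ →ₗ[ℝ] (ℝ → ℝ) where
  toFun p := L.indicator fun z => p.eval z
  map_add' p q := by ext z; by_cases hz : z ∈ L <;> simp [hz]
  map_smul' c p := by ext z; by_cases hz : z ∈ L <;> simp [hz]

theorem polyOn_X_pow (L : Set ℝ) (k : ℕ) :
    polyOn L (Polynomial.X ^ k) = L.indicator fun z => z ^ k := by
  change L.indicator (fun z => (Polynomial.X ^ k : Polynomial ℝ).eval z) = _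
  simp

theorem polyOn_injective (hL : L.Infinite) : Function.Injective (polyOn L) := fun p q h =>
  Polynomial.eq_of_infinite_eval_eq _ _ (hL.mono fun z hz => by
    simpa [polyOn, hz] using congrFun h z)

theorem le_of_pow_mem_powSpan (hL : L.Infinite) {k m : ℕ}
    (h : L.indicator (fun z : ℝ => z ^ k) ∈ powSpan L (· ≤ m)) : k ≤ m := by
  have hle : powSpan L (· ≤ m) ≤ (Polynomial.degreeLE ℝ m).map (polyOn L) := by
    rw [powSpan, Submodule.span_le]
    rintro _ ⟨j, hj, rfl⟩
    refine ⟨Polynomial.X ^ j, ?_, polyOn_X_pow L j⟩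
    rw [SetLike.mem_coe, Polynomial.mem_degreeLE, Polynomial.degree_X_pow]
    exact_mod_cast hj
  obtain ⟨p, hp, hpk⟩ := hle h
  rw [polyOn_injective hL (hpk.trans (polyOn_X_pow L k).symm), SetLike.mem_coe,
    Polynomial.mem_degreeLE, Polynomial.degree_X_pow] at hp
  exact_mod_cast hp

theorem dz_pow (hL : IsOpen L) (k : ℕ) : dz L (L.indicator fun z : ℝ => z ^ k)
    = (k : ℝ) • L.indicator fun z : ℝ => z ^ (k - 1) := by
  rw [dz_indicator hL fun z _ => hasDerivAt_pow k z]
  exact Set.indicator_const_smul L (k : ℝ) fun z => z ^ (k - 1)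

theorem pow_mul_indicator_pow (L : Set ℝ) (e k : ℕ) :
    (fun z : ℝ => z ^ e) * (L.indicator fun z : ℝ => z ^ k)
      = L.indicator fun z : ℝ => z ^ (e + k) := by
  ext z
  by_cases hz : z ∈ L <;> simp [hz, pow_add]

theorem exists_eq_smul_smoothPow_zero (hL : IsOpen L) (hc : L.OrdConnected) {v : smoothFun L}
    (hv : der hL 1 v = 0) : ∃ c : ℝ, v = c • smoothPow L 0 := by
  rcases L.eq_empty_or_nonempty with rfl | ⟨z₀, hz₀⟩
  · exact ⟨0, Subtype.ext (smoothFun_ext v.2 (Subtype.property _) (by simp))⟩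
  have hderiv (z : ℝ) (hz : z ∈ L) : HasDerivAt (v : ℝ → ℝ) 0 z := by
    have h := hasDerivAt_dz hL v.2 hz
    rwa [← der_one_eq_dz hL, hv] at h
  refine ⟨(v : ℝ → ℝ) z₀, Subtype.ext (smoothFun_ext v.2 (Subtype.property _) fun z hz => ?_)⟩
  have hconst := hL.is_const_of_deriv_eq_zero hc.isPreconnected
    (fun a ha => (hderiv a ha).differentiableAt.differentiableWithinAt)
    (fun a ha => (hderiv a ha).deriv) hz hz₀
  simp [smoothPow, hz, hconst]

theorem exists_eq_powSpan (hL : IsOpen L) (hc : L.OrdConnected)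
    {G : Submodule ℝ (ℝ → ℝ)} (hG : G ≤ smoothFun L) [FiniteDimensional ℝ G]
    (hdz : ∀ g ∈ G, dz L g ∈ G) (hzdz : ∀ g ∈ G, id * dz L g ∈ G) :
    ∃ m, G = powSpan L (· < m) := by
  let D := der hL 1
  let M := mulBy (contDiff_id.contDiffOn : ContDiffOn ℝ ∞ (id : ℝ → ℝ) L)
  let W := G.comap (smoothFun L).subtype
  have := finiteDimensional_comap_subtype (smoothFun L) G
  have hDM : D * M - M * D = 1 := by
    simpa using der_mul_mulBy hL 1 contDiff_id.contDiffOn _ fun a _ => hasFDerivAt_id a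
  have hWD : ∀ w ∈ W, D w ∈ W := fun w hw => hdz w hw
  obtain ⟨k, hk⟩ := exists_le_ker_pow_of_commutator W (fun w hw => hzdz w hw) hWD
    (by norm_num) (weyl_mul_commutator hDM)
  have hker (v : smoothFun L) (hv : D v = 0) := exists_eq_smul_smoothPow_zero hL hc hv
  obtain ⟨m, hm⟩ := exists_eq_ker_pow hker hWD hk
  have hconst : D (smoothPow L 0) = 0 := Subtype.ext ((dz_pow hL 0).trans (by simp))
  have hpow (j : ℕ) : ((M ^ j) (smoothPow L 0) : ℝ → ℝ) = L.indicator fun z => z ^ j := by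
    ext z
    rw [mulBy_pow_apply]
    by_cases hz : z ∈ L <;> simp [smoothPow, hz]
  have hGW : G = W.map (smoothFun L).subtype := by
    rw [Submodule.map_comap_subtype, inf_eq_right.2 hG]
  refine ⟨m, ?_⟩
  rw [hGW, hm, weyl_ker_pow_eq_span hDM hconst hker, Submodule.map_span, powSpan]
  congr 1
  ext g
  constructor
  · rintro ⟨_, ⟨j, hj, rfl⟩, rfl⟩
    exact ⟨j, hj, hpow j⟩
  · rintro ⟨j, hj, rfl⟩
    exact ⟨_, ⟨j, hj, rfl⟩, hpow j⟩

end Polynomials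

/-! ### Exponential spaces -/

section Complexification

variable {X : Type*} {A : Submodule ℝ (X → ℝ)}

/-- The complex functions with real and imaginary parts in a given space, a concrete model of the
complexification of that space. -/
def complexify (A : Submodule ℝ (X → ℝ)) : Submodule ℂ (X → ℂ) where
  carrier := {f | (fun a => (f a).re) ∈ A ∧ (fun a => (f a).im) ∈ A}
  add_mem' := fun hf hg => ⟨A.add_mem hf.1 hg.1, A.add_mem hf.2 hg.2⟩
  zero_mem' := ⟨A.zero_mem, A.zero_mem⟩
  smul_mem' := by
    intro c f hf
    constructor
    · convert A.sub_mem (A.smul_mem c.re hf.1) (A.smul_mem c.im hf.2) using 1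
      ext a; simp
    · convert A.add_mem (A.smul_mem c.re hf.2) (A.smul_mem c.im hf.1) using 1
      ext a; simp

theorem ofReal_mem_complexify {f : X → ℝ} (hf : f ∈ A) : (fun a => (f a : ℂ)) ∈ complexify A :=
  ⟨hf, A.zero_mem⟩

theorem indicator_mem_complexify {s : Set X} {φ : X → ℂ} : s.indicator φ ∈ complexify A ↔
    s.indicator (fun a => (φ a).re) ∈ A ∧ s.indicator (fun a => (φ a).im) ∈ A := by
  rw [show s.indicator (fun a => (φ a).re) = fun a => (s.indicator φ a).re from
      Set.indicator_comp_of_zero Complex.zero_re,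
    show s.indicator (fun a => (φ a).im) = fun a => (s.indicator φ a).im from
      Set.indicator_comp_of_zero Complex.zero_im]
  rfl

theorem finiteDimensional_complexify (A : Submodule ℝ (X → ℝ)) [FiniteDimensional ℝ A] :
    FiniteDimensional ℂ (complexify A) := by
  let φ : complexify A →ₗ[ℝ] A × A :=
    { toFun := fun f => (⟨_, f.2.1⟩, ⟨_, f.2.2⟩)
      map_add' := fun f g => by ext <;> simp
      map_smul' := fun c f => by ext <;> simp }
  have hφ : Function.Injective φ := fun f g h => Subtype.ext (funext fun a => Complex.ext
    (congrArg (fun p : A × A => (p.1 : X → ℝ) a) h) (congrArg (fun p : A × A => (p.2 : X → ℝ) a) h))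
  have := Module.Finite.of_injective φ hφ
  exact Module.Finite.of_restrictScalars_finite ℝ ℂ _

end Complexification

section Exponentials

variable {L : Set ℝ}

/-- The derivative `df/dz` of a complex-valued function on `L`, extended by zero. It is taken
separately on real and imaginary parts, so that `dz`-stable spaces have `dzC`-stable
complexifications by definition. -/
def dzC (L : Set ℝ) (f : ℝ → ℂ) : ℝ → ℂ :=
  fun z => ⟨dz L (fun t => (f t).re) z, dz L (fun t => (f t).im) z⟩

theorem dzC_of_notMem (f : ℝ → ℂ) {z : ℝ} (hz : z ∉ L) : dzC L f z = 0 :=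
  Complex.ext (Set.indicator_of_notMem hz _) (Set.indicator_of_notMem hz _)

theorem zero_of_mem_complexify {f : ℝ → ℂ} (hf : f ∈ complexify (smoothFun L)) {z : ℝ}
    (hz : z ∉ L) : f z = 0 := Complex.ext (hf.1.2 z hz) (hf.2.2 z hz)

theorem hasDerivAt_dzC (hL : IsOpen L) {f : ℝ → ℂ} (hf : f ∈ complexify (smoothFun L)) {z : ℝ}
    (hz : z ∈ L) : HasDerivAt f (dzC L f z) z := by
  have h := (hasDerivAt_dz hL hf.1 hz).ofReal_comp.add
    ((hasDerivAt_dz hL hf.2 hz).ofReal_comp.mul_const Complex.I)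
  exact (h.congr_deriv (Complex.re_add_im (dzC L f z))).congr_of_eventuallyEq
    (.of_forall fun t => (Complex.re_add_im (f t)).symm)

theorem dzC_eq (hL : IsOpen L) {f f' : ℝ → ℂ} (hf : f ∈ complexify (smoothFun L))
    (h : ∀ z ∈ L, HasDerivAt f (f' z) z) (h0 : ∀ z ∉ L, f' z = 0) : dzC L f = f' := by
  ext z
  by_cases hz : z ∈ L
  · exact (hasDerivAt_dzC hL hf hz).unique (h z hz)
  · rw [dzC_of_notMem f hz, h0 z hz]

/-- `d/dz` as an operator on the complex smooth functions on `L`. -/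
def derC (hL : IsOpen L) : Module.End ℂ (complexify (smoothFun L)) where
  toFun f := ⟨dzC L f, dz_mem_smoothFun hL f.2.1, dz_mem_smoothFun hL f.2.2⟩
  map_add' f g := Subtype.ext <| dzC_eq hL (f' := dzC L f + dzC L g) (f + g).2
    (fun _ hz => (hasDerivAt_dzC hL f.2 hz).add (hasDerivAt_dzC hL g.2 hz))
    fun _ hz => by simp [dzC_of_notMem _ hz]
  map_smul' c f := Subtype.ext <| dzC_eq hL (f' := c • dzC L f) (c • f).2
    (fun _ hz => (hasDerivAt_dzC hL f.2 hz).const_smul c)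
    fun _ hz => by simp [dzC_of_notMem _ hz]

theorem mul_mem_complexify {f : ℝ → ℂ} (hf : f ∈ complexify (smoothFun L)) :
    (fun z : ℝ => (z : ℂ) * f z) ∈ complexify (smoothFun L) := by
  have hid : ContDiffOn ℝ ∞ (id : ℝ → ℝ) L := contDiff_id.contDiffOn
  constructor
  · convert mul_mem_smoothFun hid hf.1 using 1
    ext z; simp
  · convert mul_mem_smoothFun hid hf.2 using 1
    ext z; simp

variable (L) in
/-- Multiplication by `z` as an operator on the complex smooth functions on `L`. -/
def mulC : Module.End ℂ (complexify (smoothFun L)) where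
  toFun f := ⟨_, mul_mem_complexify f.2⟩
  map_add' f g := by ext z; simp [mul_add]
  map_smul' c f := by ext z; simp [mul_left_comm]

theorem derC_mulC (hL : IsOpen L) : derC hL * mulC L - mulC L * derC hL = 1 := by
  refine LinearMap.ext fun f => sub_eq_iff_eq_add.2 (Subtype.ext ?_)
  refine dzC_eq hL (f' := fun z => (f : ℝ → ℂ) z + z * dzC L f z) (mulC L f).2
    (fun z hz => ?_) fun z hz => ?_
  · refine ((hasDerivAt_id z).ofReal_comp.mul (hasDerivAt_dzC hL f.2 hz)).congr_deriv ?_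
    simp
  · simp [zero_of_mem_complexify f.2 hz, dzC_of_notMem _ hz]

theorem derC_sub_mulC (hL : IsOpen L) (lam : ℂ) :
    (derC hL - lam • 1) * mulC L - mulC L * (derC hL - lam • 1) = 1 := by
  refine Eq.trans (LinearMap.ext fun v => ?_) (derC_mulC hL)
  simp only [Module.End.mul_apply, LinearMap.sub_apply, LinearMap.smul_apply,
    Module.End.one_apply, map_sub, map_smul]
  abel

/-- The function `z^k e^{λz}`. -/
def cexpMonomial (lam : ℂ) (k : ℕ) : ℝ → ℂ := fun z => (z : ℂ) ^ k * Complex.exp (lam * z)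

theorem contDiff_cexpMonomial (lam : ℂ) (k : ℕ) : ContDiff ℝ ∞ (cexpMonomial lam k) := by
  have : ContDiff ℝ ∞ (fun z : ℝ => (z : ℂ)) := Complex.ofRealCLM.contDiff
  exact (this.pow k).mul ((contDiff_const.mul this).cexp)

theorem hasDerivAt_cexpMonomial (lam : ℂ) (k : ℕ) (z : ℝ) :
    HasDerivAt (cexpMonomial lam k)
      (k * cexpMonomial lam (k - 1) z + lam * cexpMonomial lam k z) z := by
  have hz : HasDerivAt (fun z : ℝ => (z : ℂ)) 1 z := (hasDerivAt_id z).ofReal_comp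
  refine ((hz.pow k).mul (hz.const_mul lam).cexp).congr_deriv ?_
  simp only [cexpMonomial, Pi.pow_apply]
  ring

variable (L) in
/-- The function `z^k e^{λz}` on `L`. -/
def smoothCexp (lam : ℂ) (k : ℕ) : complexify (smoothFun L) :=
  ⟨L.indicator (cexpMonomial lam k), indicator_mem_complexify.2
    ⟨indicator_mem_smoothFun (Complex.reCLM.contDiff.comp (contDiff_cexpMonomial lam k)).contDiffOn,
      indicator_mem_smoothFun
        (Complex.imCLM.contDiff.comp (contDiff_cexpMonomial lam k)).contDiffOn⟩⟩

theorem derC_smoothCexp (hL : IsOpen L) (lam : ℂ) (k : ℕ) :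
    derC hL (smoothCexp L lam k)
      = (k : ℂ) • smoothCexp L lam (k - 1) + lam • smoothCexp L lam k := by
  refine Subtype.ext (dzC_eq hL (smoothCexp L lam k).2 (fun z hz => ?_)
    fun _ hz => zero_of_mem_complexify (Subtype.property _) hz)
  refine (hasDerivAt_indicator hL hz (hasDerivAt_cexpMonomial lam k z)).congr_deriv ?_
  simp [smoothCexp, hz]

theorem mulC_pow_smoothCexp (L : Set ℝ) (lam : ℂ) (j : ℕ) :
    (mulC L ^ j) (smoothCexp L lam 0) = smoothCexp L lam j := by
  induction j with
  | zero => rfl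
  | succ j ih =>
    rw [pow_succ', Module.End.mul_apply, ih]
    refine Subtype.ext (funext fun z => ?_)
    change (z : ℂ) * L.indicator (cexpMonomial lam j) z = L.indicator (cexpMonomial lam (j + 1)) z
    by_cases hz : z ∈ L
    · simp only [Set.indicator_of_mem hz, cexpMonomial]
      ring
    · simp [hz]

theorem smoothCexp_zero_ne_zero (hn : L.Nonempty) (lam : ℂ) : smoothCexp L lam 0 ≠ 0 := by
  obtain ⟨z, hz⟩ := hn
  intro h
  have := congrFun (congrArg Subtype.val h) z
  simp [smoothCexp, hz, cexpMonomial] at this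

theorem smoothCexp_mem_expModule {Λ : Finset ℂ} {m : ℂ → ℕ} {lam : ℂ} (hlam : lam ∈ Λ) {k : ℕ}
    (hk : k ≤ m lam) : (smoothCexp L lam k : ℝ → ℂ) ∈ complexify (expModule L Λ m) :=
  indicator_mem_complexify.2
    ⟨Submodule.subset_span ⟨_, ⟨lam, hlam, k, hk, Or.inl rfl⟩, rfl⟩,
      Submodule.subset_span ⟨_, ⟨lam, hlam, k, hk, Or.inr rfl⟩, rfl⟩⟩

theorem expModule_le {Λ : Finset ℂ} {m : ℂ → ℕ} {G : Submodule ℝ (ℝ → ℝ)}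
    (h : ∀ lam ∈ Λ, ∀ k ≤ m lam, (smoothCexp L lam k : ℝ → ℂ) ∈ complexify G) :
    expModule L Λ m ≤ G := by
  rw [expModule, Submodule.span_le]
  rintro _ ⟨_, ⟨lam, hlam, k, hk, rfl | rfl⟩, rfl⟩
  · exact (indicator_mem_complexify.1 (h lam hlam k hk)).1
  · exact (indicator_mem_complexify.1 (h lam hlam k hk)).2

theorem expModule_le_smoothFun (L : Set ℝ) (Λ : Finset ℂ) (m : ℂ → ℕ) :
    expModule L Λ m ≤ smoothFun L :=
  expModule_le fun lam _ k _ => (smoothCexp L lam k).2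

theorem finiteDimensional_expModule (L : Set ℝ) (Λ : Finset ℂ) (m : ℂ → ℕ) :
    FiniteDimensional ℝ (expModule L Λ m) := by
  let part (re : ℂ → ℝ) (p : ℂ × ℕ) : ℝ → ℝ := L.indicator fun z => re (cexpMonomial p.1 p.2 z)
  let exponents : Set (ℂ × ℕ) := ⋃ lam ∈ Λ, {lam} ×ˢ Set.Iic (m lam)
  have hfin : exponents.Finite := Set.Finite.biUnion Λ.finite_toSet fun lam _ =>
    (Set.finite_singleton lam).prod (Set.finite_Iic _)
  refine FiniteDimensional.span_of_finite ℝ (((hfin.image (part Complex.re)).union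
    (hfin.image (part Complex.im))).subset ?_)
  rintro _ ⟨_, ⟨lam, hlam, k, hk, rfl | rfl⟩, rfl⟩
  · exact Or.inl ⟨(lam, k), Set.mem_biUnion hlam ⟨rfl, hk⟩, rfl⟩
  · exact Or.inr ⟨(lam, k), Set.mem_biUnion hlam ⟨rfl, hk⟩, rfl⟩

theorem vert_mem_of_span (hL : IsOpen L) {S : Set (ℝ → ℝ)} {H : Submodule ℝ (ℝ → ℝ)}
    (hS : Submodule.span ℝ S ≤ smoothFun L) {A B C : ℝ → ℝ} {t : ℝ}
    (h : ∀ g ∈ S, A * dz L g + t • (B * g) + C * g ∈ H) :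
    ∀ g ∈ Submodule.span ℝ S, A * dz L g + t • (B * g) + C * g ∈ H := by
  intro g hg
  induction hg using Submodule.span_induction with
  | mem g hg => exact h g hg
  | zero => simp [dz_zero]
  | add f g hf hg ihf ihg =>
    rw [dz_add hL (hS hf) (hS hg)]
    convert H.add_mem ihf ihg using 1
    simp only [mul_add, smul_add]
    abel
  | smul c f hf ih =>
    rw [dz_smul hL c (hS hf)]
    convert H.smul_mem c ih using 1
    simp only [mul_smul_comm, smul_add, smul_comm t c]

theorem dz_mem_of_span (hL : IsOpen L) {S : Set (ℝ → ℝ)} {H : Submodule ℝ (ℝ → ℝ)}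
    (hS : Submodule.span ℝ S ≤ smoothFun L) (h : ∀ g ∈ S, dz L g ∈ H) :
    ∀ g ∈ Submodule.span ℝ S, dz L g ∈ H := by
  simpa using vert_mem_of_span hL hS (A := 1) (B := 0) (C := 0) (t := 0) (H := H) (by simpa using h)

theorem dz_mem_expModule (hL : IsOpen L) (Λ : Finset ℂ) (m : ℂ → ℕ) :
    ∀ g ∈ expModule L Λ m, dz L g ∈ expModule L Λ m := by
  refine dz_mem_of_span hL (expModule_le_smoothFun L Λ m) ?_
  have hder (lam) (hlam : lam ∈ Λ) (k) (hk : k ≤ m lam) :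
      dzC L (smoothCexp L lam k) ∈ complexify (expModule L Λ m) := by
    have h := congrArg Subtype.val (derC_smoothCexp hL lam k)
    rw [show dzC L (smoothCexp L lam k) = _ from h]
    exact Submodule.add_mem _
      (Submodule.smul_mem _ _ (smoothCexp_mem_expModule hlam ((Nat.sub_le k 1).trans hk)))
      (Submodule.smul_mem _ _ (smoothCexp_mem_expModule hlam hk))
  rintro _ ⟨_, ⟨lam, hlam, k, hk, rfl | rfl⟩, rfl⟩
  · convert (hder lam hlam k hk).1 using 1
    exact congrArg (dz L) (Set.indicator_comp_of_zero Complex.zero_re)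
  · convert (hder lam hlam k hk).2 using 1
    exact congrArg (dz L) (Set.indicator_comp_of_zero Complex.zero_im)

theorem exists_eq_smul_smoothCexp_zero (hL : IsOpen L) (hc : L.OrdConnected) {lam : ℂ}
    {f : complexify (smoothFun L)} (hf : (derC hL - lam • 1) f = 0) :
    ∃ c : ℂ, f = c • smoothCexp L lam 0 := by
  rcases L.eq_empty_or_nonempty with rfl | ⟨z₀, hz₀⟩
  · refine ⟨0, Subtype.ext (funext fun z => ?_)⟩
    rw [zero_of_mem_complexify f.2 (Set.notMem_empty z), zero_smul]
    rfl
  have hode : ∀ z ∈ L, HasDerivAt (f : ℝ → ℂ) (lam * (f : ℝ → ℂ) z) z := fun z hz => by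
    have h : derC hL f = lam • f := sub_eq_zero.1 hf
    exact (hasDerivAt_dzC hL f.2 hz).congr_deriv (congrFun (congrArg Subtype.val h) z)
  have hzero : ∀ z ∈ L,
      HasDerivAt (fun z : ℝ => Complex.exp (-lam * z) * (f : ℝ → ℂ) z) 0 z := fun z hz => by
    refine (((hasDerivAt_id z).ofReal_comp.const_mul (-lam)).cexp.mul (hode z hz)).congr_deriv ?_
    simp only [id, Complex.ofReal_one]
    ring
  refine ⟨Complex.exp (-lam * z₀) * (f : ℝ → ℂ) z₀, Subtype.ext (funext fun z => ?_)⟩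
  by_cases hz : z ∈ L
  · have hconst := hL.is_const_of_deriv_eq_zero hc.isPreconnected
      (fun a ha => (hzero a ha).differentiableAt.differentiableWithinAt)
      (fun a ha => (hzero a ha).deriv) hz hz₀
    simp only [smoothCexp, Submodule.coe_smul, Pi.smul_apply, Set.indicator_of_mem hz, smul_eq_mul,
      cexpMonomial, pow_zero, one_mul]
    rw [← hconst, mul_right_comm, ← Complex.exp_add]
    simp
  · rw [zero_of_mem_complexify f.2 hz]
    simp [smoothCexp, hz]

theorem exists_inf_maxGenEigenspace_eq_span (hL : IsOpen L) (hc : L.OrdConnected)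
    {W : Submodule ℂ (complexify (smoothFun L))} [FiniteDimensional ℂ W]
    (hW : ∀ w ∈ W, derC hL w ∈ W) (lam : ℂ) :
    ∃ m : ℕ, W ⊓ (derC hL).maxGenEigenspace lam
      = Submodule.span ℂ {v | ∃ j < m, v = smoothCexp L lam j} := by
  let D := derC hL - lam • 1
  have hker (v : complexify (smoothFun L)) (hv : D v = 0) :=
    exists_eq_smul_smoothCexp_zero hL hc hv
  have hstable : ∀ w ∈ W ⊓ (derC hL).maxGenEigenspace lam,
      D w ∈ W ⊓ (derC hL).maxGenEigenspace lam := fun w hw =>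
    have hDw : derC hL w ∈ W ⊓ (derC hL).maxGenEigenspace lam :=
      ⟨hW w hw.1, Module.End.mapsTo_maxGenEigenspace_of_comm (Commute.refl _) lam hw.2⟩
    sub_mem hDw (Submodule.smul_mem _ lam hw)
  obtain ⟨k, hk⟩ := exists_inf_maxGenEigenspace_le_ker_pow hW lam
  obtain ⟨m, hm⟩ := exists_eq_ker_pow hker hstable hk
  have hexp : D (smoothCexp L lam 0) = 0 := by
    simp [D, derC_smoothCexp]
  refine ⟨m, ?_⟩
  rw [hm, weyl_ker_pow_eq_span (derC_sub_mulC hL lam) hexp hker]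
  simp only [mulC_pow_smoothCexp]

theorem exists_eq_expModule (hL : IsOpen L) (hc : L.OrdConnected) (hn : L.Nonempty)
    {G : Submodule ℝ (ℝ → ℝ)} (hG : G ≤ smoothFun L) [FiniteDimensional ℝ G]
    (h : ∀ g ∈ G, dz L g ∈ G) : ∃ (Λ : Finset ℂ) (m : ℂ → ℕ), G = expModule L Λ m := by
  let W := (complexify G).comap (complexify (smoothFun L)).subtype
  have := finiteDimensional_complexify G
  have := finiteDimensional_comap_subtype (complexify (smoothFun L)) (complexify G)
  have hWD : ∀ w ∈ W, derC hL w ∈ W := fun w hw => ⟨h _ hw.1, h _ hw.2⟩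
  choose m hm using exists_inf_maxGenEigenspace_eq_span hL hc hWD
  have hfin : {lam | m lam ≠ 0}.Finite := by
    refine (finite_inf_maxGenEigenspace_ne_bot hWD).subset fun lam hlam hbot => ?_
    have hmem : smoothCexp L lam 0 ∈ W ⊓ (derC hL).maxGenEigenspace lam :=
      hm lam ▸ Submodule.subset_span ⟨0, Nat.pos_of_ne_zero hlam, rfl⟩
    rw [hbot] at hmem
    exact smoothCexp_zero_ne_zero hn lam hmem
  refine ⟨hfin.toFinset, fun lam => m lam - 1, le_antisymm (fun g hg => ?_) (expModule_le ?_)⟩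
  · have hle : W ≤ (complexify (expModule L hfin.toFinset fun lam => m lam - 1)).comap
        (complexify (smoothFun L)).subtype := by
      rw [← iSup_inf_maxGenEigenspace hWD]
      refine iSup_le fun lam => ?_
      rw [hm, Submodule.span_le]
      rintro _ ⟨j, hj, rfl⟩
      exact smoothCexp_mem_expModule (hfin.mem_toFinset.2 (Nat.ne_zero_of_lt hj))
        (Nat.le_sub_one_of_lt hj)
    exact (hle (x := ⟨_, ofReal_mem_complexify (hG hg)⟩) (ofReal_mem_complexify hg)).1
  · intro lam hlam k hk
    have hmem : smoothCexp L lam k ∈ W ⊓ (derC hL).maxGenEigenspace lam :=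
      hm lam ▸ Submodule.subset_span
        ⟨k, Nat.lt_of_le_sub_one (Nat.pos_of_ne_zero (hfin.mem_toFinset.1 hlam)) hk, rfl⟩
    exact hmem.1

end Exponentials

/-! ### Polynomial modules and their components -/

theorem smul_add_mul_eq_smul {L : Set ℝ} {C g : ℝ → ℝ} {c : ℝ} (hC : ∀ z ∈ L, C z = c)
    (hg : g ∈ smoothFun L) (a : ℝ) : a • g + C * g = (a + c) • g := by
  ext z
  by_cases hz : z ∈ L
  · simp [hC z hz, add_mul]
  · simp [hg.2 z hz]

theorem polyModule_congr {U : Set Space} {n : ℕ} {G G' : ℕ → Submodule ℝ (ℝ → ℝ)}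
    (h : ∀ l ≤ n, G l = G' l) : polyModule U n G = polyModule U n G' := by
  refine congrArg (Submodule.span ℝ) (Set.ext fun f => ?_)
  exact exists₂_congr fun i j => and_congr_right fun hij => by rw [h _ hij]

theorem polyModule_bot (U : Set Space) (n : ℕ) : polyModule U n (fun _ => ⊥) = ⊥ := by
  rw [polyModule, Submodule.span_eq_bot]
  rintro _ ⟨i, j, -, g, rfl, rfl⟩
  exact map_zero (mono U i j)

theorem mono_mem_polyModule {U : Set Space} {n i j : ℕ} {G : ℕ → Submodule ℝ (ℝ → ℝ)}
    (hij : i + j ≤ n) {g : ℝ → ℝ} (hg : g ∈ G (i + j)) : mono U i j g ∈ polyModule U n G :=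
  Submodule.subset_span ⟨i, j, hij, g, hg, rfl⟩

/-- The exponents `(i, j)` with `i + j ≤ n`. -/
def exponents (n : ℕ) : Finset (ℕ × ℕ) :=
  {p ∈ Finset.range (n + 1) ×ˢ Finset.range (n + 1) | p.1 + p.2 ≤ n}

theorem mem_exponents {n : ℕ} {p : ℕ × ℕ} : p ∈ exponents n ↔ p.1 + p.2 ≤ n := by
  simp only [exponents, Finset.mem_filter, Finset.mem_product, Finset.mem_range]
  omega

theorem polyModule_eq_iSup (U : Set Space) (n : ℕ) (G : ℕ → Submodule ℝ (ℝ → ℝ)) :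
    polyModule U n G = ⨆ p ∈ exponents n, (G (p.1 + p.2)).map (mono U p.1 p.2) := by
  apply le_antisymm
  · rw [polyModule, Submodule.span_le]
    rintro _ ⟨i, j, hij, g, hg, rfl⟩
    exact Submodule.mem_iSup_of_mem (i, j)
      (Submodule.mem_iSup_of_mem (mem_exponents.2 hij) ⟨g, hg, rfl⟩)
  · refine iSup₂_le fun p hp => ?_
    rintro _ ⟨g, hg, rfl⟩
    exact mono_mem_polyModule (mem_exponents.1 hp) hg

theorem finiteDimensional_polyModule {L : Set ℝ} (U : Set Space) {n : ℕ}
    {G : ℕ → Submodule ℝ (ℝ → ℝ)} (hG : FiniteFamily L n G) :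
    FiniteDimensional ℝ (polyModule U n G) := by
  rw [polyModule_eq_iSup, iSup_subtype']
  have (p : exponents n) : FiniteDimensional ℝ ((G (p.1.1 + p.1.2)).map (mono U p.1.1 p.1.2)) := by
    have := (hG _ (mem_exponents.1 p.2)).2
    infer_instance
  exact Submodule.finiteDimensional_iSup _

theorem exists_eq_sum_of_mem_polyModule {L : Set ℝ} {U : Set Space} {n : ℕ}
    {G : ℕ → Submodule ℝ (ℝ → ℝ)} (hG : FiniteFamily L n G) {f : Space → ℝ}
    (hf : f ∈ polyModule U n G) : ∃ g : ℕ × ℕ → smoothFun L, (∀ p, (g p : ℝ → ℝ) ∈ G (p.1 + p.2)) ∧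
      f = ∑ p ∈ exponents n, mono U p.1 p.2 (g p) := by
  rw [polyModule_congr (G' := fun l => G l ⊓ smoothFun L)
    fun l hl => (inf_eq_left.2 (hG l hl).1).symm, polyModule_eq_iSup,
    Submodule.mem_iSup_finset_iff_exists_sum] at hf
  obtain ⟨u, rfl⟩ := hf
  choose g hg hgu using fun p => (u p).2
  exact ⟨fun p => ⟨g p, (hg p).2⟩, fun p => (hg p).1, Finset.sum_congr rfl fun p _ => (hgu p).symm⟩

section Modules

variable {I J L : Set ℝ}

theorem polyModule_le_smoothFun {n : ℕ} {G : ℕ → Submodule ℝ (ℝ → ℝ)}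
    (hG : FiniteFamily L n G) : polyModule (box I J L) n G ≤ smoothFun (box I J L) := by
  rw [polyModule, Submodule.span_le]
  rintro _ ⟨i, j, hij, g, hg, rfl⟩
  exact mono_mem_smoothFun i j ((hG _ hij).1 hg)

/-- The operator `T` maps the functions `x^i y^j g(z)` that span `polyModule (box I J L) n G` into
this module. -/
def Preserves (I J L : Set ℝ) (n : ℕ) (G : ℕ → Submodule ℝ (ℝ → ℝ)) (T : DiffOp) : Prop :=
  ∀ i j, i + j ≤ n → ∀ g ∈ G (i + j),
    act (box I J L) T (mono (box I J L) i j g) ∈ polyModule (box I J L) n G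

variable (hB : IsOpenBox I J L)
include hB

theorem isFixedModule_polyModule {𝒯 : Set DiffOp} {n : ℕ} {G : ℕ → Submodule ℝ (ℝ → ℝ)}
    (hG : FiniteFamily L n G) (h : ∀ T ∈ 𝒯, Preserves I J L n G T) :
    IsFixedModule (box I J L) (Submodule.span ℝ 𝒯) (polyModule (box I J L) n G) where
  smooth := polyModule_le_smoothFun hG
  finite := finiteDimensional_polyModule _ hG
  stable := by
    refine act_mem_of_generators hB.isOpen ?_ ?_
    · rintro _ ⟨i, j, hij, g, hg, rfl⟩
      exact mono_mem_smoothFun i j ((hG _ hij).1 hg)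
    · rintro T hT _ ⟨i, j, hij, g, hg, rfl⟩
      exact h T hT i j hij g hg

section Preserves

variable {n : ℕ} {G : ℕ → Submodule ℝ (ℝ → ℝ)} (hG : FiniteFamily L n G)
include hG

theorem preserves_xq : Preserves I J L n G (cx • vq, 0) := by
  intro i j hij g hg
  rw [act_xq_mono hB.isOpen hB.oL ((hG _ hij).1 hg)]
  rcases j with _ | j
  · simp
  · exact Submodule.smul_mem _ _ (mono_mem_polyModule (by omega)
      (by rwa [show i + 1 + (j + 1 - 1) = i + (j + 1) by omega]))

theorem preserves_yp : Preserves I J L n G (cy • vp, 0) := by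
  intro i j hij g hg
  rw [act_yp_mono hB.isOpen hB.oL ((hG _ hij).1 hg)]
  rcases i with _ | i
  · simp
  · exact Submodule.smul_mem _ _ (mono_mem_polyModule (by omega)
      (by rwa [show i + 1 - 1 + (j + 1) = i + 1 + j by omega]))

theorem preserves_xp_sub_yq : Preserves I J L n G (cx • vp - cy • vq, 0) := by
  intro i j hij g hg
  rw [act_xp_sub_yq_mono hB.isOpen hB.oL ((hG _ hij).1 hg)]
  exact Submodule.smul_mem _ _ (mono_mem_polyModule hij hg)

theorem preserves_sl2 : ∀ T ∈ sl2, Preserves I J L n G T := by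
  rintro T (rfl | rfl | rfl)
  · exact preserves_xq hB hG
  · exact preserves_xp_sub_yq hB hG
  · exact preserves_yp hB hG

theorem preserves_xp_add {C : ℝ → ℝ} (h : ∀ l ≤ n, ∀ g ∈ G l, C * g ∈ G l) :
    Preserves I J L n G (cx • vp, ofZ C) := by
  intro i j hij g hg
  rw [act_xp_add_mono hB.isOpen hB.oL ((hG _ hij).1 hg)]
  exact mono_mem_polyModule hij ((G _).add_mem ((G _).smul_mem _ hg) (h _ hij g hg))

theorem preserves_yq_add {C : ℝ → ℝ} (h : ∀ l ≤ n, ∀ g ∈ G l, C * g ∈ G l) :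
    Preserves I J L n G (cy • vq, ofZ C) := by
  intro i j hij g hg
  rw [act_yq_add_mono hB.isOpen hB.oL ((hG _ hij).1 hg)]
  exact mono_mem_polyModule hij ((G _).add_mem ((G _).smul_mem _ hg) (h _ hij g hg))

theorem preserves_ofZ_smul_vp {ζ : ℝ → ℝ} (h : ∀ l < n, ∀ g ∈ G (l + 1), ζ * g ∈ G l) :
    Preserves I J L n G (ofZ ζ • vp, 0) := by
  intro i j hij g hg
  rw [act_ofZ_smul_vp_mono hB.isOpen hB.oL ((hG _ hij).1 hg)]
  rcases i with _ | i
  · simp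
  · refine Submodule.smul_mem _ _ (mono_mem_polyModule (by omega) (h _ (by omega) g ?_))
    rwa [show i + 1 - 1 + j + 1 = i + 1 + j by omega]

theorem preserves_ofZ_smul_vq {ζ : ℝ → ℝ} (h : ∀ l < n, ∀ g ∈ G (l + 1), ζ * g ∈ G l) :
    Preserves I J L n G (ofZ ζ • vq, 0) := by
  intro i j hij g hg
  rw [act_ofZ_smul_vq_mono hB.isOpen hB.oL ((hG _ hij).1 hg)]
  rcases j with _ | j
  · simp
  · refine Submodule.smul_mem _ _ (mono_mem_polyModule (by omega) (h _ (by omega) g ?_))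
    rwa [show i + (j + 1 - 1) + 1 = i + (j + 1) by omega]

theorem preserves_vp (h : ∀ l < n, G (l + 1) ≤ G l) : Preserves I J L n G (vp, 0) := by
  rw [vp_eq_ofZ_smul]
  exact preserves_ofZ_smul_vp hB hG fun l hl g hg => by simpa using h l hl hg

theorem preserves_vq (h : ∀ l < n, G (l + 1) ≤ G l) : Preserves I J L n G (vq, 0) := by
  rw [vq_eq_ofZ_smul]
  exact preserves_ofZ_smul_vq hB hG fun l hl g hg => by simpa using h l hl hg

theorem preserves_translations {S : Set (ℝ → ℝ)} (h : Lowers S n G) :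
    ∀ T ∈ translations S, Preserves I J L n G T := by
  rintro T ⟨ζ, hζ, rfl | rfl⟩
  · exact preserves_ofZ_smul_vp hB hG (h ζ hζ)
  · exact preserves_ofZ_smul_vq hB hG (h ζ hζ)

theorem preserves_vert {A B C : ℝ → ℝ}
    (h : ∀ l ≤ n, ∀ g ∈ G l, A * dz L g + (l : ℝ) • (B * g) + C * g ∈ G l) :
    Preserves I J L n G (vert A B C) := by
  intro i j hij g hg
  rw [act_vert_mono hB.isOpen hB.oL ((hG _ hij).1 hg)]
  exact mono_mem_polyModule hij (h _ hij g hg)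

omit hB in
theorem preserves_one : Preserves I J L n G one := by
  intro i j hij g hg
  rw [act_one (mono_mem_smoothFun i j ((hG _ hij).1 hg))]
  exact mono_mem_polyModule hij hg

theorem preserves_vr (h : ∀ l ≤ n, ∀ g ∈ G l, dz L g ∈ G l) : Preserves I J L n G (vr, 0) := by
  rw [vr_eq_vert]
  exact preserves_vert hB hG fun l hl g hg => by simpa using h l hl g hg

theorem preserves_euler : Preserves I J L n G (euler, 0) := by
  rw [euler_zero_eq_vert]
  exact preserves_vert hB hG fun d _ g hg => by simpa using (G d).smul_mem (d : ℝ) hg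

theorem preserves_raiseX {C : ℝ → ℝ} (hC : ∀ z ∈ L, C z = -(n : ℝ))
    (h : ∀ l < n, G l ≤ G (l + 1)) : Preserves I J L n G (raiseX C) := by
  intro i j hij g hg
  have hgs := (hG _ hij).1 hg
  rw [act_raiseX_mono hB.isOpen hB.oL hgs, smul_add_mul_eq_smul hC hgs, map_smul]
  rcases hij.eq_or_lt with rfl | hlt
  · simp
  · refine Submodule.smul_mem _ _ (mono_mem_polyModule (by omega) ?_)
    rw [add_right_comm]
    exact h _ hlt hg

theorem preserves_raiseY {C : ℝ → ℝ} (hC : ∀ z ∈ L, C z = -(n : ℝ))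
    (h : ∀ l < n, G l ≤ G (l + 1)) : Preserves I J L n G (raiseY C) := by
  intro i j hij g hg
  have hgs := (hG _ hij).1 hg
  rw [act_raiseY_mono hB.isOpen hB.oL hgs, smul_add_mul_eq_smul hC hgs, map_smul]
  rcases hij.eq_or_lt with rfl | hlt
  · simp
  · exact Submodule.smul_mem _ _ (mono_mem_polyModule (by omega) (h _ hlt hg))

theorem preserves_sl3 (h : ∀ l ≤ n, G l = G 0) : ∀ T ∈ sl3 (-(n : ℝ)), Preserves I J L n G T := by
  have hstep : ∀ l < n, G l = G (l + 1) := fun l hl => (h l hl.le).trans (h (l + 1) hl).symm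
  have hzero : ∀ l ≤ n, ∀ g ∈ G l, (0 : ℝ → ℝ) * g ∈ G l := fun l _ g _ => by simp
  rintro T (rfl | rfl | rfl | rfl | rfl | rfl | rfl | rfl)
  · exact preserves_vp hB hG fun l hl => (hstep l hl).ge
  · exact preserves_vq hB hG fun l hl => (hstep l hl).ge
  · exact preserves_xp_add hB hG hzero
  · exact preserves_yq_add hB hG hzero
  · exact preserves_xq hB hG
  · exact preserves_yp hB hG
  · rw [raiseX_const]
    exact preserves_raiseX hB hG (fun _ _ => rfl) fun l hl => (hstep l hl).le
  · rw [raiseY_const]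
    exact preserves_raiseY hB hG (fun _ _ => rfl) fun l hl => (hstep l hl).le

theorem isFixedModule_polyModule_of_lowers {S : Set (ℝ → ℝ)} (hS : Lowers S n G) {R : Set DiffOp}
    (h : ∀ T ∈ R, Preserves I J L n G T) :
    IsFixedModule (box I J L) (Submodule.span ℝ (sl2 ∪ translations S ∪ R))
      (polyModule (box I J L) n G) := by
  refine isFixedModule_polyModule hB hG ?_
  rintro T ((hT | hT) | hT)
  · exact preserves_sl2 hB hG T hT
  · exact preserves_translations hB hG hS T hT
  · exact h T hT

theorem comp_polyModule {l : ℕ} (hl : l ≤ n) :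
    comp I J L (polyModule (box I J L) n G) l = G l := by
  apply le_antisymm
  · intro g hg
    obtain ⟨hgs, hg⟩ := mem_comp.1 hg
    obtain ⟨u, hu, hgu⟩ := exists_eq_sum_of_mem_polyModule hG (hg l 0 (add_zero l))
    have hmem : (l, 0) ∈ exponents n := mem_exponents.2 hl
    set v : ℕ × ℕ → smoothFun L := Pi.single (l, 0) ⟨g, hgs⟩ with hv
    have hvsum : ∑ p ∈ exponents n, mono (box I J L) p.1 p.2 (v p) = mono (box I J L) l 0 g := by
      rw [Finset.sum_eq_single_of_mem _ hmem fun p _ hp => by simp [hv, hp], hv, Pi.single_eq_same]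
    have hsum : ∑ p ∈ exponents n, mono (box I J L) p.1 p.2 ((u - v) p : smoothFun L) = 0 := by
      simp only [Pi.sub_apply, Submodule.coe_sub, map_sub, Finset.sum_sub_distrib, ← hgu, hvsum,
        sub_self]
    have huv := mono_injective hB ((u - v) (l, 0)).2
      (mono_mem_of_sum_mem hB isFixedModule_bot (hsum ▸ zero_mem _) _ hmem)
    rw [Pi.sub_apply, hv, Pi.single_eq_same, Submodule.coe_sub, sub_eq_zero] at huv
    change (u (l, 0) : ℝ → ℝ) = g at huv
    exact huv ▸ hu (l, 0)
  · exact fun g hg =>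
      mem_comp.2 ⟨(hG l hl).1 hg, fun i j hij => mono_mem_polyModule (hij ▸ hl) (hij ▸ hg)⟩

end Preserves

section Components

variable {N : Submodule ℝ (Space → ℝ)}
  (hN : IsFixedModule (box I J L) (Submodule.span ℝ sl2) N)
include hN

theorem vert_mem_comp {A B C : ℝ → ℝ} (hA : ContDiffOn ℝ ∞ A L) (hB' : ContDiffOn ℝ ∞ B L)
    (hC : ContDiffOn ℝ ∞ C L) (h : ∀ f ∈ N, act (box I J L) (vert A B C) f ∈ N) (l : ℕ) :
    ∀ g ∈ comp I J L N l, A * dz L g + (l : ℝ) • (B * g) + C * g ∈ comp I J L N l := by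
  intro g hg
  obtain ⟨hgs, hg⟩ := mem_comp.1 hg
  have hmem := h _ (hg l 0 (add_zero l))
  rw [act_vert_mono hB.isOpen hB.oL hgs, add_zero] at hmem
  have hs : A * dz L g + (l : ℝ) • (B * g) + C * g ∈ smoothFun L :=
    add_mem (add_mem (mul_mem_smoothFun hA (dz_mem_smoothFun hB.oL hgs))
      (Submodule.smul_mem _ _ (mul_mem_smoothFun hB' hgs))) (mul_mem_smoothFun hC hgs)
  exact mem_comp_of_mono_mem hB hN (add_zero l) hs hmem

theorem dz_mem_comp (h : ∀ f ∈ N, act (box I J L) (vr, 0) f ∈ N) (l : ℕ) :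
    ∀ g ∈ comp I J L N l, dz L g ∈ comp I J L N l := by
  intro g hg
  have := vert_mem_comp hB hN (A := 1) (B := 0) (C := 0) contDiffOn_const contDiffOn_const
    contDiffOn_const (by rwa [← vr_eq_vert]) l g hg
  simpa using this

theorem mul_mem_comp_of_euler {C : ℝ → ℝ} (hC : ContDiffOn ℝ ∞ C L)
    (h : ∀ f ∈ N, act (box I J L) (vert 0 1 C) f ∈ N) (l : ℕ) :
    ∀ g ∈ comp I J L N l, C * g ∈ comp I J L N l := by
  intro g hg
  have hmem := vert_mem_comp hB hN (A := 0) (B := 1) contDiffOn_const contDiffOn_const hC h l g hg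
  rwa [zero_mul, zero_add, one_mul,
    Submodule.add_mem_iff_right _ (Submodule.smul_mem _ _ hg)] at hmem

theorem mul_mem_comp_of_vp {ζ : ℝ → ℝ} (hζ : ContDiffOn ℝ ∞ ζ L)
    (h : ∀ f ∈ N, act (box I J L) (ofZ ζ • vp, 0) f ∈ N) (l : ℕ) :
    ∀ g ∈ comp I J L N (l + 1), ζ * g ∈ comp I J L N l := by
  intro g hg
  obtain ⟨hgs, hg⟩ := mem_comp.1 hg
  have hmem := h _ (hg (l + 1) 0 (add_zero _))
  rw [act_ofZ_smul_vp_mono hB.isOpen hB.oL hgs, N.smul_mem_iff (by positivity)] at hmem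
  exact mem_comp_of_mono_mem hB hN (add_zero l) (mul_mem_smoothFun hζ hgs) hmem

theorem comp_succ_le (h : ∀ f ∈ N, act (box I J L) (vp, 0) f ∈ N) (l : ℕ) :
    comp I J L N (l + 1) ≤ comp I J L N l := by
  intro g hg
  have := mul_mem_comp_of_vp hB hN (ζ := 1) contDiffOn_const (by rwa [← vp_eq_ofZ_smul]) l g hg
  rwa [one_mul] at this

theorem raise_mem_comp {C : ℝ → ℝ} (hC : ContDiffOn ℝ ∞ C L)
    (h : ∀ f ∈ N, act (box I J L) (raiseX C) f ∈ N) (l : ℕ) :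
    ∀ g ∈ comp I J L N l, (l : ℝ) • g + C * g ∈ comp I J L N (l + 1) := by
  intro g hg
  obtain ⟨hgs, hg⟩ := mem_comp.1 hg
  have hmem := h _ (hg l 0 (add_zero l))
  rw [act_raiseX_mono hB.isOpen hB.oL hgs, add_zero] at hmem
  exact mem_comp_of_mono_mem hB hN (add_zero _)
    (add_mem (Submodule.smul_mem _ _ hgs) (mul_mem_smoothFun hC hgs)) hmem

theorem add_smul_mem_comp {c : ℝ} {C : ℝ → ℝ} (hc : ∀ z ∈ L, C z = c)
    (h : ∀ f ∈ N, act (box I J L) (raiseX C) f ∈ N) (l : ℕ) :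
    ∀ g ∈ comp I J L N l, ((l : ℝ) + c) • g ∈ comp I J L N (l + 1) := by
  intro g hg
  rw [← smul_add_mul_eq_smul hc (comp_le_smoothFun hg)]
  exact raise_mem_comp hB hN (contDiffOn_const.congr hc) h l g hg

theorem exists_eq_neg_natCast (h0 : N ≠ ⊥) {c : ℝ} {C : ℝ → ℝ} (hc : ∀ z ∈ L, C z = c)
    (h : ∀ f ∈ N, act (box I J L) (raiseX C) f ∈ N) : ∃ n : ℕ, c = -(n : ℝ) := by
  obtain ⟨n, hn, htop⟩ := exists_top hB hN h0
  obtain ⟨g, hg, hg0⟩ := Submodule.exists_mem_ne_zero_of_ne_bot hn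
  have hraise := add_smul_mem_comp hB hN hc h n g hg
  rw [htop _ n.lt_succ_self, Submodule.mem_bot] at hraise
  exact ⟨n, by linarith [(smul_eq_zero.1 hraise).resolve_right hg0]⟩

section Raise

variable {n : ℕ} {C : ℝ → ℝ} (hc : ∀ z ∈ L, C z = -(n : ℝ))
  (h : ∀ f ∈ N, act (box I J L) (raiseX C) f ∈ N)
include hc h

theorem comp_le_succ {l : ℕ} (hl : l ≠ n) : comp I J L N l ≤ comp I J L N (l + 1) := by
  intro g hg
  have hraise := add_smul_mem_comp hB hN hc h l g hg
  rwa [← sub_eq_add_neg,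
    Submodule.smul_mem_iff _ (sub_ne_zero.2 (Nat.cast_injective.ne hl))] at hraise

theorem comp_eq_bot_of_lt {l : ℕ} (hl : n < l) : comp I J L N l = ⊥ := by
  obtain ⟨k, hk⟩ := comp_eq_bot_of_le hB hN
  have hle : comp I J L N l ≤ comp I J L N (l + k) :=
    Nat.le_induction le_rfl (fun m hm ih => ih.trans (comp_le_succ hB hN hc h (by omega)))
      _ (Nat.le_add_right l k)
  exact le_bot_iff.1 (hle.trans_eq (hk _ (Nat.le_add_left k l)))

theorem comp_eq_comp_zero (hp : ∀ f ∈ N, act (box I J L) (vp, 0) f ∈ N) {l : ℕ} (hl : l ≤ n) :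
    comp I J L N l = comp I J L N 0 := by
  induction l with
  | zero => rfl
  | succ l ih =>
    rw [← ih (by omega)]
    exact (comp_succ_le hB hN hp l).antisymm (comp_le_succ hB hN hc h (by omega))

end Raise

theorem mul_mem_of_comp {C : ℝ → ℝ} (h : ∀ l, ∀ g ∈ comp I J L N l, C * g ∈ comp I J L N l) :
    ∀ f ∈ N, ofZ C * f ∈ N := by
  obtain ⟨k, hk⟩ := comp_eq_bot_of_le hB hN
  rw [eq_polyModule_comp hB hN fun l hl => hk l hl.le]
  change polyModule (box I J L) k (comp I J L N)
    ≤ (polyModule (box I J L) k (comp I J L N)).comap (LinearMap.mulLeft ℝ (ofZ C))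
  refine Submodule.span_le.2 ?_
  rintro _ ⟨i, j, hij, g, hg, rfl⟩
  have hmul : ofZ C * mono (box I J L) i j g = mono (box I J L) i j (C * g) := by
    ext a
    by_cases ha : a ∈ box I J L
    · simp only [Pi.mul_apply, mono_apply ha, ofZ]
      ring
    · simp only [Pi.mul_apply, mono_of_notMem ha, mul_zero]
  change ofZ C * mono (box I J L) i j g ∈ polyModule (box I J L) k (comp I J L N)
  rw [hmul]
  exact mono_mem_polyModule hij (h _ g hg)

theorem exists_polynomial_eval_eq_zero (hlN : LocallyNontrivial (box I J L) N) {C : ℝ → ℝ}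
    (hC : ContDiffOn ℝ ∞ C L) (h : ∀ l, ∀ g ∈ comp I J L N l, C * g ∈ comp I J L N l) :
    ∃ P : Polynomial ℝ, P ≠ 0 ∧ ∀ z ∈ L, P.eval (C z) = 0 := by
  have := hN.finite
  obtain ⟨P, hP, hPN⟩ := exists_aeval_mul_eq_zero (mul_mem_of_comp hB hN h)
  refine ⟨P, hP, fun z hz => ?_⟩
  by_contra hne
  have hcont : ContinuousOn (fun a : Space => P.eval (ofZ C a)) (box I J L) :=
    P.continuous.comp_continuousOn
      (hC.continuousOn.comp contDiff_cz.continuous.continuousOn fun _ ha => ha.2.2)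
  obtain ⟨x, hx⟩ := hB.nI
  obtain ⟨y, hy⟩ := hB.nJ
  obtain ⟨f, hf, a, ha, hfa⟩ := hlN _ Set.inter_subset_left
    (hcont.isOpen_inter_preimage hB.isOpen isOpen_compl_singleton (t := {0}ᶜ))
    ⟨(x, y, z), ⟨hx, hy, hz⟩, hne⟩
  have hPf := congrFun (hPN f hf) a
  rw [Pi.mul_apply, Polynomial.aeval_pi_apply₂, Polynomial.coe_aeval_eq_eval] at hPf
  exact (mul_ne_zero ha.2 hfa) hPf

theorem const_of_locallyNontrivial (hlN : LocallyNontrivial (box I J L) N) {C : ℝ → ℝ}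
    (hC : ContDiffOn ℝ ∞ C L) (h : ∀ l, ∀ g ∈ comp I J L N l, C * g ∈ comp I J L N l) :
    ∃ κ : ℝ, ∀ z ∈ L, C z = κ := by
  obtain ⟨P, hP, hroot⟩ := exists_polynomial_eval_eq_zero hB hN hlN hC h
  have hfin : (C '' L).Finite := P.roots.toFinset.finite_toSet.subset (by
    rintro _ ⟨z, hz, rfl⟩
    simpa [hP] using hroot z hz)
  have hsub : (C '' L).Subsingleton := hfin.countable.isTotallyDisconnected _ subset_rfl
    (hB.cL.isPreconnected.image C hC.continuousOn)
  obtain ⟨z₀, hz₀⟩ := hB.nL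
  exact ⟨C z₀, fun z hz => hsub ⟨z, hz, rfl⟩ ⟨z₀, hz₀, rfl⟩⟩

end Components

end Modules

/-! ### Algebras with arbitrary or exponential coefficients -/

section Cases

variable {I J L : Set ℝ}

theorem span_sl2_le {𝔤 : Submodule ℝ DiffOp} {η : Space → ℝ} (hxq : (cx • vq, 0) ∈ 𝔤)
    (hyp : (cy • vp, 0) ∈ 𝔤) (hxp : (cx • vp, η) ∈ 𝔤) (hyq : (cy • vq, η) ∈ 𝔤) :
    Submodule.span ℝ sl2 ≤ 𝔤 := by
  rw [Submodule.span_le]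
  rintro T (rfl | rfl | rfl)
  · exact hxq
  · simpa using 𝔤.sub_mem hxp hyq
  · exact hyp

theorem span_sl2_le_span_sl3 (c : ℝ) (R : Set DiffOp) :
    Submodule.span ℝ sl2 ≤ Submodule.span ℝ (sl3 c ∪ R) := by
  apply span_sl2_le (η := 0) <;> exact Submodule.subset_span (Or.inl (by simp [sl3]))

theorem span_sl2_le_alg1 (K : ℝ → ℝ) : Submodule.span ℝ sl2 ≤ alg1 K := by
  apply span_sl2_le (η := ofZ K) <;> exact Submodule.subset_span (by simp)

theorem span_sl2_le_span (S : Set (ℝ → ℝ)) (R : Set DiffOp) :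
    Submodule.span ℝ sl2 ≤ Submodule.span ℝ (sl2 ∪ translations S ∪ R) :=
  Submodule.span_mono fun _ h => Or.inl (Or.inl h)

theorem LocallyNontrivial.ne_bot (hB : IsOpenBox I J L) {N : Submodule ℝ (Space → ℝ)}
    (hlN : LocallyNontrivial (box I J L) N) : N ≠ ⊥ := by
  rintro rfl
  obtain ⟨x, hx⟩ := hB.nI
  obtain ⟨y, hy⟩ := hB.nJ
  obtain ⟨z, hz⟩ := hB.nL
  obtain ⟨f, rfl, a, -, ha⟩ := hlN _ subset_rfl hB.isOpen ⟨(x, y, z), hx, hy, hz⟩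
  exact ha rfl

section Alg1

variable (hB : IsOpenBox I J L) {K : ℝ → ℝ} {N : Submodule ℝ (Space → ℝ)}
include hB

omit hB in
theorem raiseX_mem_of_alg1 (hN : IsFixedModule (box I J L) (alg1 K) N) :
    ∀ f ∈ N, act (box I J L) (raiseX fun z => 3 * K z) f ∈ N := by
  rw [← raiseX_three]
  exact hN.stable_of_mem (by simp)

omit hB in
theorem vert_two_smul_mem_alg1 (K : ℝ → ℝ) : vert 0 1 ((2 : ℝ) • K) ∈ alg1 K := by
  have hxp : ((cx • vp, ofZ K) : DiffOp) ∈ alg1 K := Submodule.subset_span (by simp)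
  have hyq : ((cy • vq, ofZ K) : DiffOp) ∈ alg1 K := Submodule.subset_span (by simp)
  convert (alg1 K).add_mem hxp hyq using 1
  rw [← euler_eq_vert, Prod.mk_add_mk, Prod.mk.injEq]
  exact ⟨rfl, funext fun a => two_mul (K a.2.2)⟩

theorem alg1_exists_eq_neg_natCast (hK : ContDiffOn ℝ ∞ K L)
    (hN : IsFixedModule (box I J L) (alg1 K) N) (hlN : LocallyNontrivial (box I J L) N) :
    ∃ n : ℕ, ∀ z ∈ L, 3 * K z = -(n : ℝ) := by
  have hN' := hN.mono (span_sl2_le_alg1 K)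
  have hKc : ∀ l, ∀ g ∈ comp I J L N l, K * g ∈ comp I J L N l := by
    intro l g hg
    have hmem := mul_mem_comp_of_euler hB hN' (C := (2 : ℝ) • K) (hK.const_smul (2 : ℝ))
      (hN.stable _ (vert_two_smul_mem_alg1 K)) l g hg
    rwa [smul_mul_assoc, Submodule.smul_mem_iff _ two_ne_zero] at hmem
  obtain ⟨κ, hκ⟩ := const_of_locallyNontrivial hB hN' hlN hK hKc
  have hκ3 : ∀ z ∈ L, 3 * K z = 3 * κ := fun z hz => by rw [hκ z hz]
  obtain ⟨n, hn⟩ := exists_eq_neg_natCast hB hN' (hlN.ne_bot hB) hκ3 (raiseX_mem_of_alg1 hN)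
  exact ⟨n, fun z hz => (hκ3 z hz).trans hn⟩

section

variable {n : ℕ} (hK : ∀ z ∈ L, 3 * K z = -(n : ℝ))
include hK

theorem comp_eq_comp_zero_of_alg1 (hN : IsFixedModule (box I J L) (alg1 K) N) {l : ℕ}
    (hl : l ≤ n) : comp I J L N l = comp I J L N 0 :=
  comp_eq_comp_zero hB (hN.mono (span_sl2_le_alg1 K)) hK (raiseX_mem_of_alg1 hN)
    (hN.stable_of_mem (by simp)) hl

theorem isFixedModule_alg1_polyModule {G : ℕ → Submodule ℝ (ℝ → ℝ)} (hG : FiniteFamily L n G)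
    (hG0 : ∀ l ≤ n, G l = G 0) :
    IsFixedModule (box I J L) (alg1 K) (polyModule (box I J L) n G) := by
  have hstep : ∀ l < n, G l = G (l + 1) := fun l hl => (hG0 l hl.le).trans (hG0 (l + 1) hl).symm
  have hmul : ∀ l ≤ n, ∀ g ∈ G l, K * g ∈ G l := by
    intro l hl g hg
    have hKn : ∀ z ∈ L, K z = -(n : ℝ) / 3 := fun z hz => by rw [← hK z hz]; ring
    have hmul := smul_add_mul_eq_smul hKn ((hG l hl).1 hg) 0
    rw [zero_smul, zero_add] at hmul
    exact hmul ▸ (G l).smul_mem _ hg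
  refine isFixedModule_polyModule hB hG ?_
  rintro T (rfl | rfl | rfl | rfl | rfl | rfl | rfl | rfl | rfl)
  · exact preserves_vp hB hG fun l hl => (hstep l hl).ge
  · exact preserves_vq hB hG fun l hl => (hstep l hl).ge
  · exact preserves_xp_add hB hG hmul
  · exact preserves_yq_add hB hG hmul
  · exact preserves_xq hB hG
  · exact preserves_yp hB hG
  · rw [raiseX_three]
    exact preserves_raiseX hB hG hK fun l hl => (hstep l hl).le
  · rw [raiseY_three]
    exact preserves_raiseY hB hG hK fun l hl => (hstep l hl).le
  · exact preserves_one hG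

theorem isFixedModule_alg1_iff :
    IsFixedModule (box I J L) (alg1 K) N ↔
      ∃ G : ℕ → Submodule ℝ (ℝ → ℝ), FiniteFamily L n G ∧
        (∀ l < n, G (l + 1) ≤ G l) ∧ (∀ l ≤ n, G l = G 0) ∧
        N = polyModule (box I J L) n G := by
  constructor
  · intro hN
    have hN' := hN.mono (span_sl2_le_alg1 K)
    exact ⟨comp I J L N, finiteFamily_comp hB hN' n,
      fun l _ => comp_succ_le hB hN' (hN.stable_of_mem (by simp)) l,
      fun l hl => comp_eq_comp_zero_of_alg1 hB hK hN hl,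
      eq_polyModule_comp hB hN' fun l hl =>
        comp_eq_bot_of_lt hB hN' hK (raiseX_mem_of_alg1 hN) hl⟩
  · rintro ⟨G, hG, -, hG0, rfl⟩
    exact isFixedModule_alg1_polyModule hB hK hG hG0

theorem isFixedModule_alg1_polyModule_iff {G : ℕ → Submodule ℝ (ℝ → ℝ)}
    (hG : FiniteFamily L n G) :
    IsFixedModule (box I J L) (alg1 K) (polyModule (box I J L) n G) ↔ ∀ l ≤ n, G l = G 0 := by
  refine ⟨fun hN l hl => ?_, isFixedModule_alg1_polyModule hB hK hG⟩
  rw [← comp_polyModule hB hG hl, comp_eq_comp_zero_of_alg1 hB hK hN hl,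
    comp_polyModule hB hG n.zero_le]

end

end Alg1

section Lowers

variable (hB : IsOpenBox I J L) {S : Set (ℝ → ℝ)}
  {R : Set DiffOp} {N : Submodule ℝ (Space → ℝ)}
  (hN : IsFixedModule (box I J L) (Submodule.span ℝ (sl2 ∪ translations S ∪ R)) N)
include hB hN

theorem exists_const_of_euler_mem {C : ℝ → ℝ} (hC : ContDiffOn ℝ ∞ C L)
    (hR : (euler, ofZ C) ∈ R) (hlN : LocallyNontrivial (box I J L) N) :
    ∃ κ : ℝ, ∀ z ∈ L, C z = κ := by
  have hN' := hN.mono (span_sl2_le_span S R)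
  refine const_of_locallyNontrivial hB hN' hlN hC (mul_mem_comp_of_euler hB hN' hC ?_)
  rw [← euler_eq_vert]
  exact hN.stable_of_mem (Or.inr hR)

variable (hS : ∀ ζ ∈ S, ContDiffOn ℝ ∞ ζ L)
include hS

theorem lowers_comp (n : ℕ) : Lowers S n (comp I J L N) := fun ζ hζ l _ =>
  mul_mem_comp_of_vp hB (hN.mono (span_sl2_le_span S R)) (hS ζ hζ)
    (hN.stable_of_mem (Or.inl (Or.inr ⟨ζ, hζ, Or.inl rfl⟩))) l

theorem exists_eq_polyModule_of_lowers :
    ∃ (n : ℕ) (G : ℕ → Submodule ℝ (ℝ → ℝ)), FiniteFamily L n G ∧ Lowers S n G ∧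
      N = polyModule (box I J L) n G := by
  have hN' := hN.mono (span_sl2_le_span S R)
  obtain ⟨k, hk⟩ := comp_eq_bot_of_le hB hN'
  exact ⟨k, comp I J L N, finiteFamily_comp hB hN' k, lowers_comp hB hN hS k,
    eq_polyModule_comp hB hN' fun l hl => hk l hl.le⟩

end Lowers

section

variable (hB : IsOpenBox I J L)
include hB

theorem isFixedModule_iff_of_preserves {S : Set (ℝ → ℝ)} (hS : ∀ ζ ∈ S, ContDiffOn ℝ ∞ ζ L)
    {R : Set DiffOp} (hR : ∀ n G, FiniteFamily L n G → ∀ T ∈ R, Preserves I J L n G T)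
    (N : Submodule ℝ (Space → ℝ)) :
    IsFixedModule (box I J L) (Submodule.span ℝ (sl2 ∪ translations S ∪ R)) N ↔
      ∃ (n : ℕ) (G : ℕ → Submodule ℝ (ℝ → ℝ)), FiniteFamily L n G ∧ Lowers S n G ∧
        N = polyModule (box I J L) n G := by
  refine ⟨fun hN => exists_eq_polyModule_of_lowers hB hN hS, ?_⟩
  rintro ⟨n, G, hG, hlow, rfl⟩
  exact isFixedModule_polyModule_of_lowers hB hG hlow (hR n G hG)

theorem isFixedModule_alg2_iff {s : ℕ} {Z : Fin s → ℝ → ℝ} (hZ : ∀ i, ContDiffOn ℝ ∞ (Z i) L)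
    (N : Submodule ℝ (Space → ℝ)) :
    IsFixedModule (box I J L) (alg2 Z) N ↔
      ∃ (n : ℕ) (G : ℕ → Submodule ℝ (ℝ → ℝ)), FiniteFamily L n G ∧
        Lowers (Set.range Z) n G ∧ N = polyModule (box I J L) n G :=
  isFixedModule_iff_of_preserves hB (Set.forall_mem_range.2 hZ)
    (fun _ _ hG => forall_eq.2 (preserves_one hG)) N

theorem isFixedModule_alg3_iff {s : ℕ} {Z : Fin s → ℝ → ℝ} {K : ℝ → ℝ}
    (hZ : ∀ i, ContDiffOn ℝ ∞ (Z i) L) {κ : ℝ} (hK : ∀ z ∈ L, K z = κ)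
    (N : Submodule ℝ (Space → ℝ)) :
    IsFixedModule (box I J L) (alg3 Z K) N ↔
      ∃ (n : ℕ) (G : ℕ → Submodule ℝ (ℝ → ℝ)), FiniteFamily L n G ∧
        Lowers (Set.range Z) n G ∧ N = polyModule (box I J L) n G := by
  refine isFixedModule_iff_of_preserves hB (Set.forall_mem_range.2 hZ) (fun n G hG => ?_) N
  rintro T (rfl | rfl)
  · rw [euler_eq_vert]
    refine preserves_vert hB hG fun l hl g hg => ?_
    rw [zero_mul, zero_add, one_mul, smul_add_mul_eq_smul hK ((hG l hl).1 hg)]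
    exact (G l).smul_mem _ hg
  · exact preserves_one hG

theorem exists_eq_polyModule_of_sl3 {c : ℝ} {R : Set DiffOp} {N : Submodule ℝ (Space → ℝ)}
    (h0 : N ≠ ⊥) (hN : IsFixedModule (box I J L) (Submodule.span ℝ (sl3 c ∪ R)) N) :
    ∃ n : ℕ, c = -(n : ℝ) ∧ N = polyModule (box I J L) n fun _ => comp I J L N 0 := by
  have hN' := hN.mono (span_sl2_le_span_sl3 c R)
  have hraise : ∀ f ∈ N, act (box I J L) (raiseX fun _ => c) f ∈ N := by
    rw [← raiseX_const]
    exact hN.stable_of_mem (Or.inl (by simp [sl3]))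
  have hp : ∀ f ∈ N, act (box I J L) (vp, 0) f ∈ N :=
    hN.stable_of_mem (Or.inl (by simp [sl3]))
  obtain ⟨n, hn⟩ := exists_eq_neg_natCast hB hN' h0 (fun _ _ => rfl) hraise
  refine ⟨n, hn, ?_⟩
  rw [← polyModule_congr fun l hl => comp_eq_comp_zero hB hN' (fun _ _ => hn) hraise hp hl]
  exact eq_polyModule_comp hB hN' fun l hl => comp_eq_bot_of_lt hB hN' (fun _ _ => hn) hraise hl

omit hB in
theorem finiteFamily_of_eq_expModule {n : ℕ} {G : ℕ → Submodule ℝ (ℝ → ℝ)}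
    (hG : ∀ l ≤ n, ∃ (Λ : Finset ℂ) (m : ℂ → ℕ), G l = expModule L Λ m) : FiniteFamily L n G := by
  intro l hl
  obtain ⟨Λ, m, hGl⟩ := hG l hl
  rw [hGl]
  exact ⟨expModule_le_smoothFun L Λ m, finiteDimensional_expModule L Λ m⟩

theorem preserves_vr_of_eq_expModule {n : ℕ} {G : ℕ → Submodule ℝ (ℝ → ℝ)}
    (hG : ∀ l ≤ n, ∃ (Λ : Finset ℂ) (m : ℂ → ℕ), G l = expModule L Λ m) :
    Preserves I J L n G (vr, 0) := by
  refine preserves_vr hB (finiteFamily_of_eq_expModule hG) fun l hl => ?_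
  obtain ⟨Λ, m, hGl⟩ := hG l hl
  rw [hGl]
  exact dz_mem_expModule hB.oL Λ m

theorem comp_eq_expModule {N : Submodule ℝ (Space → ℝ)}
    (hN : IsFixedModule (box I J L) (Submodule.span ℝ sl2) N)
    (h : ∀ f ∈ N, act (box I J L) (vr, 0) f ∈ N) (l : ℕ) :
    ∃ (Λ : Finset ℂ) (m : ℂ → ℕ), comp I J L N l = expModule L Λ m := by
  have := (finiteFamily_comp hB hN l l le_rfl).2
  exact exists_eq_expModule hB.oL hB.cL hB.nL comp_le_smoothFun (dz_mem_comp hB hN h l)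

theorem isFixedModule_alg4_iff (c : ℝ) {N : Submodule ℝ (Space → ℝ)} (h0 : N ≠ ⊥) :
    IsFixedModule (box I J L) (alg4 c) N ↔
      ∃ (n : ℕ) (Λ : Finset ℂ) (m : ℂ → ℕ), c = -(n : ℝ) ∧
        N = polyModule (box I J L) n fun _ => expModule L Λ m := by
  constructor
  · intro hN
    obtain ⟨n, hn, hNn⟩ := exists_eq_polyModule_of_sl3 hB h0 hN
    obtain ⟨Λ, m, hcomp⟩ := comp_eq_expModule hB (hN.mono (span_sl2_le_span_sl3 c _))
      (hN.stable_of_mem (by simp)) 0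
    exact ⟨n, Λ, m, hn, by rwa [hcomp] at hNn⟩
  · rintro ⟨n, Λ, m, rfl, rfl⟩
    have hE : ∀ l ≤ n, ∃ (Λ' : Finset ℂ) (m' : ℂ → ℕ), expModule L Λ m = expModule L Λ' m' :=
      fun _ _ => ⟨Λ, m, rfl⟩
    have hG : FiniteFamily L n fun _ => expModule L Λ m := finiteFamily_of_eq_expModule hE
    refine isFixedModule_polyModule hB hG ?_
    rintro T (h | rfl | rfl)
    · exact preserves_sl3 hB hG (fun _ _ => rfl) T h
    · exact preserves_vr_of_eq_expModule hB hE
    · exact preserves_one hG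

omit hB in
theorem contDiffOn_of_mem_expMonomials {Λ : Finset ℂ} {m : ℂ → ℕ} :
    ∀ ζ ∈ expMonomials Λ m, ContDiffOn ℝ ∞ ζ L := by
  rintro _ ⟨lam, -, k, -, rfl | rfl⟩
  · exact (Complex.reCLM.contDiff.comp (contDiff_cexpMonomial lam k)).contDiffOn
  · exact (Complex.imCLM.contDiff.comp (contDiff_cexpMonomial lam k)).contDiffOn

theorem exists_eq_polyModule_of_vr_mem {Λ₀ : Finset ℂ} {ν : ℂ → ℕ} {R : Set DiffOp}
    {N : Submodule ℝ (Space → ℝ)} (hR : (vr, 0) ∈ R)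
    (hN : IsFixedModule (box I J L)
      (Submodule.span ℝ (sl2 ∪ translations (expMonomials Λ₀ ν) ∪ R)) N) :
    ∃ (n : ℕ) (G : ℕ → Submodule ℝ (ℝ → ℝ)),
      (∀ l ≤ n, ∃ (Λ : Finset ℂ) (m : ℂ → ℕ), G l = expModule L Λ m) ∧
      Lowers (expMonomials Λ₀ ν) n G ∧ N = polyModule (box I J L) n G := by
  have hN' := hN.mono (span_sl2_le_span _ R)
  obtain ⟨k, hk⟩ := comp_eq_bot_of_le hB hN'
  exact ⟨k, comp I J L N,
    fun l _ => comp_eq_expModule hB hN' (hN.stable_of_mem (Or.inr hR)) l,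
    lowers_comp hB hN contDiffOn_of_mem_expMonomials k,
    eq_polyModule_comp hB hN' fun l hl => hk l hl.le⟩

theorem isFixedModule_alg5_iff (Λ₀ : Finset ℂ) (ν : ℂ → ℕ) (N : Submodule ℝ (Space → ℝ)) :
    IsFixedModule (box I J L) (alg5 Λ₀ ν) N ↔
      ∃ (n : ℕ) (G : ℕ → Submodule ℝ (ℝ → ℝ)),
        (∀ l ≤ n, ∃ (Λ : Finset ℂ) (m : ℂ → ℕ), G l = expModule L Λ m) ∧
        Lowers (expMonomials Λ₀ ν) n G ∧ N = polyModule (box I J L) n G := by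
  refine ⟨exists_eq_polyModule_of_vr_mem hB (by simp), ?_⟩
  rintro ⟨n, G, hE, hlow, rfl⟩
  have hG := finiteFamily_of_eq_expModule hE
  refine isFixedModule_polyModule_of_lowers hB hG hlow ?_
  rintro T (rfl | rfl)
  · exact preserves_vr_of_eq_expModule hB hE
  · exact preserves_one hG

omit hB in
theorem eq_bot_of_id_mul_mem (hL : IsOpen L) {G : Submodule ℝ (ℝ → ℝ)} (hG : G ≤ smoothFun L)
    [FiniteDimensional ℝ G] (h : ∀ g ∈ G, id * g ∈ G) : G = ⊥ := by
  obtain ⟨P, hP, hPG⟩ := exists_aeval_mul_eq_zero h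
  refine (Submodule.eq_bot_iff G).2 fun g hg => smoothFun_ext (hG hg) (zero_mem _) fun z hzL => ?_
  by_contra hz
  have hne := (contDiffAt_of_mem_smoothFun hL (hG hg) hzL).continuousAt.eventually_ne hz
  refine infinite_of_mem_nhds z hne (P.roots.toFinset.finite_toSet.subset fun w hw => ?_)
  have hPw := congrFun (hPG g hg) w
  rw [Pi.mul_apply, Polynomial.aeval_pi_apply₂, Polynomial.coe_aeval_eq_eval] at hPw
  simpa [hP] using (mul_eq_zero.1 hPw).resolve_right hw

theorem eq_zero_of_euler_add_smul_cz {c : ℝ} {N : Submodule ℝ (Space → ℝ)} (h0 : N ≠ ⊥)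
    (hN : IsFixedModule (box I J L) (Submodule.span ℝ sl2) N)
    (h : ∀ f ∈ N, act (box I J L) (euler, c • cz) f ∈ N) : c = 0 := by
  by_contra hc
  obtain ⟨n, hn, -⟩ := exists_top hB hN h0
  have := (finiteFamily_comp hB hN n n le_rfl).2
  refine hn (eq_bot_of_id_mul_mem hB.oL comp_le_smoothFun fun g hg => ?_)
  rw [euler_smul_cz_eq_vert] at h
  have hmem := mul_mem_comp_of_euler hB hN (C := c • id) (contDiff_id.contDiffOn.const_smul c)
    h n g hg
  rwa [smul_mul_assoc, Submodule.smul_mem_iff _ hc] at hmem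

theorem isFixedModule_alg6_iff (Λ₀ : Finset ℂ) (ν : ℂ → ℕ) (c : ℝ)
    {N : Submodule ℝ (Space → ℝ)} (h0 : N ≠ ⊥) :
    IsFixedModule (box I J L) (alg6 Λ₀ ν c) N ↔
      c = 0 ∧ ∃ (n : ℕ) (G : ℕ → Submodule ℝ (ℝ → ℝ)),
        (∀ l ≤ n, ∃ (Λ : Finset ℂ) (m : ℂ → ℕ), G l = expModule L Λ m) ∧
        Lowers (expMonomials Λ₀ ν) n G ∧ N = polyModule (box I J L) n G := by
  constructor
  · intro hN
    exact ⟨eq_zero_of_euler_add_smul_cz hB h0 (hN.mono (span_sl2_le_span _ _))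
      (hN.stable_of_mem (by simp)), exists_eq_polyModule_of_vr_mem hB (by simp) hN⟩
  · rintro ⟨rfl, n, G, hE, hlow, rfl⟩
    have hG := finiteFamily_of_eq_expModule hE
    refine isFixedModule_polyModule_of_lowers hB hG hlow ?_
    rintro T (rfl | rfl | rfl)
    · rw [zero_smul]
      exact preserves_euler hB hG
    · exact preserves_vr_of_eq_expModule hB hE
    · exact preserves_one hG

end

end Cases

/-! ### Modules spanned by monomials -/

section Monomials

variable {I J L : Set ℝ}

theorem mono_indicator_pow (i j k : ℕ) :
    mono (box I J L) i j (L.indicator fun z => z ^ k)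
      = (box I J L).indicator (cx ^ i * cy ^ j * cz ^ k) := by
  ext a
  by_cases ha : a ∈ box I J L
  · rw [mono_apply ha]
    simp [ha, ha.2.2, cx, cy, cz]
  · simp [mono_of_notMem ha, ha]

theorem polyModule_powSpan (n : ℕ) (P : ℕ → ℕ → Prop) :
    polyModule (box I J L) n (fun d => powSpan L (P d))
      = monoModule (box I J L) {t | t.1 + t.2.1 ≤ n ∧ P (t.1 + t.2.1) t.2.2} := by
  apply le_antisymm
  · rw [polyModule, Submodule.span_le]
    rintro _ ⟨i, j, hij, g, hg, rfl⟩
    have hle : powSpan L (P (i + j))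
        ≤ (monoModule (box I J L) {t | t.1 + t.2.1 ≤ n ∧ P (t.1 + t.2.1) t.2.2}).comap
          (mono (box I J L) i j) := by
      rw [powSpan, Submodule.span_le]
      rintro _ ⟨k, hk, rfl⟩
      exact Submodule.subset_span ⟨i, j, k, ⟨hij, hk⟩, mono_indicator_pow i j k⟩
    exact hle hg
  · rw [monoModule, Submodule.span_le]
    rintro _ ⟨i, j, k, ⟨hij, hk⟩, rfl⟩
    rw [← mono_indicator_pow]
    exact mono_mem_polyModule hij (pow_mem_powSpan hk)

theorem powSpan_lt_zero (L : Set ℝ) : powSpan L (· < 0) = ⊥ := by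
  rw [powSpan, Submodule.span_eq_bot]
  rintro _ ⟨k, hk, -⟩
  exact absurd hk k.not_lt_zero

theorem pow_mul_mem_powSpan {P Q : ℕ → Prop} {e : ℕ} (h : ∀ k, P k → Q (e + k)) :
    ∀ g ∈ powSpan L P, (fun z => z ^ e) * g ∈ powSpan L Q := by
  have hle : powSpan L P ≤ (powSpan L Q).comap (LinearMap.mulLeft ℝ fun z : ℝ => z ^ e) := by
    rw [powSpan, Submodule.span_le]
    rintro _ ⟨k, hk, rfl⟩
    change (fun z : ℝ => z ^ e) * (L.indicator fun z => z ^ k) ∈ powSpan L Q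
    rw [pow_mul_indicator_pow]
    exact pow_mem_powSpan (h k hk)
  exact fun g hg => hle hg

theorem dz_mem_powSpan (hL : IsOpen L) {P : ℕ → Prop} (h : ∀ k, P (k + 1) → P k) :
    ∀ g ∈ powSpan L P, dz L g ∈ powSpan L P := by
  refine dz_mem_of_span hL (powSpan_le_smoothFun L P) ?_
  rintro _ ⟨k, hk, rfl⟩
  rw [dz_pow hL]
  rcases k with _ | k
  · simp
  · exact Submodule.smul_mem _ _ (pow_mem_powSpan (h k hk))

theorem id_mul_dz_add_pow (hL : IsOpen L) (b t : ℝ) (k : ℕ) :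
    id * dz L (L.indicator fun z => z ^ k) + t • ((fun _ => b) * L.indicator fun z => z ^ k)
        + 0 * (L.indicator fun z => z ^ k)
      = ((k : ℝ) + t * b) • L.indicator fun z => z ^ k := by
  ext z
  by_cases hz : z ∈ L
  · rw [dz_pow hL]
    rcases k with _ | k
    · simp [hz]
    · simp [hz]
      ring
  · simp [dz, hz]

theorem id_sq_mul_dz_add_pow (hL : IsOpen L) (b c t : ℝ) (k : ℕ) :
    id ^ 2 * dz L (L.indicator fun z => z ^ k) + t • ((b • id) * L.indicator fun z => z ^ k)
        + (c • id) * (L.indicator fun z => z ^ k)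
      = ((k : ℝ) + b * t + c) • L.indicator fun z => z ^ (k + 1) := by
  ext z
  by_cases hz : z ∈ L
  · rw [dz_pow hL]
    rcases k with _ | k <;> simp [hz] <;> ring
  · simp [dz, hz]

section Preserves

variable {n : ℕ} {P : ℕ → ℕ → Prop}

theorem finiteFamily_powSpan {b : ℕ} (hb : ∀ d ≤ n, ∀ k, P d k → k ≤ b) :
    FiniteFamily L n fun d => powSpan L (P d) := fun d hd =>
  ⟨powSpan_le_smoothFun L _, finiteDimensional_powSpan L (hb d hd)⟩

theorem lowers_powers {l : ℕ} (h : ∀ d < n, ∀ k, P (d + 1) k → ∀ e ≤ l, P d (e + k)) :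
    Lowers (powers l) n fun d => powSpan L (P d) := by
  rintro _ ⟨e, he, rfl⟩ d hd
  exact pow_mul_mem_powSpan fun k hk => h d hd k hk e he

variable (hB : IsOpenBox I J L) (hG : FiniteFamily L n fun d => powSpan L (P d))
include hB hG

theorem preserves_cz_vr_add (b : ℝ) :
    Preserves I J L n (fun d => powSpan L (P d)) (cz • vr + b • euler, 0) := by
  rw [cz_vr_add_eq_vert]
  refine preserves_vert hB hG fun d _ => vert_mem_of_span hB.oL (powSpan_le_smoothFun L _) ?_
  rintro _ ⟨k, hk, rfl⟩
  rw [id_mul_dz_add_pow hB.oL]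
  exact Submodule.smul_mem _ _ (pow_mem_powSpan hk)

theorem preserves_cz_vr : Preserves I J L n (fun d => powSpan L (P d)) (cz • vr, 0) := by
  simpa using preserves_cz_vr_add hB hG 0

theorem preserves_cz_sq_vr_add (b c : ℝ)
    (h : ∀ d ≤ n, ∀ k, P d k → P d (k + 1) ∨ (k : ℝ) + b * d + c = 0) :
    Preserves I J L n (fun d => powSpan L (P d)) (cz ^ 2 • vr + b • cz • euler, c • cz) := by
  rw [cz_sq_vr_add_eq_vert]
  refine preserves_vert hB hG fun d hd => vert_mem_of_span hB.oL (powSpan_le_smoothFun L _) ?_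
  rintro _ ⟨k, hk, rfl⟩
  rw [id_sq_mul_dz_add_pow hB.oL]
  rcases h d hd k hk with h | h
  · exact Submodule.smul_mem _ _ (pow_mem_powSpan h)
  · rw [h, zero_smul]
    exact zero_mem _

end Preserves

section Structure

variable (hB : IsOpenBox I J L)
include hB

theorem IsOpenBox.infinite : L.Infinite := by
  obtain ⟨z, hz⟩ := hB.nL
  exact infinite_of_mem_nhds z (hB.oL.mem_nhds hz)

section

variable {N : Submodule ℝ (Space → ℝ)}
  (hN : IsFixedModule (box I J L) (Submodule.span ℝ sl2) N)
include hN

theorem comp_eq_powSpan (hr : ∀ f ∈ N, act (box I J L) (vr, 0) f ∈ N) {b : ℝ}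
    (hzr : ∀ f ∈ N, act (box I J L) (cz • vr + b • euler, 0) f ∈ N) {d : ℕ}
    (hd : comp I J L N d ≠ ⊥) : ∃ m, comp I J L N d = powSpan L (· ≤ m) := by
  have := (finiteFamily_comp hB hN d d le_rfl).2
  obtain ⟨m, hm⟩ := exists_eq_powSpan hB.oL hB.cL comp_le_smoothFun (dz_mem_comp hB hN hr d)
    fun g hg => by
      have hmem := vert_mem_comp hB hN (A := id) (B := fun _ => b) (C := 0)
        contDiff_id.contDiffOn contDiffOn_const contDiffOn_const
        (by rwa [← cz_vr_add_eq_vert]) d g hg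
      have hbg : (fun _ => b) * g = b • g := rfl
      rwa [zero_mul, add_zero, hbg, Submodule.add_mem_iff_left _
        (Submodule.smul_mem _ _ (Submodule.smul_mem _ _ hg))] at hmem
  rcases m with _ | m
  · exact absurd (hm.trans (powSpan_lt_zero L)) hd
  · exact ⟨m, by simpa only [Nat.lt_succ_iff] using hm⟩

/-- The quadratic generator sends `x^d z^m` to `(m + bd + c) x^d z^(m+1)`, so it can only preserve a
component with top power `z^m` if that coefficient vanishes. -/
theorem add_add_eq_zero_of_comp_eq_powSpan {b c : ℝ}
    (h : ∀ f ∈ N, act (box I J L) (cz ^ 2 • vr + b • cz • euler, c • cz) f ∈ N) {d m : ℕ}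
    (hd : comp I J L N d = powSpan L (· ≤ m)) : (m : ℝ) + b * d + c = 0 := by
  have hmem := vert_mem_comp hB hN (A := id ^ 2) (B := b • id) (C := c • id)
    (contDiff_id.pow 2).contDiffOn (contDiff_id.contDiffOn.const_smul b)
    (contDiff_id.contDiffOn.const_smul c) (by rwa [← cz_sq_vr_add_eq_vert]) d
    (L.indicator fun z => z ^ m) (hd ▸ pow_mem_powSpan le_rfl)
  rw [id_sq_mul_dz_add_pow hB.oL, hd] at hmem
  by_contra hne
  have hle := le_of_pow_mem_powSpan hB.infinite ((Submodule.smul_mem_iff _ hne).1 hmem)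
  omega

end

section Lowers

variable {l : ℕ} {R : Set DiffOp} {N : Submodule ℝ (Space → ℝ)}
  (hN : IsFixedModule (box I J L) (Submodule.span ℝ (sl2 ∪ translations (powers l) ∪ R)) N)
include hN

theorem lowers_powers_comp (n : ℕ) : Lowers (powers l) n (comp I J L N) := by
  refine lowers_comp hB hN ?_ n
  rintro _ ⟨k, -, rfl⟩
  exact (contDiff_id.pow k).contDiffOn

theorem antitone_comp : Antitone (comp I J L N) :=
  antitone_nat_of_succ_le fun d g hg => by
    have h1 : (1 : ℝ → ℝ) ∈ powers l := ⟨0, l.zero_le, funext fun z => (pow_zero z).symm⟩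
    simpa using lowers_powers_comp hB hN (d + 1) 1 h1 d d.lt_succ_self g hg

theorem add_le_of_comp_eq_powSpan {d m m' : ℕ} (hm : comp I J L N d = powSpan L (· ≤ m))
    (hm' : comp I J L N (d + 1) = powSpan L (· ≤ m')) : l + m' ≤ m := by
  have hmem := lowers_powers_comp hB hN (d + 1) _ ⟨l, le_rfl, rfl⟩ d d.lt_succ_self
    (L.indicator fun z => z ^ m') (hm' ▸ pow_mem_powSpan le_rfl)
  rw [pow_mul_indicator_pow, hm] at hmem
  exact le_of_pow_mem_powSpan hB.infinite hmem

theorem exists_eq_monoModule_of_lowers (h0 : N ≠ ⊥) (hr : (vr, 0) ∈ R) {b : ℝ}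
    (hzr : (cz • vr + b • euler, 0) ∈ R) :
    ∃ (n : ℕ) (μ : ℕ → ℕ), (∀ d < n, l + μ (d + 1) ≤ μ d) ∧
      (∀ d ≤ n, comp I J L N d = powSpan L (· ≤ μ d)) ∧
      N = monoModule (box I J L) {t | t.1 + t.2.1 ≤ n ∧ t.2.2 ≤ μ (t.1 + t.2.1)} := by
  have hN' := hN.mono (span_sl2_le_span _ R)
  obtain ⟨n, hn, htop⟩ := exists_top hB hN' h0
  have hne : ∀ d ≤ n, comp I J L N d ≠ ⊥ := fun d hd =>
    ne_bot_of_le_ne_bot hn (antitone_comp hB hN hd)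
  choose! μ hμ using fun d (hd : d ≤ n) => comp_eq_powSpan hB hN'
    (hN.stable_of_mem (Or.inr hr)) (hN.stable_of_mem (Or.inr hzr)) (hne d hd)
  refine ⟨n, μ, fun d hd => add_le_of_comp_eq_powSpan hB hN (hμ d hd.le) (hμ (d + 1) hd), hμ, ?_⟩
  rw [← polyModule_powSpan n fun d k => k ≤ μ d, ← polyModule_congr hμ]
  exact eq_polyModule_comp hB hN' htop

end Lowers

theorem exists_eq_monoModule_of_sl3 {c : ℝ} {R : Set DiffOp} {N : Submodule ℝ (Space → ℝ)}
    (h0 : N ≠ ⊥) (hN : IsFixedModule (box I J L) (Submodule.span ℝ (sl3 c ∪ R)) N)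
    (hr : (vr, 0) ∈ R) (hzr : (cz • vr, 0) ∈ R) :
    ∃ n m : ℕ, c = -(n : ℝ) ∧ comp I J L N 0 = powSpan L (· ≤ m) ∧
      N = monoModule (box I J L) {t | t.1 + t.2.1 ≤ n ∧ t.2.2 ≤ m} := by
  obtain ⟨n, hn, hNn⟩ := exists_eq_polyModule_of_sl3 hB h0 hN
  have hne : comp I J L N 0 ≠ ⊥ := by
    intro hbot
    rw [hbot, polyModule_bot] at hNn
    exact h0 hNn
  obtain ⟨m, hm⟩ := comp_eq_powSpan hB (hN.mono (span_sl2_le_span_sl3 c R)) (b := 0)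
    (hN.stable_of_mem (Or.inr hr)) (by simpa using hN.stable_of_mem (Or.inr hzr)) hne
  rw [hm, polyModule_powSpan n fun _ k => k ≤ m] at hNn
  exact ⟨n, m, hn, hm, hNn⟩

end Structure

end Monomials

/-! ### Algebras with polynomial coefficients -/

section Cases

variable {I J L : Set ℝ} (hB : IsOpenBox I J L)
include hB

theorem isFixedModule_monoModule_of_sl3 {n m : ℕ} {R : Set DiffOp}
    (hR : ∀ T ∈ R, Preserves I J L n (fun _ => powSpan L (· ≤ m)) T) :
    IsFixedModule (box I J L) (Submodule.span ℝ (sl3 (-(n : ℝ)) ∪ R))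
      (monoModule (box I J L) {t | t.1 + t.2.1 ≤ n ∧ t.2.2 ≤ m}) := by
  have hG : FiniteFamily L n fun _ => powSpan L (· ≤ m) := finiteFamily_powSpan fun _ _ _ h => h
  rw [← polyModule_powSpan n fun _ k => k ≤ m]
  refine isFixedModule_polyModule hB hG ?_
  rintro T (hT | hT)
  · exact preserves_sl3 hB hG (fun _ _ => rfl) T hT
  · exact hR T hT

theorem isFixedModule_alg7_iff (c : ℝ) {N : Submodule ℝ (Space → ℝ)} (h0 : N ≠ ⊥) :
    IsFixedModule (box I J L) (alg7 c) N ↔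
      ∃ n m : ℕ, c = -(n : ℝ) ∧
        N = monoModule (box I J L) {t | t.1 + t.2.1 ≤ n ∧ t.2.2 ≤ m} := by
  constructor
  · intro hN
    obtain ⟨n, m, hn, -, hNn⟩ := exists_eq_monoModule_of_sl3 hB h0 hN (by simp) (by simp)
    exact ⟨n, m, hn, hNn⟩
  · rintro ⟨n, m, rfl, rfl⟩
    have hG : FiniteFamily L n fun _ => powSpan L (· ≤ m) := finiteFamily_powSpan fun _ _ _ h => h
    refine isFixedModule_monoModule_of_sl3 hB ?_
    rintro T (rfl | rfl | rfl)
    · exact preserves_vr hB hG fun _ _ => dz_mem_powSpan hB.oL fun k hk => by omega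
    · exact preserves_cz_vr hB hG
    · exact preserves_one hG

theorem isFixedModule_alg10_iff (c d : ℝ) {N : Submodule ℝ (Space → ℝ)} (h0 : N ≠ ⊥) :
    IsFixedModule (box I J L) (alg10 c d) N ↔
      ∃ n m : ℕ, c = -(n : ℝ) ∧ d = -(m : ℝ) ∧
        N = monoModule (box I J L) {t | t.1 + t.2.1 ≤ n ∧ t.2.2 ≤ m} := by
  have hquad : ((cz ^ 2 • vr, d • cz) : DiffOp)
      = (cz ^ 2 • vr + (0 : ℝ) • cz • euler, d • cz) := by rw [zero_smul, add_zero]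
  constructor
  · intro hN
    obtain ⟨n, m, hn, hm, hNn⟩ := exists_eq_monoModule_of_sl3 hB h0 hN (by simp) (by simp)
    have hz2r : ∀ f ∈ N, act (box I J L) (cz ^ 2 • vr, d • cz) f ∈ N := hN.stable_of_mem (by simp)
    rw [hquad] at hz2r
    have hdm := add_add_eq_zero_of_comp_eq_powSpan hB
      (hN.mono (span_sl2_le_span_sl3 c _)) hz2r hm
    exact ⟨n, m, hn, by linarith, hNn⟩
  · rintro ⟨n, m, rfl, rfl, rfl⟩
    have hG : FiniteFamily L n fun _ => powSpan L (· ≤ m) := finiteFamily_powSpan fun _ _ _ h => h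
    refine isFixedModule_monoModule_of_sl3 hB ?_
    rintro T (rfl | rfl | rfl | rfl)
    · exact preserves_vr hB hG fun _ _ => dz_mem_powSpan hB.oL fun k hk => by omega
    · exact preserves_cz_vr hB hG
    · rw [hquad]
      refine preserves_cz_sq_vr_add hB hG 0 (-(m : ℝ)) fun _ _ k hk => ?_
      rcases hk.lt_or_eq with hlt | rfl
      · exact Or.inl hlt
      · exact Or.inr (by ring)
    · exact preserves_one hG

section Lowers

variable {l n b : ℕ} {P : ℕ → ℕ → Prop} (hb : ∀ d ≤ n, ∀ k, P d k → k ≤ b)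
  (hP : ∀ d < n, ∀ k, P (d + 1) k → ∀ e ≤ l, P d (e + k))
include hb hP

theorem isFixedModule_monoModule_of_lowers {R : Set DiffOp}
    (hR : ∀ T ∈ R, Preserves I J L n (fun d => powSpan L (P d)) T) :
    IsFixedModule (box I J L) (Submodule.span ℝ (sl2 ∪ translations (powers l) ∪ R))
      (monoModule (box I J L) {t | t.1 + t.2.1 ≤ n ∧ P (t.1 + t.2.1) t.2.2}) := by
  rw [← polyModule_powSpan]
  exact isFixedModule_polyModule_of_lowers hB (finiteFamily_powSpan hb) (lowers_powers hP) hR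

variable (hdz : ∀ d k, P d (k + 1) → P d k)
include hdz

theorem isFixedModule_alg8_monoModule (a : ℝ) :
    IsFixedModule (box I J L) (alg8 l a)
      (monoModule (box I J L) {t | t.1 + t.2.1 ≤ n ∧ P (t.1 + t.2.1) t.2.2}) := by
  have hG : FiniteFamily L n fun d => powSpan L (P d) := finiteFamily_powSpan hb
  refine isFixedModule_monoModule_of_lowers hB hb hP ?_
  rintro T (rfl | rfl | rfl)
  · exact preserves_vr hB hG fun d _ => dz_mem_powSpan hB.oL (hdz d)
  · exact preserves_cz_vr_add hB hG a
  · exact preserves_one hG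

theorem isFixedModule_alg9_monoModule :
    IsFixedModule (box I J L) (alg9 l)
      (monoModule (box I J L) {t | t.1 + t.2.1 ≤ n ∧ P (t.1 + t.2.1) t.2.2}) := by
  have hG : FiniteFamily L n fun d => powSpan L (P d) := finiteFamily_powSpan hb
  refine isFixedModule_monoModule_of_lowers hB hb hP ?_
  rintro T (rfl | rfl | rfl | rfl)
  · exact preserves_euler hB hG
  · exact preserves_vr hB hG fun d _ => dz_mem_powSpan hB.oL (hdz d)
  · exact preserves_cz_vr hB hG
  · exact preserves_one hG

end Lowers

omit hB in
theorem le_of_mul_add_le {l n m : ℕ} : ∀ d ≤ n, ∀ k, l * d + k ≤ m → k ≤ m :=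
  fun _ _ _ h => by omega

omit hB in
theorem mul_add_add_le {l n m : ℕ} :
    ∀ d < n, ∀ k, l * (d + 1) + k ≤ m → ∀ e ≤ l, l * d + (e + k) ≤ m := by
  intro d _ k h e he
  rw [mul_add_one] at h
  omega

theorem isFixedModule_alg8_graded (l : ℕ) (a : ℝ) (n m : ℕ) :
    IsFixedModule (box I J L) (alg8 l a)
      (monoModule (box I J L) {t | t.1 + t.2.1 ≤ n ∧ l * (t.1 + t.2.1) + t.2.2 ≤ m}) :=
  isFixedModule_alg8_monoModule hB (P := fun d k => l * d + k ≤ m) le_of_mul_add_le mul_add_add_le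
    (fun d k h => by omega) a

theorem isFixedModule_alg9_graded (l : ℕ) (n m : ℕ) :
    IsFixedModule (box I J L) (alg9 l)
      (monoModule (box I J L) {t | t.1 + t.2.1 ≤ n ∧ l * (t.1 + t.2.1) + t.2.2 ≤ m}) :=
  isFixedModule_alg9_monoModule hB (P := fun d k => l * d + k ≤ m) le_of_mul_add_le mul_add_add_le
    (fun d k h => by omega)

section Filtered

variable {l n : ℕ} {μ : ℕ → ℕ} (hμ : ∀ d < n, l + μ (d + 1) ≤ μ d)
include hμ

omit hB in
theorem le_zero_of_add_le : ∀ d ≤ n, ∀ k, k ≤ μ d → k ≤ μ 0 := by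
  intro d hd k hk
  induction d with
  | zero => exact hk
  | succ d ih =>
    have := hμ d hd
    exact ih (by omega) (by omega)

omit hB in
theorem add_le_of_add_le : ∀ d < n, ∀ k, k ≤ μ (d + 1) → ∀ e ≤ l, e + k ≤ μ d := by
  intro d hd k hk e he
  have := hμ d hd
  omega

end Filtered

theorem isFixedModule_alg8_iff (l : ℕ) (a : ℝ) {N : Submodule ℝ (Space → ℝ)} (h0 : N ≠ ⊥) :
    IsFixedModule (box I J L) (alg8 l a) N ↔
      ∃ (n : ℕ) (μ : ℕ → ℕ), (∀ d < n, l + μ (d + 1) ≤ μ d) ∧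
        N = monoModule (box I J L) {t | t.1 + t.2.1 ≤ n ∧ t.2.2 ≤ μ (t.1 + t.2.1)} := by
  constructor
  · intro hN
    obtain ⟨n, μ, hμ, -, hNn⟩ := exists_eq_monoModule_of_lowers hB hN h0 (by simp) (b := a)
      (by simp)
    exact ⟨n, μ, hμ, hNn⟩
  · rintro ⟨n, μ, hμ, rfl⟩
    exact isFixedModule_alg8_monoModule hB (P := fun d k => k ≤ μ d) (le_zero_of_add_le hμ)
      (add_le_of_add_le hμ) (fun d k h => by omega) a

theorem isFixedModule_alg9_iff (l : ℕ) {N : Submodule ℝ (Space → ℝ)} (h0 : N ≠ ⊥) :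
    IsFixedModule (box I J L) (alg9 l) N ↔
      ∃ (n : ℕ) (μ : ℕ → ℕ), (∀ d < n, l + μ (d + 1) ≤ μ d) ∧
        N = monoModule (box I J L) {t | t.1 + t.2.1 ≤ n ∧ t.2.2 ≤ μ (t.1 + t.2.1)} := by
  constructor
  · intro hN
    obtain ⟨n, μ, hμ, -, hNn⟩ := exists_eq_monoModule_of_lowers hB hN h0 (by simp) (b := 0)
      (by simp)
    exact ⟨n, μ, hμ, hNn⟩
  · rintro ⟨n, μ, hμ, rfl⟩
    exact isFixedModule_alg9_monoModule hB (P := fun d k => k ≤ μ d) (le_zero_of_add_le hμ)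
      (add_le_of_add_le hμ) (fun d k h => by omega)

theorem exists_eq_monoModule_of_cz_sq {l : ℕ} {R : Set DiffOp} {N : Submodule ℝ (Space → ℝ)}
    (h0 : N ≠ ⊥)
    (hN : IsFixedModule (box I J L) (Submodule.span ℝ (sl2 ∪ translations (powers l) ∪ R)) N)
    (hr : (vr, 0) ∈ R) {b c : ℝ} (hzr : (cz • vr + b • euler, 0) ∈ R)
    (hz2r : (cz ^ 2 • vr + (l : ℝ) • cz • euler, c • cz) ∈ R) :
    ∃ n m : ℕ, c = -(m : ℝ) ∧
      N = monoModule (box I J L) {t | t.1 + t.2.1 ≤ n ∧ l * (t.1 + t.2.1) + t.2.2 ≤ m} := by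
  obtain ⟨n, μ, -, hμ, hNn⟩ := exists_eq_monoModule_of_lowers hB hN h0 hr hzr
  have hcoeff : ∀ d ≤ n, (μ d : ℝ) + l * d + c = 0 := fun d hd =>
    add_add_eq_zero_of_comp_eq_powSpan hB (hN.mono (span_sl2_le_span _ R))
      (hN.stable_of_mem (Or.inr hz2r)) (hμ d hd)
  have hc : c = -(μ 0 : ℝ) := by
    have := hcoeff 0 n.zero_le
    push_cast at this
    linarith
  have hμ0 : ∀ d ≤ n, μ d + l * d = μ 0 := fun d hd => by
    have := hcoeff d hd
    rw [hc, add_neg_eq_zero] at this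
    exact_mod_cast this
  refine ⟨n, μ 0, hc, hNn.trans (congrArg _ (Set.ext fun t => and_congr_right fun ht => ?_))⟩
  rw [← hμ0 _ ht]
  omega

omit hB in
theorem mul_add_succ_le_or_eq_zero {l m : ℕ} (d k : ℕ) (h : l * d + k ≤ m) :
    l * d + (k + 1) ≤ m ∨ (k : ℝ) + l * d + -(m : ℝ) = 0 := by
  rcases h.lt_or_eq with hlt | rfl
  · exact Or.inl hlt
  · right
    push_cast
    ring

theorem preserves_cz_sq_vr_add_graded (l n m : ℕ) :
    Preserves I J L n (fun d => powSpan L fun k => l * d + k ≤ m)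
      (cz ^ 2 • vr + (l : ℝ) • cz • euler, -(m : ℝ) • cz) :=
  preserves_cz_sq_vr_add hB (P := fun d k => l * d + k ≤ m) (finiteFamily_powSpan le_of_mul_add_le)
    _ _ fun d _ => mul_add_succ_le_or_eq_zero d

theorem isFixedModule_alg11_iff (l : ℕ) (c : ℝ) {N : Submodule ℝ (Space → ℝ)} (h0 : N ≠ ⊥) :
    IsFixedModule (box I J L) (alg11 l c) N ↔
      ∃ n m : ℕ, c = -(m : ℝ) ∧
        N = monoModule (box I J L)
          {t | t.1 + t.2.1 ≤ n ∧ l * (t.1 + t.2.1) + t.2.2 ≤ m} := by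
  constructor
  · intro hN
    exact exists_eq_monoModule_of_cz_sq hB h0 hN (by simp) (b := (l : ℝ) / 2) (by simp) (by simp)
  · rintro ⟨n, m, rfl, rfl⟩
    have hG : FiniteFamily L n fun d => powSpan L fun k => l * d + k ≤ m :=
      finiteFamily_powSpan le_of_mul_add_le
    refine isFixedModule_monoModule_of_lowers hB (P := fun d k => l * d + k ≤ m)
      le_of_mul_add_le mul_add_add_le ?_
    rintro T (rfl | rfl | rfl | rfl)
    · exact preserves_vr hB hG fun d _ => dz_mem_powSpan hB.oL fun k hk => by omega
    · exact preserves_cz_vr_add hB hG _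
    · exact preserves_cz_sq_vr_add_graded hB l n m
    · exact preserves_one hG

theorem isFixedModule_alg12_iff (l : ℕ) (c : ℝ) {N : Submodule ℝ (Space → ℝ)} (h0 : N ≠ ⊥) :
    IsFixedModule (box I J L) (alg12 l c) N ↔
      ∃ n m : ℕ, c = -(m : ℝ) ∧
        N = monoModule (box I J L)
          {t | t.1 + t.2.1 ≤ n ∧ l * (t.1 + t.2.1) + t.2.2 ≤ m} := by
  constructor
  · intro hN
    exact exists_eq_monoModule_of_cz_sq hB h0 hN (by simp) (b := 0) (by simp) (by simp)
  · rintro ⟨n, m, rfl, rfl⟩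
    have hG : FiniteFamily L n fun d => powSpan L fun k => l * d + k ≤ m :=
      finiteFamily_powSpan le_of_mul_add_le
    refine isFixedModule_monoModule_of_lowers hB (P := fun d k => l * d + k ≤ m)
      le_of_mul_add_le mul_add_add_le ?_
    rintro T (rfl | rfl | rfl | rfl | rfl)
    · exact preserves_euler hB hG
    · exact preserves_vr hB hG fun d _ => dz_mem_powSpan hB.oL fun k hk => by omega
    · exact preserves_cz_vr hB hG
    · exact preserves_cz_sq_vr_add_graded hB l n m
    · exact preserves_one hG

end Cases

end QES

end

theorem mainTheorem3 (I J L : Set ℝ)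
    (hIo : IsOpen I) (hIc : I.OrdConnected) (hIn : I.Nonempty)
    (hJo : IsOpen J) (hJc : J.OrdConnected) (hJn : J.Nonempty)
    (hLo : IsOpen L) (hLc : L.OrdConnected) (hLn : L.Nonempty) :
    -- case 1
    (∀ K : ℝ → ℝ, ContDiffOn ℝ ∞ K L →
      (∀ N, QES.IsFixedModule (QES.box I J L) (QES.alg1 K) N →
        QES.LocallyNontrivial (QES.box I J L) N →
        ∃ n : ℕ, ∀ z ∈ L, 3 * K z = -(n : ℝ)) ∧
      (∀ n : ℕ, (∀ z ∈ L, 3 * K z = -(n : ℝ)) →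
        (∀ N, QES.IsFixedModule (QES.box I J L) (QES.alg1 K) N ↔
          ∃ G : ℕ → Submodule ℝ (ℝ → ℝ), QES.FiniteFamily L n G ∧
            (∀ l < n, G (l + 1) ≤ G l) ∧ (∀ l ≤ n, G l = G 0) ∧
            N = QES.polyModule (QES.box I J L) n G) ∧
        (∀ G : ℕ → Submodule ℝ (ℝ → ℝ), QES.FiniteFamily L n G → (∀ l < n, G (l + 1) ≤ G l) →
          (QES.IsFixedModule (QES.box I J L) (QES.alg1 K)
              (QES.polyModule (QES.box I J L) n G) ↔
            ∀ l ≤ n, G l = G 0)))) ∧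
    -- case 2
    (∀ (s : ℕ) (Z : Fin s → ℝ → ℝ), (∀ i, ContDiffOn ℝ ∞ (Z i) L) →
      ∀ N, QES.IsFixedModule (QES.box I J L) (QES.alg2 Z) N ↔
        ∃ (n : ℕ) (G : ℕ → Submodule ℝ (ℝ → ℝ)), QES.FiniteFamily L n G ∧
          QES.Lowers (Set.range Z) n G ∧ N = QES.polyModule (QES.box I J L) n G) ∧
    -- case 3
    (∀ (s : ℕ) (Z : Fin s → ℝ → ℝ) (K : ℝ → ℝ), (∀ i, ContDiffOn ℝ ∞ (Z i) L) →
      ContDiffOn ℝ ∞ K L →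
      (∀ N, QES.IsFixedModule (QES.box I J L) (QES.alg3 Z K) N →
        QES.LocallyNontrivial (QES.box I J L) N → ∃ κ : ℝ, ∀ z ∈ L, K z = κ) ∧
      (∀ κ : ℝ, (∀ z ∈ L, K z = κ) →
        ∀ N, QES.IsFixedModule (QES.box I J L) (QES.alg3 Z K) N ↔
          ∃ (n : ℕ) (G : ℕ → Submodule ℝ (ℝ → ℝ)), QES.FiniteFamily L n G ∧
            QES.Lowers (Set.range Z) n G ∧ N = QES.polyModule (QES.box I J L) n G)) ∧
    -- case 4
    (∀ (c : ℝ) (N : Submodule ℝ (QES.Space → ℝ)), N ≠ ⊥ →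
      (QES.IsFixedModule (QES.box I J L) (QES.alg4 c) N ↔
        ∃ (n : ℕ) (Λ : Finset ℂ) (m : ℂ → ℕ), c = -(n : ℝ) ∧
          N = QES.polyModule (QES.box I J L) n (fun _ => QES.expModule L Λ m))) ∧
    -- case 5
    (∀ (Λ₀ : Finset ℂ) (ν : ℂ → ℕ) (N : Submodule ℝ (QES.Space → ℝ)),
      QES.IsFixedModule (QES.box I J L) (QES.alg5 Λ₀ ν) N ↔
        ∃ (n : ℕ) (G : ℕ → Submodule ℝ (ℝ → ℝ)),
          (∀ l ≤ n, ∃ (Λ : Finset ℂ) (m : ℂ → ℕ), G l = QES.expModule L Λ m) ∧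
          QES.Lowers (QES.expMonomials Λ₀ ν) n G ∧
          N = QES.polyModule (QES.box I J L) n G) ∧
    -- case 6
    (∀ (Λ₀ : Finset ℂ) (ν : ℂ → ℕ) (c : ℝ) (N : Submodule ℝ (QES.Space → ℝ)), N ≠ ⊥ →
      (QES.IsFixedModule (QES.box I J L) (QES.alg6 Λ₀ ν c) N ↔
        c = 0 ∧ ∃ (n : ℕ) (G : ℕ → Submodule ℝ (ℝ → ℝ)),
          (∀ l ≤ n, ∃ (Λ : Finset ℂ) (m : ℂ → ℕ), G l = QES.expModule L Λ m) ∧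
          QES.Lowers (QES.expMonomials Λ₀ ν) n G ∧
          N = QES.polyModule (QES.box I J L) n G)) ∧
    -- case 7
    (∀ (c : ℝ) (N : Submodule ℝ (QES.Space → ℝ)), N ≠ ⊥ →
      (QES.IsFixedModule (QES.box I J L) (QES.alg7 c) N ↔
        ∃ n m : ℕ, c = -(n : ℝ) ∧
          N = QES.monoModule (QES.box I J L) {t | t.1 + t.2.1 ≤ n ∧ t.2.2 ≤ m})) ∧
    -- case 8
    (∀ (l : ℕ) (a : ℝ),
      (∀ n m : ℕ, QES.IsFixedModule (QES.box I J L) (QES.alg8 l a)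
        (QES.monoModule (QES.box I J L)
          {t | t.1 + t.2.1 ≤ n ∧ l * (t.1 + t.2.1) + t.2.2 ≤ m})) ∧
      (∀ N : Submodule ℝ (QES.Space → ℝ), N ≠ ⊥ →
        (QES.IsFixedModule (QES.box I J L) (QES.alg8 l a) N ↔
          ∃ (n : ℕ) (μ : ℕ → ℕ), (∀ d < n, l + μ (d + 1) ≤ μ d) ∧
            N = QES.monoModule (QES.box I J L)
              {t | t.1 + t.2.1 ≤ n ∧ t.2.2 ≤ μ (t.1 + t.2.1)}))) ∧
    -- case 9
    (∀ l : ℕ,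
      (∀ n m : ℕ, QES.IsFixedModule (QES.box I J L) (QES.alg9 l)
        (QES.monoModule (QES.box I J L)
          {t | t.1 + t.2.1 ≤ n ∧ l * (t.1 + t.2.1) + t.2.2 ≤ m})) ∧
      (∀ N : Submodule ℝ (QES.Space → ℝ), N ≠ ⊥ →
        (QES.IsFixedModule (QES.box I J L) (QES.alg9 l) N ↔
          ∃ (n : ℕ) (μ : ℕ → ℕ), (∀ d < n, l + μ (d + 1) ≤ μ d) ∧
            N = QES.monoModule (QES.box I J L)
              {t | t.1 + t.2.1 ≤ n ∧ t.2.2 ≤ μ (t.1 + t.2.1)}))) ∧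
    -- case 10
    (∀ (c d : ℝ) (N : Submodule ℝ (QES.Space → ℝ)), N ≠ ⊥ →
      (QES.IsFixedModule (QES.box I J L) (QES.alg10 c d) N ↔
        ∃ n m : ℕ, c = -(n : ℝ) ∧ d = -(m : ℝ) ∧
          N = QES.monoModule (QES.box I J L) {t | t.1 + t.2.1 ≤ n ∧ t.2.2 ≤ m})) ∧
    -- case 11
    (∀ (l : ℕ) (c : ℝ) (N : Submodule ℝ (QES.Space → ℝ)), N ≠ ⊥ →
      (QES.IsFixedModule (QES.box I J L) (QES.alg11 l c) N ↔
        ∃ n m : ℕ, c = -(m : ℝ) ∧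
          N = QES.monoModule (QES.box I J L)
            {t | t.1 + t.2.1 ≤ n ∧ l * (t.1 + t.2.1) + t.2.2 ≤ m})) ∧
    -- case 12
    (∀ (l : ℕ) (c : ℝ) (N : Submodule ℝ (QES.Space → ℝ)), N ≠ ⊥ →
      (QES.IsFixedModule (QES.box I J L) (QES.alg12 l c) N ↔
        ∃ n m : ℕ, c = -(m : ℝ) ∧
          N = QES.monoModule (QES.box I J L)
            {t | t.1 + t.2.1 ≤ n ∧ l * (t.1 + t.2.1) + t.2.2 ≤ m})) := by
  have hB : QES.IsOpenBox I J L := ⟨hIo, hIc, hIn, hJo, hJc, hJn, hLo, hLc, hLn⟩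
  refine ⟨fun K hK => ⟨fun N hN hlN => QES.alg1_exists_eq_neg_natCast hB hK hN hlN, fun n hn =>
      ⟨fun N => QES.isFixedModule_alg1_iff hB hn,
        fun G hG _ => QES.isFixedModule_alg1_polyModule_iff hB hn hG⟩⟩,
    fun s Z hZ N => QES.isFixedModule_alg2_iff hB hZ N,
    fun s Z K hZ hK => ⟨fun N hN hlN =>
        QES.exists_const_of_euler_mem hB hN hK (Set.mem_insert _ _) hlN,
      fun κ hκ N => QES.isFixedModule_alg3_iff hB hZ hκ N⟩,
    fun c N h0 => QES.isFixedModule_alg4_iff hB c h0,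
    fun Λ₀ ν N => QES.isFixedModule_alg5_iff hB Λ₀ ν N,
    fun Λ₀ ν c N h0 => QES.isFixedModule_alg6_iff hB Λ₀ ν c h0,
    fun c N h0 => QES.isFixedModule_alg7_iff hB c h0,
    fun l a => ⟨QES.isFixedModule_alg8_graded hB l a,
      fun N h0 => QES.isFixedModule_alg8_iff hB l a h0⟩,
    fun l => ⟨QES.isFixedModule_alg9_graded hB l, fun N h0 => QES.isFixedModule_alg9_iff hB l h0⟩,
    fun c d N h0 => QES.isFixedModule_alg10_iff hB c d h0,
    fun l c N h0 => QES.isFixedModule_alg11_iff hB l c h0,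
    fun l c N h0 => QES.isFixedModule_alg12_iff hB l c h0⟩
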